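/- Let $N$ be a natural number and let $l, l_0,l_1,l_2,l_3$ be real numbers with $l,l_0,l_1\ge 0$. For $\tau$ in the upper half plane let $\wp$ be the Weierstrass function with periods $(1,\tau)$, let $\omega_0=0$, $\omega_1=\frac12$, $\omega_2=-\frac{\tau+1}{2}$, $\omega_3=\frac{\tau}{2}$, and put $p=\exp(\pi\sqrt{-1}\,\tau)$. For $0<|p|<1$ consider $$H(p)=-\sum_{j=1}^N\frac{\partial^2}{\partial x_j^2}+\sum_{j=1}^N\sum_{i=0}^3 l_i(l_i+1)\wp(x_j+\omega_i)+2l(l+1)\sum_{1\le j<k\le N}\bigl(\wp(x_j-x_k)+\wp(x_j+x_k)\bigr),$$ and let $H(0)=H_T+C_T$, where $$H_T=-\sum_{j=1}^N\frac{\partial^2}{\partial x_j^2}+\sum_{j<k}\Bigl(\frac{2\pi^2l(l+1)}{\sin^2\pi(x_j-x_k)}+\frac{2\pi^2l(l+1)}{\sin^2\pi(x_j+x_k)}\Bigr)+\sum_{j=1}^N\Bigl(\frac{\pi^2l_0(l_0+1)}{\sin^2\pi x_j}+\frac{\pi^2l_1(l_1+1)}{\cos^2\pi x_j}\Bigr),$$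 $$C_T=-\frac{2N(N-1)\pi^2}{3}\,l(l+1)-\frac{N\pi^2}{3}\sum_{i=0}^3l_i(l_i+1).$$ Let $$\Phi_T(x)=\prod_{j}(\sin\pi x_j)^{l_0+1}(\cos\pi x_j)^{l_1+1}\prod_{j<k}\bigl(\sin\pi(x_j-x_k)\sin\pi(x_j+x_k)\bigr)^{l+1}$$ (principal values of the powers), $D=\{x\in\mathbb R^N: 0<x_1\le\dots\le x_N<1\}$, and let $\mathbf H$ be the Hilbert space of (classes of) measurable functions $f:\mathbb R^N\to\mathbb C$ with $\int_D|f|^2\,dx<\infty$ such that $f/\Phi_T$ is almost everywhere invariant under permutations and sign changes of the coordinates and under translations by $\mathbb Z^N$, with inner product that of $L^2(D)$. The initial domain of $H(p)$ is the space of functions $\Phi_T P$, where $P$ is a Laurent polynomial in $z_j=\exp(2\pi\sqrt{-1}\,x_j)$ ($1\le j\le N$) that is invariant under permutations and sign changes of the $x_j$. Then: 1. There are bounded continuous functions $V_k:\mathbb R^N\to\mathbb R$ $(k\ge1)$ and bounds $|V_k|\le M_k$ with $\sum_k M_k r^k<\infty$ for all $0\le r<1$, such that $H(p)=H_T+C_T+\sum_{k\ge1}V_k(x)\,p^k$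 for $|p|<1$, the potentials being compared at the points where $\Phi_T\ne0$. 2. For every complex $p$ with $|p|<1$, $H(p)$ is a well-defined, densely defined operator in $\mathbf H$. For real $p$ with $-1<p<1$ it is essentially self-adjoint: its closure $\tilde H(p)$ is self-adjoint and is the only self-adjoint extension of $H(p)$. 3. The operators $\tilde H(p)$, $-1<p<1$, form a holomorphic family of type (A) in Kato's sense. More precisely, the closures $\tilde H(p)$ of $H(p)$ for complex $p$ in the unit disc $|p|<1$ are closed operators with a common domain $\mathcal D$ independent of $p$, and for every $u\in\mathcal D$ the map $p\mapsto\tilde H(p)u\in\mathbf H$ is holomorphic on $|p|<1$. -/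

import Mathlib

open MeasureTheory Filter Topology

namespace Inozemtsev

noncomputable section

/-! ### The potentials -/

/-- The period pair `(1, τ)` for `τ` in the upper half plane. -/
def periods (τ : UpperHalfPlane) : PeriodPair where
  ω₁ := 1
  ω₂ := τ
  indep := by
    rw [LinearIndependent.pair_iff]
    intro s t h
    have him := congrArg Complex.im h
    have ht : t = 0 := by
      have := τ.im_pos.ne'
      simpa [this] using him
    have hre := congrArg Complex.re h
    subst ht
    simpa using hre

/-- `ω₀ = 0`, `ω₁ = 1/2`, `ω₂ = -(τ+1)/2`, `ω₃ = τ/2`. -/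
def halfPeriod (τ : UpperHalfPlane) : Fin 4 → ℂ :=
  ![0, 1 / 2, -((τ : ℂ) + 1) / 2, (τ : ℂ) / 2]

/-- The potential of the `BC_N` elliptic Inozemtsev model; the coupling constants are `l` and
`lc i = l_i`, `i = 0, 1, 2, 3`. -/
def ellipticPotential {N : ℕ} (l : ℝ) (lc : Fin 4 → ℝ) (τ : UpperHalfPlane)
    (x : Fin N → ℝ) : ℂ :=
  (∑ j, ∑ i, ((lc i * (lc i + 1) : ℝ) : ℂ) *
      (periods τ).weierstrassP ((x j : ℂ) + halfPeriod τ i)) +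
    ((2 * l * (l + 1) : ℝ) : ℂ) * ∑ j, ∑ k ∈ Finset.Ioi j,
      ((periods τ).weierstrassP ((x j : ℂ) - (x k : ℂ)) +
        (periods τ).weierstrassP ((x j : ℂ) + (x k : ℂ)))

/-- The potential of the `BC_N` trigonometric Calogero-Moser-Sutherland operator `H_T`. -/
def trigPotential {N : ℕ} (l : ℝ) (lc : Fin 4 → ℝ) (x : Fin N → ℝ) : ℝ :=
  (∑ j, ∑ k ∈ Finset.Ioi j,
    (2 * Real.pi ^ 2 * l * (l + 1) / Real.sin (Real.pi * (x j - x k)) ^ 2 +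
      2 * Real.pi ^ 2 * l * (l + 1) / Real.sin (Real.pi * (x j + x k)) ^ 2)) +
  ∑ j, (Real.pi ^ 2 * lc 0 * (lc 0 + 1) / Real.sin (Real.pi * x j) ^ 2 +
      Real.pi ^ 2 * lc 1 * (lc 1 + 1) / Real.cos (Real.pi * x j) ^ 2)

/-- The constant `C_T`, for which the elliptic potential tends to
`trigPotential + C_T` as `Im τ → ∞`. -/
def trigConst (N : ℕ) (l : ℝ) (lc : Fin 4 → ℝ) : ℝ :=
  -(2 * N * (N - 1) * Real.pi ^ 2 / 3) * l * (l + 1) -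
    N * Real.pi ^ 2 / 3 * ∑ i, lc i * (lc i + 1)

/-- For `0 < |p| < 1`, a point `τ` of the upper half plane with `exp (π i τ) = p`. -/
def tauOfNome (p : ℂ) (hp : p ≠ 0) (hp1 : ‖p‖ < 1) : UpperHalfPlane :=
  ⟨Function.Periodic.invQParam 2 p, by
    rw [Function.Periodic.im_invQParam]
    have h0 : 0 < ‖p‖ := norm_pos_iff.mpr hp
    have hlog : Real.log ‖p‖ < 0 := Real.log_neg h0 hp1
    have hpi := Real.pi_pos
    have : (-2 : ℝ) / (2 * Real.pi) < 0 := div_neg_of_neg_of_pos (by norm_num) (by positivity)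
    exact mul_pos_of_neg_of_neg this hlog⟩

open scoped Classical in
/-- The potential of `H(p)`, as a function of the nome `p`, `|p| < 1`: the elliptic potential
with `p = exp (π i τ)` when `p ≠ 0`, and that of `H_T + C_T` when `p = 0`.
(Nothing is meant by the value for `|p| ≥ 1`.) -/
def nomePotential {N : ℕ} (l : ℝ) (lc : Fin 4 → ℝ) (p : ℂ) (x : Fin N → ℝ) : ℂ :=
  if h : p ≠ 0 ∧ ‖p‖ < 1 then ellipticPotential l lc (tauOfNome p h.1 h.2) x
  else ((trigPotential l lc x + trigConst N l lc : ℝ) : ℂ)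

/-- The differential expression `-∑ ∂²f/∂x_j² + U f`. -/
def schrodinger {N : ℕ} (U f : (Fin N → ℝ) → ℂ) (x : Fin N → ℝ) : ℂ :=
  -(∑ j, iteratedDeriv 2 (fun t : ℝ => f (Function.update x j t)) (x j)) + U x * f x

/-! ### The Hilbert space -/

/-- The ground state `Φ_T`; powers of negative numbers are principal values. -/
def groundState {N : ℕ} (l : ℝ) (lc : Fin 4 → ℝ) (x : Fin N → ℝ) : ℂ :=
  (∏ j, ((Real.sin (Real.pi * x j) : ℝ) : ℂ) ^ ((lc 0 : ℂ) + 1) *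
      ((Real.cos (Real.pi * x j) : ℝ) : ℂ) ^ ((lc 1 : ℂ) + 1)) *
    ∏ j, ∏ k ∈ Finset.Ioi j,
      ((Real.sin (Real.pi * (x j - x k)) * Real.sin (Real.pi * (x j + x k)) : ℝ) : ℂ) ^
        ((l : ℂ) + 1)

/-- `D = {0 < x_1 ≤ ⋯ ≤ x_N < 1}`. -/
def chamber (N : ℕ) : Set (Fin N → ℝ) :=
  {x | (∀ j, 0 < x j ∧ x j < 1) ∧ Monotone x}

/-- `h` is, almost everywhere, invariant under permutations of the coordinates, under sign changes
of the coordinates, and under translations by `ℤ^N`. -/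
structure AEInvariant {N : ℕ} (h : (Fin N → ℝ) → ℂ) : Prop where
  swap : ∀ i j : Fin N, ∀ᵐ x : Fin N → ℝ, h (x ∘ Equiv.swap i j) = h x
  neg : ∀ i : Fin N, ∀ᵐ x : Fin N → ℝ, h (Function.update x i (-x i)) = h x
  translate : ∀ n : Fin N → ℤ, ∀ᵐ x : Fin N → ℝ, h (fun j => x j + n j) = h x

/-- The Hilbert space `𝐇` of measurable functions `g` on `ℝ^N` that are square-integrable on `D`
and for which `g / Φ_T` is invariant.  Such a `g` is determined by its restriction to `D`, and the
inner product is that of `L²(D)`; so the space is realised as the space of all restrictions to `D`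
of such functions. -/
def hilbert (N : ℕ) (l : ℝ) (lc : Fin 4 → ℝ) :
    Submodule ℂ (Lp ℂ 2 (volume.restrict (chamber N))) where
  carrier := {u | ∃ g : (Fin N → ℝ) → ℂ, Measurable g ∧
    AEInvariant (fun x => g x / groundState l lc x) ∧ u =ᵐ[volume.restrict (chamber N)] g}
  zero_mem' := ⟨0, measurable_const, ⟨by simp, by simp, by simp⟩, Lp.coeFn_zero _ _ _⟩
  add_mem' := by
    rintro u v ⟨g, hg, hgi, hug⟩ ⟨h, hh, hhi, hvh⟩
    refine ⟨g + h, hg.add hh, ⟨fun i j => ?_, fun i => ?_, fun n => ?_⟩,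
      (Lp.coeFn_add u v).trans (hug.add hvh)⟩
    · filter_upwards [hgi.swap i j, hhi.swap i j] with x h1 h2
      simp only [Pi.add_apply, add_div, h1, h2]
    · filter_upwards [hgi.neg i, hhi.neg i] with x h1 h2
      simp only [Pi.add_apply, add_div, h1, h2]
    · filter_upwards [hgi.translate n, hhi.translate n] with x h1 h2
      simp only [Pi.add_apply, add_div, h1, h2]
  smul_mem' := by
    rintro c u ⟨g, hg, hgi, hug⟩
    refine ⟨c • g, hg.const_smul c, ⟨fun i j => ?_, fun i => ?_, fun n => ?_⟩,
      (Lp.coeFn_smul c u).trans (hug.const_smul c)⟩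
    · filter_upwards [hgi.swap i j] with x h1
      simp only [Pi.smul_apply, smul_eq_mul, mul_div_assoc, h1]
    · filter_upwards [hgi.neg i] with x h1
      simp only [Pi.smul_apply, smul_eq_mul, mul_div_assoc, h1]
    · filter_upwards [hgi.translate n] with x h1
      simp only [Pi.smul_apply, smul_eq_mul, mul_div_assoc, h1]

theorem measurable_groundState {N : ℕ} (l : ℝ) (lc : Fin 4 → ℝ) :
    Measurable (groundState (N := N) l lc) := by
  unfold groundState
  fun_prop

theorem isClosed_hilbert (N : ℕ) (l : ℝ) (lc : Fin 4 → ℝ) :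
    IsClosed (hilbert N l lc : Set (Lp ℂ 2 (volume.restrict (chamber N)))) := by
  classical
  refine isSeqClosed_iff_isClosed.mp ?_
  intro u v hu huv
  choose g hg hgi hug using hu
  obtain ⟨φ, -, hφ⟩ := (tendstoInMeasure_of_tendsto_Lp huv).exists_seq_tendsto_ae
  let Φ := groundState (N := N) l lc
  have hΦ : Measurable Φ := measurable_groundState l lc
  let h : (Fin N → ℝ) → ℂ := fun x => limUnder atTop (fun n => g (φ n) x / Φ x)
  let k : (Fin N → ℝ) → ℂ := fun x => limUnder atTop (fun n => g (φ n) x)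
  have hh : Measurable h :=
    (StronglyMeasurable.limUnder fun n => ((hg (φ n)).div hΦ).stronglyMeasurable).measurable
  have hk : Measurable k :=
    (StronglyMeasurable.limUnder fun n => (hg (φ n)).stronglyMeasurable).measurable
  have key : (fun x => (if Φ x = 0 then k x else h x * Φ x) / groundState l lc x) = h := by
    funext x
    change (if Φ x = 0 then k x else h x * Φ x) / Φ x = h x
    by_cases hx : Φ x = 0
    · have : h x = 0 := by
        simp only [h, hx, div_zero]
        exact tendsto_const_nhds.limUnder_eq
      simp [hx, this]
    · simp [hx]
  refine ⟨fun x => if Φ x = 0 then k x else h x * Φ x,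
    Measurable.ite (hΦ (measurableSet_singleton 0)) hk (hh.mul hΦ), ?_, ?_⟩
  · rw [key]
    refine ⟨fun i j => ?_, fun i => ?_, fun n => ?_⟩
    · filter_upwards [ae_all_iff.mpr fun m => (hgi (φ m)).swap i j] with x hx
      simp only [h]
      exact congrArg _ (funext hx)
    · filter_upwards [ae_all_iff.mpr fun m => (hgi (φ m)).neg i] with x hx
      simp only [h]
      exact congrArg _ (funext hx)
    · filter_upwards [ae_all_iff.mpr fun m => (hgi (φ m)).translate n] with x hx
      simp only [h]
      exact congrArg _ (funext hx)
  · filter_upwards [hφ, ae_all_iff.mpr fun n => hug (φ n)] with x hx hx'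
    have hlim : Tendsto (fun n => g (φ n) x) atTop (𝓝 (v x)) := by simpa [hx'] using hx
    by_cases h0 : Φ x = 0
    · simp only [h0, if_true]
      exact hlim.limUnder_eq.symm
    · simp only [h0, if_false]
      have : h x = v x / Φ x := (hlim.div_const (Φ x)).limUnder_eq
      rw [this, div_mul_cancel₀ _ h0]

instance (N : ℕ) (l : ℝ) (lc : Fin 4 → ℝ) : CompleteSpace (hilbert N l lc) :=
  (isClosed_hilbert N l lc).completeSpace_coe

/-! ### The operators -/

/-- The `W(B_N)`-invariant Laurent polynomials in `z_j = exp (2 π i x_j)`, as functions of `x`.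
The products `Φ_T P` with such `P` span the same space as the eigenfunctions `v_λ` of `H_T`
(ground state times a `BC_N` Jacobi polynomial). -/
def invLaurent (N : ℕ) : Set ((Fin N → ℝ) → ℂ) :=
  {P | P ∈ Submodule.span ℂ (Set.range fun (n : Fin N → ℤ) (x : Fin N → ℝ) =>
        Complex.exp (2 * Real.pi * Complex.I * ∑ j, (n j : ℂ) * (x j : ℂ))) ∧
    (∀ i j x, P (x ∘ Equiv.swap i j) = P x) ∧
    (∀ i x, P (Function.update x i (-x i)) = P x)}

/-- The operator `H(p)` on `𝐇`, with initial domain the functions `Φ_T P`, `P` an invariant Laurent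
polynomial, on which it acts as the differential operator `-∑ ∂²/∂x_j² + U_p`.  It is given by its
graph. -/
def hamiltonian (N : ℕ) (l : ℝ) (lc : Fin 4 → ℝ) (p : ℂ) :
    hilbert N l lc →ₗ.[ℂ] hilbert N l lc :=
  (Submodule.span ℂ {w : hilbert N l lc × hilbert N l lc | ∃ P ∈ invLaurent N,
    ((w.1 : Lp ℂ 2 (volume.restrict (chamber N))) : (Fin N → ℝ) → ℂ)
      =ᵐ[volume.restrict (chamber N)] (fun x => groundState l lc x * P x) ∧
    ((w.2 : Lp ℂ 2 (volume.restrict (chamber N))) : (Fin N → ℝ) → ℂ)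
      =ᵐ[volume.restrict (chamber N)]
        schrodinger (nomePotential l lc p) (fun x => groundState l lc x * P x)}).toLinearPMap

/-- `H̃(p)`, the closure of `H(p)`. -/
def closedHamiltonian (N : ℕ) (l : ℝ) (lc : Fin 4 → ℝ) (p : ℂ) :
    hilbert N l lc →ₗ.[ℂ] hilbert N l lc :=
  (hamiltonian N l lc p).closure

/-- A holomorphic family of type (A) in the sense of Kato on a domain `Ω` of the complex plane:
closed operators `T p`, `p ∈ Ω`, with a domain `𝒟` that does not depend on `p`, such that
`p ↦ T p u` is holomorphic on `Ω` for every `u ∈ 𝒟`. -/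
structure IsHolomorphicFamilyTypeA {X : Type*} [NormedAddCommGroup X] [NormedSpace ℂ X]
    (Ω : Set ℂ) (T : ℂ → X →ₗ.[ℂ] X) : Prop where
  isOpen : IsOpen Ω
  isConnected : IsConnected Ω
  isClosed : ∀ p ∈ Ω, (T p).IsClosed
  holomorphic : ∃ 𝒟 : Submodule ℂ X, (∀ p ∈ Ω, (T p).domain = 𝒟) ∧
    ∀ u ∈ 𝒟, ∃ f : ℂ → X, DifferentiableOn ℂ f Ω ∧ ∀ p ∈ Ω, (u, f p) ∈ (T p).graph

end

end Inozemtsev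

/-!
The operator `H(p)` differs from `H(0) = H_T + C_T` by multiplication with a bounded function that
is holomorphic in `p`, and `H(0)` is essentially self-adjoint because it preserves each of an
exhausting family of finite-dimensional subspaces of its domain.  Everything follows from these two
facts.

*The perturbation.*  Summing the Weierstrass series along the rows `z + n τ + ℤ` turns each row off
the real axis into a power series in the nome (Lipschitz' formula), while the row on the real axis
is `π² / sin² π x`.  The poles of the elliptic potential are therefore those of the trigonometric
one, and the difference is a power series in `p` whose coefficients are continuous and invariant
under the symmetries of the model (`exists_potential_expansion`, `exists_perturbation`).

*The operator `H(0)`.*  Let `A_j` be the logarithmic derivative `∂_j Φ_T / Φ_T`.  Then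
`∑ (A_j² + ∂_j A_j)` is the potential of `H_T` up to a constant
(`exists_sum_drift_sq_add_driftDeriv`), so that conjugation by `Φ_T` turns `H(0)` into
`-∑ (∂_j² + 2 A_j ∂_j)` plus a constant.  Invariant Laurent polynomials are the symmetric
polynomials in `cos 2πx_j`, and on these the conjugated operator has polynomial coefficients and
divided differences, and does not raise the degree (`gaugeOp`, `polyFun_gaugeOp`,
`totalDegree_gaugeOp_le`).  It is symmetric for the weight `|Φ_T|²`, by integration by parts over a
period cube (`integral_weight_mul_gaugeOp`); the weight is continuously differentiable even where
`Φ_T` vanishes, so the walls contribute nothing.  The functions `Φ_T P` are total: if `g` is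
orthogonal to all of them, `conj Φ_T · g = |Φ_T|² (g / Φ_T)` is an invariant square-integrable
function all of whose Fourier coefficients vanish (`ae_eq_zero_of_integral_groundState`).

*Abstract part.*  A densely defined symmetric operator that preserves finite-dimensional spaces
exhausting its domain is essentially self-adjoint, because non-real shifts of it are onto on each of
these spaces (`adjoint_range_eq_topologicalClosure`).  On graphs, adding a bounded operator `B` is
the shear `(u, v) ↦ (u, v + B u)`, a homeomorphism.  It commutes with closures, and with adjoints
when `B` is symmetric (`topologicalClosure_shearGraph`, `adjoint_shearGraph`), so the closure of
`H(p)` is that of `H(0)` plus a bounded operator: the domain does not depend on `p`, holomorphy in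
`p` is that of the bounded operator, and self-adjointness is inherited for real `p`.
-/

namespace Inozemtsev

noncomputable section

/-! ### Symmetric relations in a Hilbert space -/

section

variable {X : Type*} [NormedAddCommGroup X] [InnerProductSpace ℂ X]

theorem isClosed_adjoint (g : Submodule ℂ (X × X)) : IsClosed (g.adjoint : Set (X × X)) := by
  have : (g.adjoint : Set (X × X)) =
      ⋂ y ∈ g, {x : X × X | inner ℂ y.2 x.1 - inner ℂ y.1 x.2 = 0} := by
    ext x
    simp
  rw [this]
  exact isClosed_biInter fun y _ => isClosed_eq (by fun_prop) continuous_const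

theorem adjoint_topologicalClosure (g : Submodule ℂ (X × X)) :
    g.topologicalClosure.adjoint = g.adjoint := by
  apply le_antisymm
  · intro x hx
    rw [Submodule.mem_adjoint_iff] at hx ⊢
    exact fun a b hab => hx a b (g.le_topologicalClosure hab)
  · intro x hx
    rw [Submodule.mem_adjoint_iff] at hx ⊢
    intro a b hab
    have hc : IsClosed {y : X × X | inner ℂ y.2 x.1 - inner ℂ y.1 x.2 = 0} :=
      isClosed_eq (by fun_prop) continuous_const
    exact closure_minimal (s := (g : Set (X × X))) (fun y hy => hx y.1 y.2 hy) hc hab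

theorem norm_sq_sub_smul_I {u v : X} (h : inner ℂ v u = inner ℂ u v) :
    ‖v - Complex.I • u‖ ^ 2 = ‖v‖ ^ 2 + ‖u‖ ^ 2 := by
  have him : (inner ℂ v u : ℂ).im = 0 := by
    have h1 := inner_conj_symm (𝕜 := ℂ) v u
    rw [← h] at h1
    exact Complex.conj_eq_iff_im.mp h1
  rw [@norm_sub_sq ℂ, inner_smul_right, norm_smul]
  simp [him]

/-- A symmetric relation for which the range of `· - i` is dense has its closure as adjoint, provided
that the range of `· + i` is dense as well: this is the basic criterion for essential
self-adjointness. -/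
theorem adjoint_eq_topologicalClosure [CompleteSpace X] {g : Submodule ℂ (X × X)}
    (hg : g ≤ g.adjoint)
    (h₁ : Dense {z : X | ∃ y ∈ g, z = y.2 - Complex.I • y.1})
    (h₂ : Dense {z : X | ∃ y ∈ g, z = y.2 + Complex.I • y.1}) :
    g.adjoint = g.topologicalClosure := by
  set Γ := g.topologicalClosure with hΓ
  have hΓle : Γ ≤ g.adjoint := Submodule.topologicalClosure_minimal g hg (isClosed_adjoint g)
  have hsymm : ∀ y ∈ Γ, inner ℂ y.2 y.1 = inner ℂ y.1 y.2 := by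
    intro y hy
    have := hΓle hy
    rw [← adjoint_topologicalClosure, Submodule.mem_adjoint_iff] at this
    exact sub_eq_zero.mp (this y.1 y.2 hy)
  refine le_antisymm (fun x hx => ?_) hΓle
  -- `· - i` is bounded below on the closed relation `Γ`, so its range is closed, hence everything.
  let f : Γ →L[ℂ] X := ((ContinuousLinearMap.snd ℂ X X) -
    Complex.I • (ContinuousLinearMap.fst ℂ X X)).comp Γ.subtypeL
  have hf : ∀ y : Γ, f y = (y : X × X).2 - Complex.I • (y : X × X).1 := fun y => rfl
  have hanti : AntilipschitzWith 1 f := by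
    refine AddMonoidHomClass.antilipschitz_of_bound f fun y => ?_
    have h := norm_sq_sub_smul_I (hsymm y.1 y.2)
    rw [hf, NNReal.coe_one, one_mul]
    change ‖(y : X × X)‖ ≤ _
    rw [Prod.norm_def]
    refine max_le ?_ ?_ <;> refine le_of_sq_le_sq ?_ (norm_nonneg _) <;> rw [h] <;>
      simp
  have : CompleteSpace Γ := g.isClosed_topologicalClosure.completeSpace_coe
  have hrange : Set.range f = Set.univ := by
    refine (hanti.isClosed_range f.uniformContinuous).closure_eq.symm.trans
      (Dense.closure_eq (h₁.mono ?_))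
    rintro z ⟨y, hy, rfl⟩
    exact ⟨⟨y, g.le_topologicalClosure hy⟩, rfl⟩
  obtain ⟨w, hw⟩ : ∃ w, f w = x.2 - Complex.I • x.1 := by
    have : x.2 - Complex.I • x.1 ∈ Set.range f := hrange ▸ Set.mem_univ _
    exact this
  rw [hf] at hw
  have hd : x - w ∈ g.adjoint := sub_mem hx (hΓle w.2)
  have hd2 : (x - w).2 = Complex.I • (x - w).1 := by
    simp only [Prod.snd_sub, Prod.fst_sub, smul_sub]
    rw [sub_eq_sub_iff_add_eq_add] at hw ⊢
    rw [← hw, add_comm]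
  have h0 : (x - w).1 = 0 := by
    refine h₂.eq_zero_of_inner_right ℂ ?_
    rintro z ⟨y, hy, rfl⟩
    rw [Submodule.mem_adjoint_iff] at hd
    have := hd y.1 y.2 hy
    rw [hd2, inner_smul_right] at this
    rw [inner_add_left, inner_smul_left]
    simpa [sub_eq_add_neg] using this
  have : x - w = 0 := Prod.ext h0 (by rw [hd2, h0]; simp)
  rw [sub_eq_zero.mp this]
  exact w.2

/-- The shear `(u, v) ↦ (u, v + B u)`, which carries the graph of an operator `T` to the graph of
`T + B`. -/
def shear (B : X →L[ℂ] X) : (X × X) ≃L[ℂ] (X × X) :=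
  ContinuousLinearEquiv.equivOfInverse
    ((ContinuousLinearMap.fst ℂ X X).prod
      (ContinuousLinearMap.snd ℂ X X + B.comp (ContinuousLinearMap.fst ℂ X X)))
    ((ContinuousLinearMap.fst ℂ X X).prod
      (ContinuousLinearMap.snd ℂ X X - B.comp (ContinuousLinearMap.fst ℂ X X)))
    (fun x => by simp) (fun x => by simp)

/-- The graph of an operator plus `B`. -/
def shearGraph (g : Submodule ℂ (X × X)) (B : X →L[ℂ] X) : Submodule ℂ (X × X) :=
  g.comap ((shear B).symm : (X × X) →ₗ[ℂ] (X × X))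

theorem mem_shearGraph {g : Submodule ℂ (X × X)} {B : X →L[ℂ] X} {x : X × X} :
    x ∈ shearGraph g B ↔ (x.1, x.2 - B x.1) ∈ g := Iff.rfl

theorem topologicalClosure_shearGraph (g : Submodule ℂ (X × X)) (B : X →L[ℂ] X) :
    (shearGraph g B).topologicalClosure = shearGraph g.topologicalClosure B := by
  apply SetLike.coe_injective
  exact ((shear B).symm.toHomeomorph.preimage_closure (g : Set (X × X))).symm

/-- A bounded symmetric perturbation carries over to the adjoint. -/
theorem adjoint_shearGraph (g : Submodule ℂ (X × X)) {B : X →L[ℂ] X}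
    (hB : ∀ x y, inner ℂ (B x) y = inner ℂ x (B y)) :
    (shearGraph g B).adjoint = shearGraph g.adjoint B := by
  ext x
  rw [mem_shearGraph, Submodule.mem_adjoint_iff, Submodule.mem_adjoint_iff]
  constructor
  · intro h a b hab
    have := h a (b + B a) (by simpa [mem_shearGraph] using hab)
    rw [inner_add_left, hB] at this
    rw [inner_sub_right]
    linear_combination this
  · intro h a b hab
    have := h a (b - B a) hab
    rw [inner_sub_left, inner_sub_right, hB] at this
    linear_combination this

/-- If the closure of a relation is single-valued, it is the graph of the closure of the operator that
the relation defines. -/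
theorem closure_toLinearPMap_graph {g : Submodule ℂ (X × X)}
    (hg : ∀ x ∈ g.topologicalClosure, x.1 = 0 → x.2 = 0) :
    g.toLinearPMap.closure.graph = g.topologicalClosure := by
  have hg' : g.toLinearPMap.graph = g :=
    g.toLinearPMap_graph_eq fun x hx => hg x (g.le_topologicalClosure hx)
  have hc : g.toLinearPMap.IsClosable :=
    ⟨g.topologicalClosure.toLinearPMap, by rw [hg', Submodule.toLinearPMap_graph_eq _ hg]⟩
  rw [← hc.graph_closure_eq_closure_graph, hg']

/-- The closure of an essentially self-adjoint operator is its only self-adjoint extension. -/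
theorem eq_closure_of_isSelfAdjoint [CompleteSpace X] {T A : X →ₗ.[ℂ] X}
    (hT : IsSelfAdjoint T.closure) (hA : IsSelfAdjoint A) (h : T ≤ A) : A = T.closure := by
  have hAc := hA.isClosed
  have h1 : T.closure ≤ A := by
    have := hAc.isClosable.closure_mono h
    have h2 : A.closure = A := by
      apply LinearPMap.eq_of_eq_graph
      rw [← hAc.isClosable.graph_closure_eq_closure_graph]
      exact IsClosed.submodule_topologicalClosure_eq hAc
    rwa [h2] at this
  refine le_antisymm ?_ h1
  rw [← LinearPMap.le_graph_iff, ← LinearPMap.isSelfAdjoint_def.mp hT,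
    LinearPMap.adjoint_graph_eq_graph_adjoint hT.dense_domain]
  conv_lhs => rw [← LinearPMap.isSelfAdjoint_def.mp hA,
    LinearPMap.adjoint_graph_eq_graph_adjoint hA.dense_domain]
  intro x hx
  rw [Submodule.mem_adjoint_iff] at hx ⊢
  exact fun a b hab => hx a b (LinearPMap.le_graph_of_le h1 hab)

theorem isSelfAdjoint_of_adjoint_graph [CompleteSpace X] {T : X →ₗ.[ℂ] X}
    (hd : Dense (T.domain : Set X)) (h : T.graph.adjoint = T.graph) : IsSelfAdjoint T := by
  rw [LinearPMap.isSelfAdjoint_def]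
  apply LinearPMap.eq_of_eq_graph
  rw [LinearPMap.adjoint_graph_eq_graph_adjoint hd, h]

variable {E : Type*} [AddCommGroup E] [Module ℂ E]

/-- A symmetric operator that preserves a finite-dimensional space maps it onto itself after a
non-real shift. -/
theorem exists_sub_smul_eq (ι T : E →ₗ[ℂ] X)
    (hsymm : ∀ a b, inner ℂ (T a) (ι b) = inner ℂ (ι a) (T b))
    (hdense : DenseRange ι) (F : Submodule ℂ E) [FiniteDimensional ℂ F]
    (hF : ∀ a ∈ F, ∃ b ∈ F, T a = ι b) {c : ℂ} (hc : c.im ≠ 0) {a : E} (ha : a ∈ F) :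
    ∃ b ∈ F, ι a = T b - c • ι b := by
  let S : Submodule ℂ X := F.map ι
  -- `ι` need not be injective; symmetry and density make `T` factor through its image.
  have hker : ∀ a, ι a = 0 → T a = 0 := by
    intro a h
    refine hdense.eq_zero_of_inner_left ℂ ?_
    intro b
    rw [hsymm, h, inner_zero_left]
  have hker' : ∀ b, T b - c • ι b = 0 → ι b = 0 := by
    intro b hb
    have h1 := hsymm b b
    rw [sub_eq_zero.mp hb, inner_smul_left, inner_smul_right] at h1
    have h2 : (starRingEnd ℂ c - c) * inner ℂ (ι b) (ι b) = 0 := by linear_combination h1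
    rcases mul_eq_zero.mp h2 with h | h
    · exact absurd (Complex.conj_eq_iff_im.mp (sub_eq_zero.mp h)) hc
    · exact inner_self_eq_zero.mp h
  let R : Submodule ℂ X := F.map (T - c • ι)
  have hRS : R ≤ S := by
    rintro _ ⟨b, hb, rfl⟩
    obtain ⟨b', hb', h⟩ := hF b hb
    exact ⟨b' - c • b, sub_mem hb' (F.smul_mem c hb), by simp [h]⟩
  have hfr : Module.finrank ℂ S ≤ Module.finrank ℂ R := by
    have hle : LinearMap.ker ((T - c • ι).comp F.subtype) ≤ LinearMap.ker (ι.comp F.subtype) := by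
      intro b hb
      exact hker' b (by simpa using hb)
    have e1 := LinearMap.finrank_range_add_finrank_ker ((T - c • ι).comp F.subtype)
    have e2 := LinearMap.finrank_range_add_finrank_ker (ι.comp F.subtype)
    have e3 := Submodule.finrank_mono hle
    rw [LinearMap.range_comp, Submodule.range_subtype] at e1 e2
    change Module.finrank ℂ (F.map ι) ≤ Module.finrank ℂ (F.map (T - c • ι))
    lia
  have hRS' : R = S := Submodule.eq_of_le_of_finrank_le hRS hfr
  have : ι a ∈ R := hRS' ▸ ⟨a, ha, rfl⟩
  obtain ⟨b, hb, h⟩ := this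
  exact ⟨b, hb, by simpa using h.symm⟩

/-- A densely defined symmetric operator that preserves each member of an exhausting family of
finite-dimensional spaces is essentially self-adjoint. -/
theorem adjoint_range_eq_topologicalClosure [CompleteSpace X] (ι T : E →ₗ[ℂ] X)
    (hsymm : ∀ a b, inner ℂ (T a) (ι b) = inner ℂ (ι a) (T b))
    (hdense : DenseRange ι) (F : ℕ → Submodule ℂ E) [∀ d, FiniteDimensional ℂ (F d)]
    (hF : ∀ d, ∀ a ∈ F d, ∃ b ∈ F d, T a = ι b) (hFtop : ∀ a, ∃ d, a ∈ F d) :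
    (LinearMap.range (ι.prod T)).adjoint = (LinearMap.range (ι.prod T)).topologicalClosure := by
  have key : ∀ c : ℂ, c.im ≠ 0 →
      Dense {z : X | ∃ y ∈ LinearMap.range (ι.prod T), z = y.2 - c • y.1} := by
    intro c hc
    refine hdense.mono ?_
    rintro _ ⟨a, rfl⟩
    obtain ⟨d, hd⟩ := hFtop a
    obtain ⟨b, -, hb⟩ := exists_sub_smul_eq ι T hsymm hdense (F d) (hF d) hc hd
    exact ⟨_, ⟨b, rfl⟩, hb⟩
  refine adjoint_eq_topologicalClosure ?_ (key _ (by simp)) ?_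
  · rintro _ ⟨a, rfl⟩
    rw [Submodule.mem_adjoint_iff]
    rintro _ _ ⟨b, hb⟩
    obtain ⟨rfl, rfl⟩ := Prod.mk.inj hb
    exact sub_eq_zero.mpr (hsymm _ _)
  · simpa using key (-Complex.I) (by simp)

/-- Elements of the adjoint of a densely defined relation are determined by their first
component. -/
theorem snd_eq_zero_of_mem_adjoint {g : Submodule ℂ (X × X)}
    (hd : Dense {u : X | ∃ y ∈ g, u = y.1}) {x : X × X} (hx : x ∈ g.adjoint) (h : x.1 = 0) :
    x.2 = 0 := by
  refine hd.eq_zero_of_inner_right ℂ ?_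
  rintro _ ⟨y, hy, rfl⟩
  rw [Submodule.mem_adjoint_iff] at hx
  simpa [h] using hx y.1 y.2 hy

/-- Adding a bounded operator does not change the domain. -/
theorem domain_eq_map_fst_of_graph_eq_shearGraph {T : X →ₗ.[ℂ] X} {g : Submodule ℂ (X × X)}
    {B : X →L[ℂ] X} (h : T.graph = shearGraph g B) :
    T.domain = g.map (LinearMap.fst ℂ X X) := by
  ext u
  rw [LinearPMap.mem_domain_iff, h, Submodule.mem_map]
  constructor
  · rintro ⟨v, hv⟩
    exact ⟨_, mem_shearGraph.mp hv, rfl⟩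
  · rintro ⟨⟨u, v⟩, hv, rfl⟩
    refine ⟨v + B u, mem_shearGraph.mpr ?_⟩
    simpa using hv

end

/-! ### Nome expansions of the Weierstrass function -/

theorem hasSum_of_eq {ι : Type*} {f g : ι → ℂ} {a : ℂ} (h : HasSum f a) (e : ∀ i, f i = g i) :
    HasSum g a :=
  funext e ▸ h

/-- The sum of `1 / (z + m)²` over the integers `m`; the term `m = -z`, if there is one, is
omitted. -/
def rowSum (z : ℂ) : ℂ := ∑' m : ℤ, 1 / (z + m) ^ 2

theorem summable_rowSum (z : ℂ) : Summable fun m : ℤ => 1 / (z + m) ^ 2 := by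
  simpa using EisensteinSeries.linear_right_summable z 1 (k := 2) le_rfl

theorem rowSum_neg (z : ℂ) : rowSum (-z) = rowSum z := by
  unfold rowSum
  rw [← (Equiv.neg ℤ).tsum_eq]
  refine tsum_congr fun m => ?_
  simp only [Equiv.neg_apply, Int.cast_neg, ← neg_add, neg_sq]

theorem rowSum_zero : rowSum 0 = Real.pi ^ 2 / 3 := by
  have h : HasSum (fun n : ℕ => (1 / ((n : ℂ)) ^ 2)) (Real.pi ^ 2 / 6 : ℂ) := by
    have := hasSum_zeta_two
    rw [← Complex.hasSum_ofReal] at this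
    simpa using this
  have h2 := (HasSum.of_nat_of_neg (f := fun m : ℤ => (1 / ((0 : ℂ) + m) ^ 2))
    (by simpa using h) (by simpa using h)).tsum_eq
  rw [rowSum, h2]
  simp
  ring

/-- Lipschitz' formula. -/
theorem hasSum_rowSum_of_im_pos {z : ℂ} (hz : 0 < z.im) :
    HasSum (fun k : ℕ => -4 * Real.pi ^ 2 * (k + 1) *
      Complex.exp (2 * Real.pi * Complex.I * z) ^ (k + 1)) (rowSum z) := by
  have h := EisensteinSeries.qExpansion_identity (k := 1) le_rfl ⟨z, hz⟩
  have hs := summable_pow_mul_cexp 1 1 ⟨z, hz⟩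
  simp only [pow_one, PNat.one_coe, Nat.cast_one, mul_one] at hs
  have h1 := hs.hasSum
  rw [← hasSum_nat_add_iff' 1] at h1
  have h2 := h1.mul_left (-4 * Real.pi ^ 2 : ℂ)
  simp only [Finset.range_one, Finset.sum_singleton, Nat.cast_zero, zero_mul, sub_zero] at h2
  have h3 : rowSum z = -4 * Real.pi ^ 2 *
      ∑' b : ℕ, (b : ℂ) * Complex.exp (2 * Real.pi * Complex.I * z) ^ b := by
    refine h.trans ?_
    simp only [Nat.factorial_one, Nat.cast_one, div_one, pow_one]
    congr 1
    ring_nf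
    simp
  rw [h3]
  refine hasSum_of_eq h2 fun k => ?_
  push_cast
  ring

theorem rowSum_of_im_pos {z : ℂ} (hz : 0 < z.im) :
    rowSum z = Real.pi ^ 2 / Complex.sin (Real.pi * z) ^ 2 := by
  set w := Complex.exp (2 * Real.pi * Complex.I * z) with hw
  have hw1 : ‖w‖ < 1 := by
    rw [hw, Complex.norm_exp]
    have : (2 * Real.pi * Complex.I * z).re = -(2 * Real.pi * z.im) := by simp
    rw [this, Real.exp_lt_one_iff]
    have := Real.pi_pos
    nlinarith [mul_pos this hz]
  have h1 := (hasSum_rowSum_of_im_pos hz).tsum_eq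
  have h2 : HasSum (fun k : ℕ => -4 * Real.pi ^ 2 * (k + 1) * w ^ (k + 1))
      (-4 * Real.pi ^ 2 * (w / (1 - w) ^ 2)) := by
    have := (hasSum_coe_mul_geometric_of_norm_lt_one hw1)
    rw [← hasSum_nat_add_iff' 1] at this
    have h3 := this.mul_left (-4 * Real.pi ^ 2 : ℂ)
    simp only [Finset.range_one, Finset.sum_singleton, Nat.cast_zero, zero_mul, sub_zero] at h3
    refine hasSum_of_eq h3 fun k => ?_
    push_cast
    ring
  rw [← h1, h2.tsum_eq]
  have hw0 : w ≠ 0 := Complex.exp_ne_zero _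
  have hw2 : 1 - w ≠ 0 := by
    intro h
    rw [sub_eq_zero.mp h |>.symm] at hw1
    simp at hw1
  set v := Complex.exp (Real.pi * z * Complex.I) with hv
  have hv0 : v ≠ 0 := Complex.exp_ne_zero _
  have hvw : w = v ^ 2 := by
    rw [hw, hv, ← Complex.exp_nat_mul]
    congr 1
    push_cast
    ring
  have hs : Complex.sin (Real.pi * z) = (v⁻¹ - v) * Complex.I / 2 := by
    rw [Complex.sin, hv, ← Complex.exp_neg, neg_mul]
  rw [hs, hvw]
  have hv2 : 1 - v ^ 2 ≠ 0 := hvw ▸ hw2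
  have : (v⁻¹ - v) * Complex.I / 2 = (1 - v ^ 2) * Complex.I / (2 * v) := by field_simp
  rw [this]
  field_simp
  rw [Complex.I_sq]
  ring

/-- The partial fraction expansion of the squared cosecant, on the real axis. -/
theorem rowSum_ofReal {x : ℝ} (hx : Real.sin (Real.pi * x) ≠ 0) :
    rowSum x = Real.pi ^ 2 / Complex.sin (Real.pi * x) ^ 2 := by
  -- Both sides are limits of their values at `x + i y`, `y ↓ 0`, where the row sum is dominated by
  -- its terms at `y = 0`.
  have hl : Tendsto (fun y : ℝ => rowSum (x + y * Complex.I)) (𝓝[>] 0) (𝓝 (rowSum x)) := by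
    unfold rowSum
    refine tendsto_tsum_of_dominated_convergence (summable_rowSum x).norm ?_ ?_
    · intro m
      have hne : (x : ℂ) + m ≠ 0 := by
        intro h
        apply hx
        have h' : x = ((-m : ℤ) : ℝ) := by
          have : (x : ℂ) = ((-m : ℤ) : ℝ) := by
            push_cast
            linear_combination h
          exact_mod_cast this
        rw [h', mul_comm]
        exact Real.sin_int_mul_pi _
      have : Tendsto (fun y : ℝ => 1 / ((x : ℂ) + y * Complex.I + m) ^ 2) (𝓝 0)
          (𝓝 (1 / ((x : ℂ) + (0 : ℝ) * Complex.I + m) ^ 2)) := by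
        apply ContinuousAt.tendsto (x := (0 : ℝ))
          (f := fun y : ℝ => 1 / ((x : ℂ) + y * Complex.I + m) ^ 2)
        refine ContinuousAt.div (by fun_prop) (by fun_prop) ?_
        simpa using hne
      simpa using this.mono_left nhdsWithin_le_nhds
    · refine Eventually.of_forall fun y m => ?_
      have e : (x : ℂ) + y * Complex.I + m = ((x + m : ℝ) : ℂ) + y * Complex.I := by
        push_cast
        ring
      have e' : (x : ℂ) + m = ((x + m : ℝ) : ℂ) := by push_cast; rfl
      by_cases h0 : x + m = 0
      · have : Real.sin (Real.pi * x) = 0 := by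
          have h' : x = ((-m : ℤ) : ℝ) := by push_cast; linarith
          rw [h', mul_comm]
          exact Real.sin_int_mul_pi _
        exact absurd this hx
      rw [norm_div, norm_div, norm_pow, norm_pow, e, e']
      have h1 : ‖((x + m : ℝ) : ℂ)‖ ≤ ‖((x + m : ℝ) : ℂ) + y * Complex.I‖ := by
        rw [Complex.norm_real, Real.norm_eq_abs]
        have := Complex.abs_re_le_norm (((x + m : ℝ) : ℂ) + y * Complex.I)
        simpa using this
      have h2 : 0 < ‖((x + m : ℝ) : ℂ)‖ := by
        rw [Complex.norm_real]
        exact norm_pos_iff.mpr h0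
      gcongr
  have hr : Tendsto (fun y : ℝ => rowSum (x + y * Complex.I)) (𝓝[>] 0)
      (𝓝 (Real.pi ^ 2 / Complex.sin (Real.pi * x) ^ 2)) := by
    have : Tendsto (fun y : ℝ => (Real.pi : ℂ) ^ 2 /
        Complex.sin (Real.pi * (x + y * Complex.I)) ^ 2) (𝓝 0)
        (𝓝 ((Real.pi : ℂ) ^ 2 / Complex.sin (Real.pi * (x + (0 : ℝ) * Complex.I)) ^ 2)) := by
      apply ContinuousAt.tendsto (x := (0 : ℝ)) (f := fun y : ℝ => (Real.pi : ℂ) ^ 2 /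
        Complex.sin (Real.pi * (x + y * Complex.I)) ^ 2)
      refine ContinuousAt.div (by fun_prop) (by fun_prop) ?_
      have h : Complex.sin (Real.pi * x) ≠ 0 := by exact_mod_cast hx
      simpa using h
    have h2 := this.mono_left (nhdsWithin_le_nhds (s := Set.Ioi 0))
    simp only [Complex.ofReal_zero, zero_mul, add_zero] at h2
    refine h2.congr' ?_
    filter_upwards [self_mem_nhdsWithin] with y hy
    rw [rowSum_of_im_pos]
    simpa using hy
  exact tendsto_nhds_unique hl hr

/-- The Weierstrass function as the sum of its rows parallel to the real axis. -/
theorem hasSum_weierstrassP_rows (τ : UpperHalfPlane) (z : ℂ) :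
    HasSum (fun n : ℤ => rowSum (z + n * τ) - rowSum (n * τ)) ((periods τ).weierstrassP z) := by
  have h := (periods τ).hasSum_weierstrassP z
  have h1 := (((Equiv.prodComm ℤ ℤ).trans ((Equiv.neg (ℤ × ℤ)).trans
    (periods τ).latticeEquivProd.symm.toEquiv)).hasSum_iff).mpr h
  refine h1.prod_fiberwise fun n => ?_
  have h2 := ((summable_rowSum (z + n * τ)).hasSum).sub ((summable_rowSum (n * τ)).hasSum)
  refine hasSum_of_eq h2 fun m => ?_
  simp only [Function.comp_apply, Equiv.trans_apply, Equiv.prodComm_apply, Prod.swap_prod_mk,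
    Equiv.neg_apply, Prod.neg_mk, LinearEquiv.coe_toEquiv, PeriodPair.latticeEquiv_symm_apply]
  simp only [periods, Int.cast_neg, mul_one]
  congr 2 <;> ring

/-- The double series whose value at `p = exp (π i τ)` is the sum of the rows of the Weierstrass
function that lie off the real axis; `e` lists the exponents of `p`. -/
def nomeSum (e : ℕ × ℕ → ℕ) (p : ℂ) (x : ℝ) : ℂ :=
  ∑' i : ℕ × ℕ, ((-8 * Real.pi ^ 2 * (i.2 + 1) * Real.cos (2 * Real.pi * (i.2 + 1) * x) : ℝ) : ℂ) *
    p ^ e i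

theorem summable_nomeSum_bound {e : ℕ × ℕ → ℕ} (he : ∀ i, i.1 + i.2 ≤ e i) {r : ℝ} (h0 : 0 ≤ r)
    (h1 : r < 1) : Summable fun i : ℕ × ℕ => 8 * Real.pi ^ 2 * (i.2 + 1) * r ^ e i := by
  have hr : ‖r‖ < 1 := by rwa [Real.norm_of_nonneg h0]
  have s1 : Summable fun n : ℕ => r ^ n := summable_geometric_of_lt_one h0 h1
  have s2 : Summable fun k : ℕ => 8 * Real.pi ^ 2 * (k + 1) * r ^ k := by
    have := ((summable_pow_mul_geometric_of_norm_lt_one 1 hr).add s1).mul_left (8 * Real.pi ^ 2)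
    refine this.congr fun k => ?_
    ring
  have s3 := s1.mul_of_nonneg s2 (fun n => by positivity) (fun k => by positivity)
  refine Summable.of_nonneg_of_le (fun i => by positivity) (fun i => ?_) s3
  have : r ^ e i ≤ r ^ (i.1 + i.2) := pow_le_pow_of_le_one h0 h1.le (he i)
  calc 8 * Real.pi ^ 2 * (i.2 + 1) * r ^ e i ≤ 8 * Real.pi ^ 2 * (i.2 + 1) * r ^ (i.1 + i.2) := by
        gcongr
    _ = _ := by rw [pow_add]; ring

theorem abs_nomeCoeff_le (k : ℕ) (x : ℝ) :
    |-8 * Real.pi ^ 2 * (k + 1) * Real.cos (2 * Real.pi * (k + 1) * x)| ≤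
      8 * Real.pi ^ 2 * (k + 1) := by
  rw [abs_mul, abs_mul, abs_mul, abs_neg, abs_of_pos (by norm_num : (0 : ℝ) < 8),
    abs_of_pos (by positivity : (0 : ℝ) < Real.pi ^ 2),
    abs_of_pos (by positivity : (0 : ℝ) < (k : ℝ) + 1)]
  exact mul_le_of_le_one_right (by positivity) (Real.abs_cos_le_one _)

theorem summable_nomeSum {e : ℕ × ℕ → ℕ} (he : ∀ i, i.1 + i.2 ≤ e i) {p : ℂ} (hp : ‖p‖ < 1)
    (x : ℝ) : Summable fun i : ℕ × ℕ =>
      ((-8 * Real.pi ^ 2 * (i.2 + 1) * Real.cos (2 * Real.pi * (i.2 + 1) * x) : ℝ) : ℂ) *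
        p ^ e i := by
  refine Summable.of_norm_bounded (summable_nomeSum_bound he (norm_nonneg p) hp) fun i => ?_
  rw [norm_mul, norm_pow, Complex.norm_real, Real.norm_eq_abs]
  exact mul_le_mul_of_nonneg_right (abs_nomeCoeff_le _ _) (by positivity)

theorem norm_exp_pi_I_lt_one (τ : UpperHalfPlane) :
    ‖Complex.exp (Real.pi * Complex.I * τ)‖ < 1 := by
  rw [Complex.norm_exp, Real.exp_lt_one_iff]
  have : (Real.pi * Complex.I * (τ : ℂ)).re = -(Real.pi * τ.im) := by simp
  rw [this]
  have := mul_pos Real.pi_pos τ.im_pos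
  linarith

/-- A pair of rows at the heights `± y Im τ`, `y = (d + 1) / 2`, as a power series in the nome. -/
theorem hasSum_rowSum_add_rowSum (τ : UpperHalfPlane) (d : ℕ) (x : ℝ) :
    HasSum (fun k : ℕ =>
      ((-8 * Real.pi ^ 2 * (k + 1) * Real.cos (2 * Real.pi * (k + 1) * x) : ℝ) : ℂ) *
        Complex.exp (Real.pi * Complex.I * τ) ^ ((d + 1) * (k + 1)))
      (rowSum (x + (d + 1) / 2 * τ) + rowSum (x - (d + 1) / 2 * τ)) := by
  have him : ∀ x : ℝ, 0 < ((x : ℂ) + (d + 1) / 2 * τ).im := by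
    intro x
    have : ((x : ℂ) + (d + 1) / 2 * τ).im = (d + 1) / 2 * τ.im := by
      have h : ((x : ℂ) + (d + 1) / 2 * τ) = (x : ℂ) + (((d + 1) / 2 : ℝ) : ℂ) * τ := by
        push_cast
        ring
      rw [h, Complex.add_im, Complex.ofReal_im, Complex.im_ofReal_mul, zero_add]
      rfl
    rw [this]
    have := τ.im_pos
    positivity
  have h1 := hasSum_rowSum_of_im_pos (him x)
  have h2 := hasSum_rowSum_of_im_pos (him (-x))
  have e2 : rowSum (x - (d + 1) / 2 * τ) = rowSum ((-x : ℝ) + (d + 1) / 2 * τ) := by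
    rw [← rowSum_neg]
    congr 1
    push_cast
    ring
  rw [e2]
  refine hasSum_of_eq (h1.add h2) fun k => ?_
  rw [← Complex.exp_nat_mul, ← Complex.exp_nat_mul, ← Complex.exp_nat_mul]
  push_cast
  rw [Complex.cos]
  have a1 : ((k : ℂ) + 1) * (2 * Real.pi * Complex.I * (x + (d + 1) / 2 * τ)) =
      2 * Real.pi * (k + 1) * x * Complex.I +
        (d + 1) * (k + 1) * (Real.pi * Complex.I * τ) := by ring
  have a2 : ((k : ℂ) + 1) * (2 * Real.pi * Complex.I * (-x + (d + 1) / 2 * τ)) =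
      -(2 * Real.pi * (k + 1) * x) * Complex.I +
        (d + 1) * (k + 1) * (Real.pi * Complex.I * τ) := by ring
  rw [a1, a2, Complex.exp_add, Complex.exp_add]
  ring

theorem hasSum_nomeSum (τ : UpperHalfPlane) {d : ℕ → ℕ} (hd : ∀ n, n ≤ d n) (x : ℝ) :
    HasSum (fun n : ℕ => rowSum (x + (d n + 1) / 2 * τ) + rowSum (x - (d n + 1) / 2 * τ))
      (nomeSum (fun i => (d i.1 + 1) * (i.2 + 1)) (Complex.exp (Real.pi * Complex.I * τ)) x) := by
  refine HasSum.prod_fiberwise (summable_nomeSum ?_ (norm_exp_pi_I_lt_one τ) x).hasSum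
    fun n => hasSum_rowSum_add_rowSum τ (d n) x
  intro i
  have := hd i.1
  nlinarith [Nat.zero_le (d i.1 * i.2)]

/-- The exponents `2 (n + 1) (k + 1)` of the nome in the expansion of the Weierstrass function on
the real axis. -/
def evenExp (i : ℕ × ℕ) : ℕ := (2 * i.1 + 1 + 1) * (i.2 + 1)

/-- The exponents `(2 n + 1) (k + 1)` of the nome in the expansion of the Weierstrass function on
the line through `τ / 2`. -/
def oddExp (i : ℕ × ℕ) : ℕ := (2 * i.1 + 1) * (i.2 + 1)

/-- The expansion of the Weierstrass function in powers of the nome, on the real axis. -/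
theorem weierstrassP_ofReal (τ : UpperHalfPlane) {x : ℝ} (hx : Real.sin (Real.pi * x) ≠ 0) :
    (periods τ).weierstrassP x =
      Real.pi ^ 2 / Complex.sin (Real.pi * x) ^ 2 - Real.pi ^ 2 / 3 +
        (nomeSum evenExp (Complex.exp (Real.pi * Complex.I * τ)) x -
          nomeSum evenExp (Complex.exp (Real.pi * Complex.I * τ)) 0) := by
  have h := hasSum_weierstrassP_rows τ x
  have h0 := (hasSum_nat_add_iff' 1).mpr h.nat_add_neg
  have h1 := hasSum_nomeSum τ (d := fun n => 2 * n + 1) (fun n => by lia) x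
  have h2 := hasSum_nomeSum τ (d := fun n => 2 * n + 1) (fun n => by lia) 0
  have h3 := h0.unique (hasSum_of_eq (h1.sub h2) fun n => ?_)
  · simp only [Finset.range_one, Finset.sum_singleton, Nat.cast_zero, neg_zero, Int.cast_zero,
      zero_mul, add_zero] at h3
    rw [rowSum_ofReal hx, rowSum_zero] at h3
    change _ = nomeSum evenExp _ x - nomeSum evenExp _ 0 at h3
    linear_combination h3
  · have e : (((2 * n + 1 : ℕ) : ℂ) + 1) / 2 = n + 1 := by push_cast; ring
    simp only [e]
    push_cast
    have e3 : rowSum (0 - (n + 1) * τ) = rowSum (-(n + 1) * τ) := by congr 1; ring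
    have e4 : (x : ℂ) - (n + 1) * τ = x + -(n + 1) * τ := by ring
    rw [e3, e4, zero_add, neg_add]
    ring_nf

/-- The expansion of the Weierstrass function in powers of the nome, on the line through `τ / 2`: no
row of the lattice lies on it, so there is no trigonometric term. -/
theorem weierstrassP_ofReal_add_half_period (τ : UpperHalfPlane) (x : ℝ) :
    (periods τ).weierstrassP (x + τ / 2) =
      - Real.pi ^ 2 / 3 +
        (nomeSum oddExp (Complex.exp (Real.pi * Complex.I * τ)) x -
          nomeSum evenExp (Complex.exp (Real.pi * Complex.I * τ)) 0) := by
  have h := (hasSum_weierstrassP_rows τ (x + τ / 2)).nat_add_neg_add_one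
  have h1 := hasSum_nomeSum τ (d := fun n => 2 * n) (fun n => by lia) x
  have h2 := hasSum_nomeSum τ (d := fun n => 2 * n + 1) (fun n => by lia) 0
  -- The rows of the lattice itself: each row off the real axis occurs once with index `n` and
  -- once with index `-(n + 1)`.
  have h4 : HasSum (fun n : ℕ => rowSum (n * τ) + rowSum (-((n : ℂ) + 1) * τ))
      (rowSum 0 + nomeSum evenExp (Complex.exp (Real.pi * Complex.I * τ)) 0) := by
    have e : ∀ n : ℕ, (((2 * n + 1 : ℕ) : ℂ) + 1) / 2 = n + 1 := fun n => by push_cast; ring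
    have e' : ∀ n : ℕ, rowSum (-((n : ℂ) + 1) * τ) = rowSum (((n : ℂ) + 1) * τ) := by
      intro n
      rw [← rowSum_neg]
      congr 1
      ring
    have e'' : ∀ n : ℕ, rowSum (-(((n : ℂ) + 1) * τ)) = rowSum (((n : ℂ) + 1) * τ) := by
      intro n
      rw [← rowSum_neg]
      congr 1
      ring
    simp only [e, Complex.ofReal_zero, zero_add, zero_sub, e''] at h2
    simp only [e']
    have h5 : HasSum (fun n : ℕ => rowSum (((n : ℂ) + 1) * τ))
        (nomeSum evenExp (Complex.exp (Real.pi * Complex.I * τ)) 0 / 2) := by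
      refine hasSum_of_eq (h2.div_const 2) fun n => ?_
      ring
    have h6 : HasSum (fun n : ℕ => rowSum ((n : ℂ) * τ))
        (rowSum 0 + nomeSum evenExp (Complex.exp (Real.pi * Complex.I * τ)) 0 / 2) := by
      rw [← hasSum_nat_add_iff' 1]
      simpa using h5
    have := h6.add h5
    rwa [add_assoc, add_halves] at this
  have h3 := h.unique (hasSum_of_eq (h1.sub h4) fun n => ?_)
  · rw [h3, rowSum_zero]
    change nomeSum oddExp _ x - _ = _
    ring
  · push_cast
    have e1 : (x : ℂ) + (2 * n + 1) / 2 * τ = x + τ / 2 + n * τ := by ring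
    have e2 : (x : ℂ) - (2 * n + 1) / 2 * τ = x + τ / 2 + -(n + 1) * τ := by ring
    rw [e1, e2, neg_add]
    ring_nf

/-! ### The potentials as power series in the nome -/

/-- `F p x`, `‖p‖ < 1`, is a power series in `p` whose coefficients are even `1`-periodic continuous
functions of `x`, bounded by the coefficients of a power series that converges for `‖p‖ < 1`. -/
def IsNomeSeries (F : ℂ → ℝ → ℂ) : Prop :=
  ∃ (V : ℕ → ℝ → ℝ) (M : ℕ → ℝ), (∀ k, Continuous (V k)) ∧ (∀ k x, V k (-x) = V k x) ∧
    (∀ k x, V k (x + 1) = V k x) ∧ (∀ k x, |V k x| ≤ M k) ∧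
    (∀ r : ℝ, 0 ≤ r → r < 1 → Summable fun k => M k * r ^ k) ∧ (∀ x, V 0 x = 0) ∧
    ∀ p : ℂ, ‖p‖ < 1 → ∀ x, HasSum (fun k => (V k x : ℂ) * p ^ k) (F p x)

theorem IsNomeSeries.add {F G : ℂ → ℝ → ℂ} (hF : IsNomeSeries F) (hG : IsNomeSeries G) :
    IsNomeSeries fun p x => F p x + G p x := by
  obtain ⟨V, M, h1, h2, h3, h4, h5, h6, h7⟩ := hF
  obtain ⟨V', M', h1', h2', h3', h4', h5', h6', h7'⟩ := hG
  refine ⟨fun k x => V k x + V' k x, fun k => M k + M' k, fun k => (h1 k).add (h1' k),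
    fun k x => by simp only [h2, h2'], fun k x => by simp only [h3, h3'],
    fun k x => (abs_add_le _ _).trans (add_le_add (h4 k x) (h4' k x)), fun r h0 hr => ?_,
    fun x => by simp only [h6, h6', add_zero], fun p hp x => ?_⟩
  · simpa [add_mul] using (h5 r h0 hr).add (h5' r h0 hr)
  · simpa [add_mul] using (h7 p hp x).add (h7' p hp x)

theorem IsNomeSeries.const_mul {F : ℂ → ℝ → ℂ} (c : ℝ) (hF : IsNomeSeries F) :
    IsNomeSeries fun p x => (c : ℂ) * F p x := by
  obtain ⟨V, M, h1, h2, h3, h4, h5, h6, h7⟩ := hF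
  refine ⟨fun k x => c * V k x, fun k => |c| * M k, fun k => (h1 k).const_mul c,
    fun k x => by simp only [h2], fun k x => by simp only [h3],
    fun k x => by rw [abs_mul]; exact mul_le_mul_of_nonneg_left (h4 k x) (abs_nonneg c),
    fun r h0 hr => ?_, fun x => by simp only [h6, mul_zero], fun p hp x => ?_⟩
  · simpa [mul_assoc] using (h5 r h0 hr).mul_left |c|
  · simpa [mul_assoc] using (h7 p hp x).mul_left (c : ℂ)

theorem IsNomeSeries.sub {F G : ℂ → ℝ → ℂ} (hF : IsNomeSeries F) (hG : IsNomeSeries G) :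
    IsNomeSeries fun p x => F p x - G p x := by
  simpa [sub_eq_add_neg] using hF.add (hG.const_mul (-1))

theorem IsNomeSeries.apply_zero {F : ℂ → ℝ → ℂ} (hF : IsNomeSeries F) :
    IsNomeSeries fun p _ => F p 0 := by
  obtain ⟨V, M, h1, h2, h3, h4, h5, h6, h7⟩ := hF
  exact ⟨fun k _ => V k 0, M, fun k => continuous_const, fun _ _ => rfl, fun _ _ => rfl,
    fun k _ => h4 k 0, h5, fun _ => h6 0, fun p hp _ => h7 p hp 0⟩

theorem IsNomeSeries.comp_add_half {F : ℂ → ℝ → ℂ} (hF : IsNomeSeries F) :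
    IsNomeSeries fun p x => F p (x + 1 / 2) := by
  obtain ⟨V, M, h1, h2, h3, h4, h5, h6, h7⟩ := hF
  refine ⟨fun k x => V k (x + 1 / 2), M, fun k => (h1 k).comp (by fun_prop), fun k x => ?_,
    fun k x => ?_, fun k _ => h4 k _, h5, fun _ => h6 _, fun p hp _ => h7 p hp _⟩
  · change V k (-x + 1 / 2) = V k (x + 1 / 2)
    rw [← h2, ← h3]
    congr 1
    ring
  · change V k (x + 1 + 1 / 2) = V k (x + 1 / 2)
    rw [← h3 k (x + 1 / 2)]
    congr 1
    ring

theorem isNomeSeries_nomeSum {e : ℕ × ℕ → ℕ} (he : ∀ i, i.1 + i.2 ≤ e i) (he0 : ∀ i, e i ≠ 0) :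
    IsNomeSeries (nomeSum e) := by
  let c : ℕ × ℕ → ℝ → ℝ := fun i x =>
    -8 * Real.pi ^ 2 * (i.2 + 1) * Real.cos (2 * Real.pi * (i.2 + 1) * x)
  let b : ℕ × ℕ → ℝ := fun i => 8 * Real.pi ^ 2 * (i.2 + 1)
  have hcb : ∀ i x, |c i x| ≤ b i := fun i x => abs_nomeCoeff_le _ _
  -- The coefficient of `p ^ k` collects the terms of the double series in the fibre of `e` over `k`.
  have hfib : ∀ k, Summable fun i : {i // e i = k} => b i := by
    intro k
    have h := (summable_nomeSum_bound he (r := 1 / 2) (by norm_num) (by norm_num)).comp_injective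
      (i := fun i : {i // e i = k} => (i : ℕ × ℕ)) Subtype.val_injective
    have h2 := h.mul_right ((2 : ℝ) ^ k)
    refine h2.congr fun i => ?_
    have hi : e i = k := i.2
    simp only [Function.comp_apply, hi, b]
    rw [mul_assoc, ← mul_pow]
    norm_num
  have hcs : ∀ k x, Summable fun i : {i // e i = k} => c i x := fun k x =>
    Summable.of_norm_bounded (hfib k) fun i => hcb _ _
  refine ⟨fun k x => ∑' i : {i // e i = k}, c i x, fun k => ∑' i : {i // e i = k}, b i,
    fun k => ?_, fun k x => ?_, fun k x => ?_, fun k x => ?_, fun r h0 hr => ?_, fun x => ?_,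
    fun p hp x => ?_⟩
  · refine continuous_tsum (fun i => ?_) (hfib k) fun i x => hcb _ _
    simp only [c]
    fun_prop
  · refine tsum_congr fun i => ?_
    simp only [c, mul_neg, Real.cos_neg]
  · refine tsum_congr fun i => ?_
    simp only [c]
    have : 2 * Real.pi * (((i : ℕ × ℕ).2 : ℝ) + 1) * (x + 1) =
        2 * Real.pi * ((i : ℕ × ℕ).2 + 1) * x +
          (((i : ℕ × ℕ).2 + 1 : ℕ) : ℝ) * (2 * Real.pi) := by
      push_cast
      ring
    rw [this, Real.cos_add_nat_mul_two_pi]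
  · exact tsum_of_norm_bounded (f := fun i : {i // e i = k} => c i x) (hfib k).hasSum
      fun i => hcb i x
  · have h := (Equiv.sigmaFiberEquiv e).summable_iff.mpr (summable_nomeSum_bound he h0 hr)
    refine h.sigma.congr fun k => ?_
    rw [← tsum_mul_right]
    refine tsum_congr fun i => ?_
    simp [b, i.2]
  · have : IsEmpty {i // e i = 0} := ⟨fun i => he0 i.1 i.2⟩
    exact tsum_empty
  · have h := (Equiv.sigmaFiberEquiv e).hasSum_iff.mpr (summable_nomeSum he hp x).hasSum
    refine h.sigma fun k => ?_
    have h2 := (Complex.hasSum_ofReal.mpr (hcs k x).hasSum).mul_right (p ^ k)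
    refine hasSum_of_eq h2 fun i => ?_
    simp [c, i.2]

theorem isNomeSeries_even : IsNomeSeries (nomeSum evenExp) :=
  isNomeSeries_nomeSum (fun i => by unfold evenExp; nlinarith [Nat.zero_le (i.1 * i.2)])
    fun i => by unfold evenExp; positivity

theorem isNomeSeries_odd : IsNomeSeries (nomeSum oddExp) :=
  isNomeSeries_nomeSum (fun i => by unfold oddExp; nlinarith [Nat.zero_le (i.1 * i.2)])
    fun i => by unfold oddExp; positivity

/-- The contribution of `℘ (x)` and `℘ (x + 1 / 2)`, on the real axis. -/
def realNome (p : ℂ) (x : ℝ) : ℂ := nomeSum evenExp p x - nomeSum evenExp p 0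

/-- The contribution of `℘ (x + τ / 2)` and `℘ (x - (τ + 1) / 2)`. -/
def halfNome (p : ℂ) (x : ℝ) : ℂ := nomeSum oddExp p x - nomeSum evenExp p 0

theorem isNomeSeries_realNome : IsNomeSeries realNome :=
  isNomeSeries_even.sub isNomeSeries_even.apply_zero

theorem isNomeSeries_halfNome : IsNomeSeries halfNome :=
  isNomeSeries_odd.sub isNomeSeries_even.apply_zero

/-- The part of the elliptic potential that depends on a single coordinate, without its value at
`p = 0`. -/
def oneBodyNome (lc : Fin 4 → ℝ) (p : ℂ) (x : ℝ) : ℂ :=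
  ((lc 0 * (lc 0 + 1) : ℝ) : ℂ) * realNome p x +
  ((lc 1 * (lc 1 + 1) : ℝ) : ℂ) * realNome p (x + 1 / 2) +
  ((lc 2 * (lc 2 + 1) : ℝ) : ℂ) * halfNome p (x + 1 / 2) +
  ((lc 3 * (lc 3 + 1) : ℝ) : ℂ) * halfNome p x

theorem isNomeSeries_oneBodyNome (lc : Fin 4 → ℝ) : IsNomeSeries (oneBodyNome lc) :=
  (((isNomeSeries_realNome.const_mul _).add (isNomeSeries_realNome.comp_add_half.const_mul _)).add
    (isNomeSeries_halfNome.comp_add_half.const_mul _)).add (isNomeSeries_halfNome.const_mul _)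

/-- A function with the symmetries of the model: permutations of the coordinates, sign changes and
integral translations. -/
structure IsInvariant {N : ℕ} {α : Type*} (h : (Fin N → ℝ) → α) : Prop where
  swap : ∀ (i j : Fin N) x, h (x ∘ Equiv.swap i j) = h x
  neg : ∀ (i : Fin N) x, h (Function.update x i (-x i)) = h x
  translate : ∀ (n : Fin N → ℤ) x, h (fun j => x j + n j) = h x

theorem sum_Ioi_eq_half {N : ℕ} {K : Type*} [Field K] [CharZero K] (f : Fin N → Fin N → K)
    (hf : ∀ i j, f i j = f j i) :
    ∑ i, ∑ j ∈ Finset.Ioi i, f i j = (∑ i, ∑ j ∈ ({i} : Finset (Fin N))ᶜ, f i j) / 2 := by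
  have h := Finset.sum_sum_Ioi_add_eq_sum_sum_off_diag f
  have h2 : ∑ i, ∑ j ∈ ({i} : Finset (Fin N))ᶜ, f i j =
      ∑ i, ∑ j ∈ ({i} : Finset (Fin N))ᶜ, f j i :=
    Finset.sum_congr rfl fun i _ => Finset.sum_congr rfl fun j _ => hf i j
  rw [h2, ← h]
  simp only [hf, ← two_mul, ← Finset.mul_sum]
  field_simp

@[to_additive]
theorem prod_offDiag_comp_perm {N : ℕ} {K : Type*} [CommMonoid K] (f : Fin N → Fin N → K)
    (σ : Equiv.Perm (Fin N)) :
    ∏ i, ∏ j ∈ ({i} : Finset (Fin N))ᶜ, f (σ i) (σ j) =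
      ∏ i, ∏ j ∈ ({i} : Finset (Fin N))ᶜ, f i j := by
  rw [← Equiv.prod_comp σ fun i => ∏ j ∈ ({i} : Finset (Fin N))ᶜ, f i j]
  refine Finset.prod_congr rfl fun i _ => ?_
  refine Finset.prod_bij (fun j _ => σ j) ?_ ?_ ?_ ?_
  · intro j hj
    simpa using hj
  · intro a _ b _ h
    exact σ.injective h
  · intro b hb
    refine ⟨σ.symm b, ?_, by simp⟩
    simp only [Finset.mem_compl, Finset.mem_singleton] at hb ⊢
    exact fun h => hb (by rw [← h]; simp)
  · intro _ _
    rfl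

/-- The one- and two-body potential made from even periodic functions. -/
def pairPotential {N : ℕ} (v w : ℝ → ℝ) (x : Fin N → ℝ) : ℝ :=
  ∑ j, v (x j) + ∑ j, ∑ k ∈ Finset.Ioi j, (w (x j - x k) + w (x j + x k))

theorem periodic_int {v : ℝ → ℝ} (h : ∀ x, v (x + 1) = v x) (x : ℝ) (n : ℤ) :
    v (x + n) = v x := by
  have : Function.Periodic v 1 := h
  simpa using this.int_mul n x

theorem isInvariant_pairPotential {N : ℕ} {v w : ℝ → ℝ} (hv : ∀ x, v (-x) = v x)
    (hv1 : ∀ x, v (x + 1) = v x) (hw : ∀ x, w (-x) = w x) (hw1 : ∀ x, w (x + 1) = w x) :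
    IsInvariant (pairPotential (N := N) v w) := by
  refine ⟨fun i j x => ?_, fun i x => ?_, fun n x => ?_⟩
  · unfold pairPotential
    have hs : ∀ (x : Fin N → ℝ) i j, w (x i - x j) + w (x i + x j) =
        w (x j - x i) + w (x j + x i) := by
      intro x i j
      rw [← hw (x i - x j), neg_sub, add_comm (x i)]
    rw [sum_Ioi_eq_half _ (hs x), sum_Ioi_eq_half _ (hs _)]
    congr 1
    · exact Equiv.sum_comp (Equiv.swap i j) fun j => v (x j)
    · exact congrArg (· / 2)
        (sum_offDiag_comp_perm (fun i j => w (x i - x j) + w (x i + x j)) _)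
  · have hev : ∀ j, Function.update x i (-x i) j = x j ∨ Function.update x i (-x i) j = -x j := by
      intro j
      by_cases h : j = i
      · subst h
        simp
      · simp [h]
    unfold pairPotential
    congr 1
    · refine Finset.sum_congr rfl fun j _ => ?_
      rcases hev j with h | h <;> rw [h]
      exact hv _
    · refine Finset.sum_congr rfl fun j _ => Finset.sum_congr rfl fun k _ => ?_
      rcases hev j with h | h <;> rcases hev k with h' | h' <;> rw [h, h']
      · rw [sub_neg_eq_add, ← sub_eq_add_neg, add_comm]
      · rw [← hw (-x j - x k), ← hw (-x j + x k)]
        ring_nf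
      · rw [← hw (-x j - -x k), ← hw (-x j + -x k)]
        ring_nf
  · unfold pairPotential
    congr 1
    · exact Finset.sum_congr rfl fun j _ => periodic_int hv1 _ _
    · refine Finset.sum_congr rfl fun j _ => Finset.sum_congr rfl fun k _ => ?_
      have e1 : x j + n j - (x k + n k) = x j - x k + ((n j - n k : ℤ) : ℝ) := by push_cast; ring
      have e2 : x j + n j + (x k + n k) = x j + x k + ((n j + n k : ℤ) : ℝ) := by push_cast; ring
      rw [e1, e2, periodic_int hw1, periodic_int hw1]

theorem abs_pairPotential_le {N : ℕ} {v w : ℝ → ℝ} {a b : ℝ} (hv : ∀ x, |v x| ≤ a)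
    (hw : ∀ x, |w x| ≤ b) (x : Fin N → ℝ) :
    |pairPotential v w x| ≤ N * a + N * (N * (b + b)) := by
  have hb : 0 ≤ b := (abs_nonneg _).trans (hw 0)
  unfold pairPotential
  refine (abs_add_le _ _).trans (add_le_add ?_ ?_)
  · refine (Finset.abs_sum_le_sum_abs _ _).trans ((Finset.sum_le_sum fun j _ => hv _).trans ?_)
    simp
  · refine (Finset.abs_sum_le_sum_abs _ _).trans
      ((Finset.sum_le_sum (g := fun _ => N * (b + b)) fun j _ => ?_).trans ?_)
    · refine (Finset.abs_sum_le_sum_abs _ _).trans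
        ((Finset.sum_le_sum (g := fun _ => b + b) fun k _ =>
          (abs_add_le _ _).trans (add_le_add (hw _) (hw _))).trans ?_)
      rw [Finset.sum_const, nsmul_eq_mul]
      refine mul_le_mul_of_nonneg_right ?_ (by positivity)
      exact_mod_cast (Finset.card_le_univ _).trans (by simp)
    · simp

/-- A point at which the potential of `H_T` has no singularity. -/
def IsRegular {N : ℕ} (x : Fin N → ℝ) : Prop :=
  (∀ j, Real.sin (Real.pi * x j) ≠ 0 ∧ Real.cos (Real.pi * x j) ≠ 0) ∧
    ∀ j k, j ≠ k → Real.sin (Real.pi * (x j - x k)) ≠ 0 ∧ Real.sin (Real.pi * (x j + x k)) ≠ 0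

theorem groundState_ne_zero_iff {N : ℕ} {l : ℝ} {lc : Fin 4 → ℝ} (hl : 0 ≤ l) (hl0 : 0 ≤ lc 0)
    (hl1 : 0 ≤ lc 1) {x : Fin N → ℝ} : groundState l lc x ≠ 0 ↔ IsRegular x := by
  have hne : ∀ a : ℝ, 0 ≤ a → (a : ℂ) + 1 ≠ 0 := by
    intro a ha h
    have : ((a + 1 : ℝ) : ℂ) = 0 := by push_cast; exact h
    have := Complex.ofReal_eq_zero.mp this
    linarith
  unfold groundState IsRegular
  simp only [ne_eq, mul_eq_zero, Finset.prod_eq_zero_iff, Complex.cpow_eq_zero_iff,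
    Complex.ofReal_eq_zero, not_or, not_exists, not_and, not_not, hne _ hl, hne _ hl0, hne _ hl1,
    Finset.mem_univ, Finset.mem_Ioi, true_and, imp_false]
  constructor
  · rintro ⟨h1, h2⟩
    refine ⟨h1, fun j k hjk => ?_⟩
    rcases lt_or_gt_of_ne hjk with h | h
    · exact h2 j k h
    · have := h2 k j h
      refine ⟨fun h0 => this.1 ?_, fun h0 => this.2 (by rwa [add_comm])⟩
      rw [← neg_sub, mul_neg, Real.sin_neg, h0, neg_zero]
  · rintro ⟨h1, h2⟩
    exact ⟨h1, fun j k hjk => h2 j k hjk.ne⟩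

theorem sum_Ioi_const (N : ℕ) : ∑ j : Fin N, ∑ _k ∈ Finset.Ioi j, (1 : ℂ) = N * (N - 1) / 2 := by
  rw [sum_Ioi_eq_half (fun _ _ => (1 : ℂ)) fun _ _ => rfl]
  simp only [Finset.sum_const, Finset.card_compl, Finset.card_singleton, Fintype.card_fin,
    nsmul_eq_mul, mul_one, Finset.card_univ]
  rcases N with _ | N
  · simp
  · simp

/-- The half period `-(τ + 1) / 2` is `(1 + τ) / 2` modulo the lattice. -/
theorem weierstrassP_add_half (τ : UpperHalfPlane) (x : ℝ) :
    (periods τ).weierstrassP (x + -((τ : ℂ) + 1) / 2) =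
      (periods τ).weierstrassP (((x + 1 / 2 : ℝ) : ℂ) + τ / 2) := by
  have h : (1 : ℂ) + τ ∈ (periods τ).lattice := PeriodPair.mem_lattice.mpr ⟨1, 1, by simp [periods]⟩
  have := (periods τ).weierstrassP_add_coe (x + -((τ : ℂ) + 1) / 2) ⟨_, h⟩
  rw [← this]
  congr 1
  push_cast
  ring

theorem ellipticPotential_sub {N : ℕ} (l : ℝ) (lc : Fin 4 → ℝ) (τ : UpperHalfPlane)
    {x : Fin N → ℝ} (hx : IsRegular x) :
    ellipticPotential l lc τ x - ((trigPotential l lc x + trigConst N l lc : ℝ) : ℂ) =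
      ∑ j, oneBodyNome lc (Complex.exp (Real.pi * Complex.I * τ)) (x j) +
      ∑ j, ∑ k ∈ Finset.Ioi j, ((2 * l * (l + 1) : ℝ) : ℂ) *
        (realNome (Complex.exp (Real.pi * Complex.I * τ)) (x j - x k) +
          realNome (Complex.exp (Real.pi * Complex.I * τ)) (x j + x k)) := by
  set p := Complex.exp (Real.pi * Complex.I * τ) with hp
  have hone : ∀ j, ∑ i, ((lc i * (lc i + 1) : ℝ) : ℂ) *
      (periods τ).weierstrassP ((x j : ℂ) + halfPeriod τ i) =
      ((Real.pi ^ 2 * lc 0 * (lc 0 + 1) / Real.sin (Real.pi * x j) ^ 2 +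
        Real.pi ^ 2 * lc 1 * (lc 1 + 1) / Real.cos (Real.pi * x j) ^ 2 -
        Real.pi ^ 2 / 3 * ∑ i, lc i * (lc i + 1) : ℝ) : ℂ) + oneBodyNome lc p (x j) := by
    intro j
    have hc : Real.sin (Real.pi * (x j + 1 / 2)) = Real.cos (Real.pi * x j) := by
      rw [mul_add, mul_one_div, Real.sin_add_pi_div_two]
    have hc' : Complex.sin (Real.pi * (x j + 1 / 2 : ℝ)) = Complex.cos (Real.pi * x j) := by
      exact_mod_cast congrArg (fun y : ℝ => (y : ℂ)) hc
    have e1 : (x j : ℂ) + 1 / 2 = ((x j + 1 / 2 : ℝ) : ℂ) := by push_cast; ring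
    rw [Fin.sum_univ_four, Fin.sum_univ_four]
    simp only [halfPeriod, Matrix.cons_val_zero, Matrix.cons_val_one, Matrix.cons_val, add_zero]
    rw [weierstrassP_ofReal τ (hx.1 j).1, e1, weierstrassP_ofReal τ (hc ▸ (hx.1 j).2), hc',
      weierstrassP_add_half, weierstrassP_ofReal_add_half_period,
      weierstrassP_ofReal_add_half_period, ← hp]
    unfold oneBodyNome realNome halfNome
    push_cast
    ring
  have htwo : ∀ j, ∀ k ∈ Finset.Ioi j,
      ((2 * l * (l + 1) : ℝ) : ℂ) * ((periods τ).weierstrassP ((x j : ℂ) - (x k : ℂ)) +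
        (periods τ).weierstrassP ((x j : ℂ) + (x k : ℂ))) =
      ((2 * Real.pi ^ 2 * l * (l + 1) / Real.sin (Real.pi * (x j - x k)) ^ 2 +
      2 * Real.pi ^ 2 * l * (l + 1) / Real.sin (Real.pi * (x j + x k)) ^ 2 : ℝ) : ℂ) -
      ((4 * Real.pi ^ 2 / 3 * l * (l + 1) : ℝ) : ℂ) * 1 +
      ((2 * l * (l + 1) : ℝ) : ℂ) * (realNome p (x j - x k) + realNome p (x j + x k)) := by
    intro j k hk
    have hr := hx.2 j k (Finset.mem_Ioi.mp hk).ne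
    rw [← Complex.ofReal_sub, ← Complex.ofReal_add, weierstrassP_ofReal τ hr.1,
      weierstrassP_ofReal τ hr.2, ← hp]
    unfold realNome
    push_cast
    ring
  have hms : ∀ (c : ℂ) (f : Fin N → Fin N → ℂ), c * ∑ j, ∑ k ∈ Finset.Ioi j, f j k =
      ∑ j, ∑ k ∈ Finset.Ioi j, c * f j k := by
    intro c f
    simp only [Finset.mul_sum]
  unfold ellipticPotential
  rw [Finset.sum_congr rfl fun j _ => hone j, hms,
    Finset.sum_congr rfl fun j _ => Finset.sum_congr rfl (htwo j)]
  simp only [Finset.sum_add_distrib, Finset.sum_sub_distrib, ← Finset.mul_sum, sum_Ioi_const]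
  unfold trigPotential trigConst
  push_cast
  simp only [Finset.sum_add_distrib, Finset.sum_sub_distrib, Finset.sum_const, Finset.card_univ,
    Fintype.card_fin, nsmul_eq_mul]
  ring

/-- The coefficients of the expansion of the elliptic potential in powers of the nome. -/
theorem exists_potential_expansion (N : ℕ) (l : ℝ) (lc : Fin 4 → ℝ) :
    ∃ (V : ℕ → (Fin N → ℝ) → ℝ) (M : ℕ → ℝ),
      (∀ k, Continuous (V k)) ∧ (∀ k, IsInvariant (V k)) ∧ (∀ k x, |V k x| ≤ M k) ∧
      (∀ r : ℝ, 0 ≤ r → r < 1 → Summable fun k => M k * r ^ k) ∧ (∀ x, V 0 x = 0) ∧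
      ∀ (τ : UpperHalfPlane) (x : Fin N → ℝ), IsRegular x →
        HasSum (fun k : ℕ => (V k x : ℂ) * Complex.exp (Real.pi * Complex.I * (τ : ℂ)) ^ k)
          (ellipticPotential l lc τ x -
            ((trigPotential l lc x + trigConst N l lc : ℝ) : ℂ)) := by
  obtain ⟨V, M, h1, h2, h3, h4, h5, h6, h7⟩ := isNomeSeries_oneBodyNome lc
  obtain ⟨V', M', h1', h2', h3', h4', h5', h6', h7'⟩ :=
    isNomeSeries_realNome.const_mul (2 * l * (l + 1))
  refine ⟨fun k => pairPotential (V k) (V' k), fun k => N * M k + N * (N * (M' k + M' k)),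
    fun k => ?_, fun k => isInvariant_pairPotential (h2 k) (h3 k) (h2' k) (h3' k),
    fun k x => abs_pairPotential_le (h4 k) (h4' k) x, fun r h0 hr => ?_, fun x => ?_,
    fun τ x hx => ?_⟩
  · unfold pairPotential
    have := h1 k
    have := h1' k
    fun_prop
  · have := ((h5 r h0 hr).mul_left (N : ℝ)).add
      (((h5' r h0 hr).add (h5' r h0 hr)).mul_left ((N : ℝ) * N))
    refine this.congr fun k => ?_
    ring
  · simp [pairPotential, h6, h6']
  · rw [ellipticPotential_sub l lc τ hx]
    have hp := norm_exp_pi_I_lt_one τ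
    have s1 := hasSum_sum (s := Finset.univ) fun j _ => h7 _ hp (x j)
    have s2 := hasSum_sum (s := Finset.univ) fun j _ => hasSum_sum (s := Finset.Ioi j)
      fun k _ => (h7' _ hp (x j - x k)).add (h7' _ hp (x j + x k))
    have s3 := s1.add s2
    simp only [← mul_add] at s3
    refine hasSum_of_eq s3 fun k => ?_
    simp only [pairPotential]
    push_cast
    simp only [← add_mul, ← Finset.sum_mul]

/-! ### The ground state -/

/-- The coordinates `cos (2 π x_j)`, in which the gauged operator has polynomial coefficients. -/
def cosCoord {N : ℕ} (x : Fin N → ℝ) (j : Fin N) : ℝ := Real.cos (2 * Real.pi * x j)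

theorem sin_sq_eq_cosCoord {N : ℕ} (x : Fin N → ℝ) (j : Fin N) :
    Real.sin (Real.pi * x j) ^ 2 = (1 - cosCoord x j) / 2 := by
  rw [cosCoord, mul_assoc, Real.cos_two_mul, Real.cos_sq']
  ring

theorem cos_sq_eq_cosCoord {N : ℕ} (x : Fin N → ℝ) (j : Fin N) :
    Real.cos (Real.pi * x j) ^ 2 = (1 + cosCoord x j) / 2 := by
  rw [cosCoord, mul_assoc, Real.cos_two_mul]
  ring

theorem sin_two_sq_eq_cosCoord {N : ℕ} (x : Fin N → ℝ) (j : Fin N) :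
    Real.sin (2 * Real.pi * x j) ^ 2 = 1 - cosCoord x j ^ 2 := Real.sin_sq _

theorem sin_sub_mul_sin_add {N : ℕ} (x : Fin N → ℝ) (j k : Fin N) :
    Real.sin (Real.pi * (x j - x k)) * Real.sin (Real.pi * (x j + x k)) =
      (cosCoord x k - cosCoord x j) / 2 := by
  rw [cosCoord, cosCoord, mul_assoc, Real.cos_two_mul, mul_assoc, Real.cos_two_mul, mul_sub,
    mul_add, Real.sin_sub, Real.sin_add]
  linear_combination (Real.cos (Real.pi * x k)) ^ 2 * (Real.sin_sq (Real.pi * x j)) -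
    (Real.cos (Real.pi * x j)) ^ 2 * (Real.sin_sq (Real.pi * x k))

theorem sin_sub_sq_add_sin_add_sq {N : ℕ} (x : Fin N → ℝ) (j k : Fin N) :
    Real.sin (Real.pi * (x j - x k)) ^ 2 + Real.sin (Real.pi * (x j + x k)) ^ 2 =
      1 - cosCoord x j * cosCoord x k := by
  rw [cosCoord, cosCoord, mul_assoc, Real.cos_two_mul, mul_assoc, Real.cos_two_mul, mul_sub,
    mul_add, Real.sin_sub, Real.sin_add]
  linear_combination (2 * (Real.cos (Real.pi * x k)) ^ 2) * (Real.sin_sq (Real.pi * x j)) +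
    (2 * (Real.cos (Real.pi * x j)) ^ 2) * (Real.sin_sq (Real.pi * x k))

theorem isRegular_iff {N : ℕ} {x : Fin N → ℝ} :
    IsRegular x ↔ (∀ j, 1 - cosCoord x j ≠ 0 ∧ 1 + cosCoord x j ≠ 0) ∧
      ∀ j k, j ≠ k → cosCoord x k - cosCoord x j ≠ 0 := by
  have h1 : ∀ j, Real.sin (Real.pi * x j) ≠ 0 ↔ 1 - cosCoord x j ≠ 0 := by
    intro j
    rw [← pow_ne_zero_iff (n := 2) two_ne_zero, sin_sq_eq_cosCoord]
    simp
  have h2 : ∀ j, Real.cos (Real.pi * x j) ≠ 0 ↔ 1 + cosCoord x j ≠ 0 := by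
    intro j
    rw [← pow_ne_zero_iff (n := 2) two_ne_zero, cos_sq_eq_cosCoord]
    simp
  have h3 : ∀ j k, (Real.sin (Real.pi * (x j - x k)) ≠ 0 ∧
      Real.sin (Real.pi * (x j + x k)) ≠ 0) ↔ cosCoord x k - cosCoord x j ≠ 0 := by
    intro j k
    rw [← mul_ne_zero_iff, sin_sub_mul_sin_add]
    simp
  unfold IsRegular
  simp only [h1, h2, h3]

theorem continuous_cosCoord {N : ℕ} (j : Fin N) :
    Continuous fun x : Fin N → ℝ => cosCoord x j := by
  unfold cosCoord
  fun_prop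

theorem isOpen_isRegular (N : ℕ) : IsOpen {x : Fin N → ℝ | IsRegular x} := by
  simp only [isRegular_iff, Set.ofPred_and, Set.ofPred_forall]
  have := continuous_cosCoord (N := N)
  refine IsOpen.inter ?_ ?_
  · exact isOpen_iInter_of_finite fun j => (isOpen_ne_fun (by fun_prop) (by fun_prop)).inter
      (isOpen_ne_fun (by fun_prop) (by fun_prop))
  · exact isOpen_iInter_of_finite fun j => isOpen_iInter_of_finite fun k =>
      isOpen_iInter_of_finite fun _ => isOpen_ne_fun (by fun_prop) (by fun_prop)

theorem ae_linearMap_ne {N : ℕ} (L : (Fin N → ℝ) →ₗ[ℝ] ℝ) (hL : L ≠ 0) (c : ℝ) :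
    ∀ᵐ x, L x ≠ c := by
  obtain ⟨v, hv⟩ : ∃ v, L v ≠ 0 := by
    by_contra! h
    exact hL (LinearMap.ext h)
  let S : AffineSubspace ℝ (Fin N → ℝ) :=
    (AffineSubspace.mk' c (⊥ : Submodule ℝ ℝ)).comap L.toAffineMap
  have hS : ∀ x, x ∈ S ↔ L x = c := by
    intro x
    simp [S, AffineSubspace.mem_comap, AffineSubspace.mem_mk', sub_eq_zero]
  have hne : S ≠ ⊤ := by
    intro h
    have h1 : ((c + 1) / L v) • v ∈ S := h ▸ AffineSubspace.mem_top _ _ _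
    rw [hS, map_smul, smul_eq_mul, div_mul_cancel₀ _ hv] at h1
    linarith
  rw [ae_iff]
  simpa [← hS] using Measure.addHaar_affineSubspace volume S hne

theorem ae_sin_pi_linearMap_ne_zero {N : ℕ} (L : (Fin N → ℝ) →ₗ[ℝ] ℝ) (hL : L ≠ 0) :
    ∀ᵐ x, Real.sin (Real.pi * L x) ≠ 0 := by
  filter_upwards [ae_all_iff.mpr fun n : ℤ => ae_linearMap_ne L hL n] with x hx h
  obtain ⟨n, hn⟩ := Real.sin_eq_zero_iff.mp h
  refine hx n ?_
  have := Real.pi_ne_zero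
  rw [mul_comm] at hn
  exact (mul_left_cancel₀ this hn).symm

theorem ae_isRegular (N : ℕ) : ∀ᵐ x : Fin N → ℝ, IsRegular x := by
  have h1 : ∀ j : Fin N, ∀ᵐ x : Fin N → ℝ, Real.sin (Real.pi * (2 * x j)) ≠ 0 := by
    intro j
    have hL : (2 : ℝ) • (LinearMap.proj j : (Fin N → ℝ) →ₗ[ℝ] ℝ) ≠ 0 := fun h => by
      simpa using LinearMap.congr_fun h (Pi.single j 1)
    exact (ae_sin_pi_linearMap_ne_zero _ hL).mono fun x hx => hx
  have h2 : ∀ j k : Fin N, j ≠ k → ∀ᵐ x : Fin N → ℝ, Real.sin (Real.pi * (x j - x k)) ≠ 0 := by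
    intro j k hjk
    have hL : (LinearMap.proj j : (Fin N → ℝ) →ₗ[ℝ] ℝ) - LinearMap.proj k ≠ 0 := fun h => by
      simpa [hjk.symm] using LinearMap.congr_fun h (Pi.single j 1)
    exact (ae_sin_pi_linearMap_ne_zero _ hL).mono fun x hx => hx
  have h3 : ∀ j k : Fin N, j ≠ k → ∀ᵐ x : Fin N → ℝ, Real.sin (Real.pi * (x j + x k)) ≠ 0 := by
    intro j k hjk
    have hL : (LinearMap.proj j : (Fin N → ℝ) →ₗ[ℝ] ℝ) + LinearMap.proj k ≠ 0 := fun h => by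
      simpa [hjk.symm] using LinearMap.congr_fun h (Pi.single j 1)
    exact (ae_sin_pi_linearMap_ne_zero _ hL).mono fun x hx => hx
  have h2' : ∀ᵐ x : Fin N → ℝ, ∀ j k, j ≠ k → Real.sin (Real.pi * (x j - x k)) ≠ 0 := by
    simpa only [ae_all_iff] using h2
  have h3' : ∀ᵐ x : Fin N → ℝ, ∀ j k, j ≠ k → Real.sin (Real.pi * (x j + x k)) ≠ 0 := by
    simpa only [ae_all_iff] using h3
  filter_upwards [ae_all_iff.mpr h1, h2', h3'] with x hx1 hx2 hx3
  refine ⟨fun j => ?_, fun j k hjk => ⟨hx2 j k hjk, hx3 j k hjk⟩⟩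
  have := hx1 j
  rw [mul_left_comm, Real.sin_two_mul, mul_assoc] at this
  exact mul_ne_zero_iff.mp (right_ne_zero_of_mul this)

/-! ### The weight -/

/-- The weight `|Φ_T|²`. -/
def weight {N : ℕ} (l : ℝ) (lc : Fin 4 → ℝ) (x : Fin N → ℝ) : ℝ := ‖groundState l lc x‖ ^ 2

theorem norm_groundState {N : ℕ} (l : ℝ) (lc : Fin 4 → ℝ) (x : Fin N → ℝ) :
    ‖groundState l lc x‖ = (∏ j, ‖Real.sin (Real.pi * x j)‖ ^ (lc 0 + 1) *
      ‖Real.cos (Real.pi * x j)‖ ^ (lc 1 + 1)) *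
        ∏ j, ∏ k ∈ Finset.Ioi j, ‖(cosCoord x k - cosCoord x j) / 2‖ ^ (l + 1) := by
  have h : ∀ a b : ℝ, ‖((a : ℝ) : ℂ) ^ ((b : ℂ) + 1)‖ = ‖a‖ ^ (b + 1) := by
    intro a b
    rw [← Complex.ofReal_one, ← Complex.ofReal_add, Complex.norm_cpow_real, Complex.norm_real]
  simp only [groundState, norm_mul, norm_prod, h, sin_sub_mul_sin_add]

theorem weight_eq {N : ℕ} (l : ℝ) (lc : Fin 4 → ℝ) (x : Fin N → ℝ) :
    weight l lc x = (∏ j, ‖Real.sin (Real.pi * x j)‖ ^ ((lc 0 + 1) * 2) *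
      ‖Real.cos (Real.pi * x j)‖ ^ ((lc 1 + 1) * 2)) *
        ∏ j, ∏ k ∈ Finset.Ioi j, ‖(cosCoord x k - cosCoord x j) / 2‖ ^ ((l + 1) * 2) := by
  have h : ∀ a b : ℝ, (‖a‖ ^ b) ^ 2 = ‖a‖ ^ (b * 2) := by
    intro a b
    rw [Real.rpow_mul (norm_nonneg a), Real.rpow_two]
  rw [weight, norm_groundState]
  simp only [mul_pow, ← Finset.prod_pow, h]

/-- The exponents `2 (l + 1)` of the weight are at least `2`, so the weight is continuously
differentiable even where the ground state vanishes. -/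
theorem contDiff_weight {N : ℕ} {l : ℝ} {lc : Fin 4 → ℝ} (hl : 0 ≤ l) (hl0 : 0 ≤ lc 0)
    (hl1 : 0 ≤ lc 1) : ContDiff ℝ 1 (weight (N := N) l lc) := by
  have he : weight (N := N) l lc = _ := funext (weight_eq l lc)
  rw [he]
  refine ContDiff.mul (contDiff_prod fun j _ => ContDiff.mul ?_ ?_)
    (contDiff_prod fun j _ => contDiff_prod fun k _ => ?_)
  · exact (contDiff_norm_rpow (by linarith)).comp
      (Real.contDiff_sin.comp (contDiff_const.mul (contDiff_apply ℝ ℝ j)))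
  · exact (contDiff_norm_rpow (by linarith)).comp
      (Real.contDiff_cos.comp (contDiff_const.mul (contDiff_apply ℝ ℝ j)))
  · refine (contDiff_norm_rpow (by linarith)).comp (ContDiff.div_const (ContDiff.sub ?_ ?_) _)
    · exact Real.contDiff_cos.comp (contDiff_const.mul (contDiff_apply ℝ ℝ k))
    · exact Real.contDiff_cos.comp (contDiff_const.mul (contDiff_apply ℝ ℝ j))

theorem norm_groundState_le_one {N : ℕ} {l : ℝ} {lc : Fin 4 → ℝ} (hl : 0 ≤ l) (hl0 : 0 ≤ lc 0)
    (hl1 : 0 ≤ lc 1) (x : Fin N → ℝ) : ‖groundState l lc x‖ ≤ 1 := by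
  rw [norm_groundState]
  refine mul_le_one₀ (Finset.prod_le_one (fun j _ => by positivity) fun j _ =>
    mul_le_one₀ ?_ (by positivity) ?_)
    (Finset.prod_nonneg fun j _ => Finset.prod_nonneg fun k _ => by positivity)
    (Finset.prod_le_one (fun j _ => Finset.prod_nonneg fun k _ => by positivity) fun j _ =>
      Finset.prod_le_one (fun k _ => by positivity) fun k _ => ?_)
  · exact Real.rpow_le_one (norm_nonneg _) (Real.abs_sin_le_one _) (by linarith)
  · exact Real.rpow_le_one (norm_nonneg _) (Real.abs_cos_le_one _) (by linarith)
  · refine Real.rpow_le_one (norm_nonneg _) ?_ (by linarith)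
    rw [← sin_sub_mul_sin_add, norm_mul]
    exact mul_le_one₀ (Real.abs_sin_le_one _) (norm_nonneg _) (Real.abs_sin_le_one _)

theorem cosCoord_comp {N : ℕ} (x : Fin N → ℝ) (σ : Fin N → Fin N) :
    cosCoord (x ∘ σ) = cosCoord x ∘ σ := rfl

theorem cosCoord_neg {N : ℕ} (x : Fin N → ℝ) (i : Fin N) :
    cosCoord (Function.update x i (-x i)) = cosCoord x := by
  funext j
  by_cases h : j = i
  · subst h
    simp [cosCoord]
  · simp [cosCoord, h]

theorem cosCoord_translate {N : ℕ} (x : Fin N → ℝ) (n : Fin N → ℤ) :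
    cosCoord (fun j => x j + n j) = cosCoord x := by
  funext j
  simp only [cosCoord]
  rw [mul_add, mul_comm (2 * Real.pi) (n j : ℝ), Real.cos_add_int_mul_two_pi]

theorem isInvariant_of_comp_cosCoord {N : ℕ} {α : Type*} {h : (Fin N → ℝ) → α}
    {f : (Fin N → ℝ) → α} (hf : ∀ x, h x = f (cosCoord x))
    (hs : ∀ (σ : Equiv.Perm (Fin N)) y, f (y ∘ σ) = f y) : IsInvariant h :=
  ⟨fun i j x => by rw [hf, hf, cosCoord_comp, hs], fun i x => by rw [hf, hf, cosCoord_neg],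
    fun n x => by rw [hf, hf, cosCoord_translate]⟩

/-- The weight as a function of the cosines, symmetric in them. -/
theorem weight_eq_cosCoord {N : ℕ} (l : ℝ) (lc : Fin 4 → ℝ) (x : Fin N → ℝ) :
    weight l lc x = (∏ j, ((1 - cosCoord x j) / 2) ^ (lc 0 + 1) *
      ((1 + cosCoord x j) / 2) ^ (lc 1 + 1)) *
        ∏ j, ∏ k ∈ ({j} : Finset (Fin N))ᶜ, ‖(cosCoord x j - cosCoord x k) / 2‖ ^ (l + 1) := by
  rw [weight_eq]
  have h : ∀ a b : ℝ, ‖a‖ ^ (b * 2) = (a ^ 2) ^ b := by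
    intro a b
    rw [mul_comm, Real.rpow_mul (norm_nonneg a), Real.rpow_two, Real.norm_eq_abs, sq_abs]
  congr 1
  · simp only [h, sin_sq_eq_cosCoord, cos_sq_eq_cosCoord]
  · have h2 := Finset.prod_prod_Ioi_mul_eq_prod_prod_off_diag
      fun j k => ‖(cosCoord x k - cosCoord x j) / 2‖ ^ (l + 1)
    rw [← h2]
    refine Finset.prod_congr rfl fun j _ => Finset.prod_congr rfl fun k _ => ?_
    have : ‖(cosCoord x j - cosCoord x k) / 2‖ = ‖(cosCoord x k - cosCoord x j) / 2‖ := by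
      rw [← norm_neg]
      ring_nf
    rw [this, h, ← sq_abs, ← Real.norm_eq_abs, sq, Real.mul_rpow (norm_nonneg _) (norm_nonneg _)]

theorem isInvariant_weight {N : ℕ} (l : ℝ) (lc : Fin 4 → ℝ) :
    IsInvariant (weight (N := N) l lc) := by
  refine isInvariant_of_comp_cosCoord (f := fun y => (∏ j, ((1 - y j) / 2) ^ (lc 0 + 1) *
      ((1 + y j) / 2) ^ (lc 1 + 1)) *
        ∏ j, ∏ k ∈ ({j} : Finset (Fin N))ᶜ, ‖(y j - y k) / 2‖ ^ (l + 1))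
    (weight_eq_cosCoord l lc) fun σ y => ?_
  congr 1
  · exact Equiv.prod_comp σ fun j => ((1 - y j) / 2) ^ (lc 0 + 1) * ((1 + y j) / 2) ^ (lc 1 + 1)
  · exact prod_offDiag_comp_perm (fun i j => ‖(y i - y j) / 2‖ ^ (l + 1)) σ

/-! ### Derivatives of the ground state -/

/-- The product rule for logarithmic derivatives `a i`. -/
theorem hasDerivAt_finset_prod_log {ι : Type*} (s : Finset ι) {f : ι → ℝ → ℂ} {v a : ι → ℂ} {t : ℝ}
    (hv : ∀ i ∈ s, f i t = v i) (h : ∀ i ∈ s, HasDerivAt (f i) (v i * a i) t) :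
    HasDerivAt (fun u => ∏ i ∈ s, f i u) ((∏ i ∈ s, v i) * ∑ i ∈ s, a i) t := by
  classical
  induction s using Finset.induction_on with
  | empty => simpa using hasDerivAt_const t (1 : ℂ)
  | insert i s hi ih =>
    have hv' : ∀ j ∈ s, f j t = v j := fun j hj => hv j (Finset.mem_insert_of_mem hj)
    have h1 := (h i (Finset.mem_insert_self i s)).mul
      (ih hv' fun j hj => h j (Finset.mem_insert_of_mem hj))
    simp only [Finset.prod_insert hi, Finset.sum_insert hi]
    refine h1.congr_deriv ?_
    rw [hv i (Finset.mem_insert_self i s), Finset.prod_congr rfl hv']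
    ring

theorem hasDerivAt_ofReal_cpow {b : ℝ → ℝ} {b' t c : ℝ} (hb : HasDerivAt b b' t) (h0 : b t ≠ 0)
    (hc : 0 ≤ c) : HasDerivAt (fun u => ((b u : ℝ) : ℂ) ^ ((c : ℂ) + 1))
      (((b t : ℝ) : ℂ) ^ ((c : ℂ) + 1) * (((c + 1) * b' / b t : ℝ) : ℂ)) t := by
  have hc1 : (c : ℂ) + 1 ≠ 0 := by
    intro h
    have : ((c + 1 : ℝ) : ℂ) = 0 := by push_cast; exact h
    have := Complex.ofReal_eq_zero.mp this
    linarith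
  have h0' : ((b t : ℝ) : ℂ) ≠ 0 := by exact_mod_cast h0
  have h1 := (hasDerivAt_ofReal_cpow_const h0 hc1).scomp t hb
  refine h1.congr_deriv ?_
  rw [Complex.cpow_sub _ _ h0', Complex.cpow_one, Complex.real_smul]
  push_cast
  field_simp

theorem hasDerivAt_cosCoord {N : ℕ} (x : Fin N → ℝ) (i j : Fin N) :
    HasDerivAt (fun t => cosCoord (Function.update x j t) i)
      (if i = j then -(2 * Real.pi * Real.sin (2 * Real.pi * x j)) else 0) (x j) := by
  unfold cosCoord
  by_cases h : i = j
  · subst h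
    simp only [Function.update_self, if_true]
    have := ((hasDerivAt_id (x i)).const_mul (2 * Real.pi)).cos
    refine this.congr_deriv ?_
    simp
    ring
  · simp only [h, if_false, Function.update_of_ne (f := x) (a' := j) h]
    exact hasDerivAt_const _ _

/-- The logarithmic derivative of the ground state with respect to `x_j`. -/
def drift {N : ℕ} (l : ℝ) (lc : Fin 4 → ℝ) (j : Fin N) (x : Fin N → ℝ) : ℝ :=
  Real.pi * ((lc 0 + 1) * Real.cos (Real.pi * x j) / Real.sin (Real.pi * x j) -
      (lc 1 + 1) * Real.sin (Real.pi * x j) / Real.cos (Real.pi * x j)) +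
    ∑ k ∈ ({j} : Finset (Fin N))ᶜ, 2 * Real.pi * (l + 1) * Real.sin (2 * Real.pi * x j) /
      (cosCoord x k - cosCoord x j)

theorem hasDerivAt_groundState {N : ℕ} {l : ℝ} {lc : Fin 4 → ℝ} (hl : 0 ≤ l) (hl0 : 0 ≤ lc 0)
    (hl1 : 0 ≤ lc 1) {x : Fin N → ℝ} (hx : IsRegular x) (j : Fin N) :
    HasDerivAt (fun t => groundState l lc (Function.update x j t))
      (groundState l lc x * drift l lc j x) (x j) := by
  have hx' := isRegular_iff.mp hx
  have hup : Function.update x j (x j) = x := Function.update_eq_self j x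
  have hcoord : ∀ i, HasDerivAt (fun t => Function.update x j t i) (if i = j then 1 else 0)
      (x j) := by
    intro i
    have := (hasDerivAt_pi.mp (hasDerivAt_update x j (x j))) i
    refine this.congr_deriv ?_
    simp [Pi.single_apply]
  have h1 : ∀ i, HasDerivAt (fun t => ((Real.sin (Real.pi * Function.update x j t i) : ℝ) : ℂ) ^
      ((lc 0 : ℂ) + 1) * ((Real.cos (Real.pi * Function.update x j t i) : ℝ) : ℂ) ^
        ((lc 1 : ℂ) + 1))
      ((((Real.sin (Real.pi * x i) : ℝ) : ℂ) ^ ((lc 0 : ℂ) + 1) *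
        ((Real.cos (Real.pi * x i) : ℝ) : ℂ) ^ ((lc 1 : ℂ) + 1)) *
        ((if i = j then Real.pi * ((lc 0 + 1) * Real.cos (Real.pi * x i) / Real.sin (Real.pi * x i) -
      (lc 1 + 1) * Real.sin (Real.pi * x i) / Real.cos (Real.pi * x i)) else 0 : ℝ) : ℂ))
        (x j) := by
    intro i
    have d := (hcoord i).const_mul Real.pi
    have hs := hasDerivAt_ofReal_cpow d.sin (c := lc 0) (by rw [hup]; exact (hx.1 i).1) hl0
    have hc := hasDerivAt_ofReal_cpow d.cos (c := lc 1) (by rw [hup]; exact (hx.1 i).2) hl1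
    refine (hs.mul hc).congr_deriv ?_
    simp only [hup]
    split_ifs with h
    · push_cast
      ring
    · push_cast
      ring
  have h2 : ∀ i, ∀ k ∈ Finset.Ioi i, HasDerivAt (fun t =>
      ((Real.sin (Real.pi * (Function.update x j t i - Function.update x j t k)) *
        Real.sin (Real.pi * (Function.update x j t i + Function.update x j t k)) : ℝ) : ℂ) ^
          ((l : ℂ) + 1))
      (((Real.sin (Real.pi * (x i - x k)) * Real.sin (Real.pi * (x i + x k)) : ℝ) : ℂ) ^
          ((l : ℂ) + 1) * (((if i = j then 2 * Real.pi * (l + 1) * Real.sin (2 * Real.pi * x j) /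
            (cosCoord x k - cosCoord x i) else 0) +
            (if k = j then 2 * Real.pi * (l + 1) * Real.sin (2 * Real.pi * x j) /
            (cosCoord x i - cosCoord x k) else 0) : ℝ) : ℂ)) (x j) := by
    intro i k hk
    have hik := (Finset.mem_Ioi.mp hk).ne
    simp only [sin_sub_mul_sin_add]
    have d := ((hasDerivAt_cosCoord x k j).sub (hasDerivAt_cosCoord x i j)).div_const 2
    have h := hasDerivAt_ofReal_cpow d (c := l) (by
      simp only [Pi.sub_apply, hup]
      exact div_ne_zero (hx'.2 i k hik) two_ne_zero) hl
    refine h.congr_deriv ?_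
    simp only [Pi.sub_apply, hup]
    congr 2
    have n1 := hx'.2 i k hik
    have n2 := hx'.2 k i hik.symm
    have e : cosCoord x i - cosCoord x k = -(cosCoord x k - cosCoord x i) := by ring
    rw [e]
    by_cases hi : i = j
    · have hkj : k ≠ j := fun h => hik (hi.trans h.symm)
      simp only [hi, hkj, if_true, if_false] at n1 ⊢
      field_simp
      ring
    · by_cases hk : k = j
      · simp only [hi, hk, if_true, if_false] at n1 ⊢
        field_simp
        ring
      · simp [hi, hk]
  have h3 := hasDerivAt_finset_prod_log Finset.univ (fun i _ => by simp only [hup])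
    fun i _ => h1 i
  have h4 := hasDerivAt_finset_prod_log Finset.univ
    (fun i _ => Finset.prod_congr rfl fun k _ => by simp only [hup])
    fun i _ => hasDerivAt_finset_prod_log (Finset.Ioi i) (fun k _ => by simp only [hup]) (h2 i)
  refine (h3.mul h4).congr_deriv ?_
  simp only [hup]
  have hsum : ∑ i : Fin N, ∑ k ∈ Finset.Ioi i,
      ((if i = j then 2 * Real.pi * (l + 1) * Real.sin (2 * Real.pi * x j) /
            (cosCoord x k - cosCoord x i) else 0) +
        (if k = j then 2 * Real.pi * (l + 1) * Real.sin (2 * Real.pi * x j) /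
            (cosCoord x i - cosCoord x k) else 0)) =
      ∑ k ∈ ({j} : Finset (Fin N))ᶜ, 2 * Real.pi * (l + 1) * Real.sin (2 * Real.pi * x j) /
        (cosCoord x k - cosCoord x j) := by
    rw [Finset.sum_sum_Ioi_add_eq_sum_sum_off_diag fun k i : Fin N =>
      if i = j then 2 * Real.pi * (l + 1) * Real.sin (2 * Real.pi * x j) /
            (cosCoord x k - cosCoord x i) else 0]
    rw [Finset.sum_eq_single j]
    · simp
    · intro i _ hi
      simp [hi]
    · simp
  rw [drift, ← hsum, Complex.ofReal_add]
  unfold groundState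
  simp only [← Complex.ofReal_sum, Finset.sum_ite_eq', Finset.mem_univ, if_true]
  ring

/-! ### The ground state identity -/

/-- The derivative of `drift l lc j` with respect to `x_j`. -/
def driftDeriv {N : ℕ} (l : ℝ) (lc : Fin 4 → ℝ) (j : Fin N) (x : Fin N → ℝ) : ℝ :=
  Real.pi ^ 2 * (-(lc 0 + 1) / Real.sin (Real.pi * x j) ^ 2 -
      (lc 1 + 1) / Real.cos (Real.pi * x j) ^ 2) +
    ∑ k ∈ ({j} : Finset (Fin N))ᶜ, 4 * Real.pi ^ 2 * (l + 1) *
      (cosCoord x j / (cosCoord x k - cosCoord x j) -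
        Real.sin (2 * Real.pi * x j) ^ 2 / (cosCoord x k - cosCoord x j) ^ 2)

theorem hasDerivAt_drift {N : ℕ} (l : ℝ) (lc : Fin 4 → ℝ) {x : Fin N → ℝ} (hx : IsRegular x)
    (j : Fin N) : HasDerivAt (fun t => drift l lc j (Function.update x j t))
      (driftDeriv l lc j x) (x j) := by
  have hx' := isRegular_iff.mp hx
  have hup : Function.update x j (x j) = x := Function.update_eq_self j x
  unfold drift driftDeriv
  refine HasDerivAt.add ?_ (HasDerivAt.fun_sum fun k hk => ?_)
  · simp only [Function.update_self]
    have hs : HasDerivAt (fun t => Real.sin (Real.pi * t))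
        (Real.cos (Real.pi * x j) * (Real.pi * 1)) (x j) :=
      ((hasDerivAt_id (x j)).const_mul Real.pi).sin
    have hc : HasDerivAt (fun t => Real.cos (Real.pi * t))
        (-Real.sin (Real.pi * x j) * (Real.pi * 1)) (x j) :=
      ((hasDerivAt_id (x j)).const_mul Real.pi).cos
    have h := ((((hc.const_mul (lc 0 + 1)).div hs (hx.1 j).1).sub
      ((hs.const_mul (lc 1 + 1)).div hc (hx.1 j).2)).const_mul Real.pi)
    refine h.congr_deriv ?_
    have h1 := (hx.1 j).1
    have h2 := (hx.1 j).2
    have h3 := Real.sin_sq_add_cos_sq (Real.pi * x j)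
    generalize Real.sin (Real.pi * x j) = s at *
    generalize Real.cos (Real.pi * x j) = c at *
    field_simp
    linear_combination (-(lc 0 + 1) * c ^ 2 - (lc 1 + 1) * s ^ 2) * h3
  · have hkj : k ≠ j := by simpa using hk
    have hS : HasDerivAt (fun t => Real.sin (2 * Real.pi * Function.update x j t j))
        (Real.cos (2 * Real.pi * x j) * (2 * Real.pi * 1)) (x j) := by
      simp only [Function.update_self]
      exact ((hasDerivAt_id (x j)).const_mul (2 * Real.pi)).sin
    have hd := (hasDerivAt_cosCoord x k j).sub (hasDerivAt_cosCoord x j j)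
    have hne := hx'.2 j k hkj.symm
    have h := (hS.const_mul (2 * Real.pi * (l + 1))).div hd (by
      simpa only [Pi.sub_apply, hup] using hne)
    refine h.congr_deriv ?_
    simp only [Pi.sub_apply, hup, hkj, if_true, if_false]
    change (2 * Real.pi * (l + 1) * (cosCoord x j * (2 * Real.pi * 1)) * _ - _) / _ = _
    field_simp
    ring

/-- The square of a one-body term plus two-body terms, sorted by the number of distinct indices. -/
theorem sum_add_sum_sq {N : ℕ} (a : Fin N → ℝ) (b : Fin N → Fin N → ℝ) :
    ∑ j, (a j + ∑ k ∈ ({j} : Finset (Fin N))ᶜ, b j k) ^ 2 =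
      ∑ j, a j ^ 2 + ∑ j, ∑ k ∈ ({j} : Finset (Fin N))ᶜ, (2 * a j * b j k + b j k ^ 2) +
      ∑ j, ∑ k, ∑ i, if j ≠ k ∧ k ≠ i ∧ i ≠ j then b j k * b j i else 0 := by
  rw [← Finset.sum_add_distrib, ← Finset.sum_add_distrib]
  refine Finset.sum_congr rfl fun j _ => ?_
  have hc : ∀ f : Fin N → ℝ, ∑ k ∈ ({j} : Finset (Fin N))ᶜ, f k =
      ∑ k, if j ≠ k then f k else 0 := by
    intro f
    rw [← Finset.sum_filter]
    congr 1
    ext k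
    simp [eq_comm]
  rw [add_sq, Finset.sum_add_distrib, ← Finset.mul_sum]
  have : (∑ k ∈ ({j} : Finset (Fin N))ᶜ, b j k) ^ 2 =
      ∑ k ∈ ({j} : Finset (Fin N))ᶜ, b j k ^ 2 +
        ∑ k, ∑ i, if j ≠ k ∧ k ≠ i ∧ i ≠ j then b j k * b j i else 0 := by
    rw [hc, hc, sq, Finset.sum_mul_sum, ← Finset.sum_add_distrib]
    refine Finset.sum_congr rfl fun k _ => ?_
    have h1 : (if j ≠ k then b j k ^ 2 else 0) =
        ∑ i, if i = k then (if j ≠ k then b j k ^ 2 else 0) else 0 := by simp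
    rw [h1, ← Finset.sum_add_distrib]
    refine Finset.sum_congr rfl fun i _ => ?_
    by_cases hk : j = k
    · simp [hk]
    · by_cases hi : i = k
      · simp [hk, hi, sq]
      · by_cases hij : j = i
        · simp [hi, hij]
        · simp [hk, hi, hij, Ne.symm hi, Ne.symm hij]
  rw [this]
  ring

theorem three_mul_sum_cyclic {N : ℕ} (g : Fin N → Fin N → Fin N → ℝ) :
    3 * ∑ j, ∑ k, ∑ i, g j k i = ∑ j, ∑ k, ∑ i, (g j k i + g k i j + g i j k) := by
  have h1 : ∀ g : Fin N → Fin N → Fin N → ℝ,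
      ∑ j, ∑ k, ∑ i, g k i j = ∑ j, ∑ k, ∑ i, g j k i := by
    intro g
    rw [Finset.sum_comm]
    refine Finset.sum_congr rfl fun k _ => ?_
    exact Finset.sum_comm
  have h2 : ∑ j, ∑ k, ∑ i, g i j k = ∑ j, ∑ k, ∑ i, g j k i :=
    (h1 fun j k i => g i j k).symm
  simp only [Finset.sum_add_distrib, h1 g, h2]
  ring

/-- The ground state is an eigenfunction of `H_T`: the poles of the products of two logarithmic
derivatives with three different indices cancel cyclically. -/
theorem exists_sum_drift_sq_add_driftDeriv (N : ℕ) (l : ℝ) (lc : Fin 4 → ℝ) :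
    ∃ E : ℝ, ∀ x : Fin N → ℝ, IsRegular x →
      ∑ j, (drift l lc j x ^ 2 + driftDeriv l lc j x) = trigPotential l lc x + E := by
  let m := l + 1
  let a := lc 0 + 1
  let b := lc 1 + 1
  refine ⟨-(∑ _j : Fin N, Real.pi ^ 2 * (a + b) ^ 2) -
      (∑ j : Fin N, ∑ _k ∈ Finset.Ioi j, 4 * Real.pi ^ 2 * m * (a + b + m)) +
      (∑ j : Fin N, ∑ k, ∑ i, if j ≠ k ∧ k ≠ i ∧ i ≠ j then
        -(4 * Real.pi ^ 2 * m ^ 2) else 0) / 3, fun x hx => ?_⟩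
  have hx' := isRegular_iff.mp hx
  let α : Fin N → ℝ := fun j => Real.pi * (a * Real.cos (Real.pi * x j) / Real.sin (Real.pi * x j) -
      b * Real.sin (Real.pi * x j) / Real.cos (Real.pi * x j))
  let β : Fin N → Fin N → ℝ := fun j k => 2 * Real.pi * m * Real.sin (2 * Real.pi * x j) /
      (cosCoord x k - cosCoord x j)
  have hdrift : ∀ j, drift l lc j x = α j + ∑ k ∈ ({j} : Finset (Fin N))ᶜ, β j k := fun j => rfl
  -- the terms that involve one coordinate
  have h1 : ∀ j, α j ^ 2 + Real.pi ^ 2 * (-a / Real.sin (Real.pi * x j) ^ 2 -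
      b / Real.cos (Real.pi * x j) ^ 2) =
      (Real.pi ^ 2 * lc 0 * (lc 0 + 1) / Real.sin (Real.pi * x j) ^ 2 +
      Real.pi ^ 2 * lc 1 * (lc 1 + 1) / Real.cos (Real.pi * x j) ^ 2) -
        Real.pi ^ 2 * (a + b) ^ 2 := by
    intro j
    have h1 := (hx.1 j).1
    have h2 := (hx.1 j).2
    have h3 := Real.sin_sq_add_cos_sq (Real.pi * x j)
    simp only [α, a, b]
    generalize Real.sin (Real.pi * x j) = s at *
    generalize Real.cos (Real.pi * x j) = c at *
    have h4 : c ^ 2 = 1 - s ^ 2 := by linarith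
    have h5 : (1 - s ^ 2) ≠ 0 := h4 ▸ pow_ne_zero 2 h2
    have e : ∀ A B : ℝ, (A * c / s - B * s / c) ^ 2 =
        A ^ 2 * c ^ 2 / s ^ 2 - 2 * A * B + B ^ 2 * s ^ 2 / c ^ 2 := by
      intro A B
      field_simp
      ring
    rw [mul_pow, e, h4]
    field_simp
    ring
  -- the terms that involve two coordinates
  have h2 : ∀ j, ∀ k ∈ Finset.Ioi j,
      (2 * α j * β j k + β j k ^ 2 + 4 * Real.pi ^ 2 * m *
      (cosCoord x j / (cosCoord x k - cosCoord x j) -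
        Real.sin (2 * Real.pi * x j) ^ 2 / (cosCoord x k - cosCoord x j) ^ 2)) +
      (2 * α k * β k j + β k j ^ 2 + 4 * Real.pi ^ 2 * m *
      (cosCoord x k / (cosCoord x j - cosCoord x k) -
        Real.sin (2 * Real.pi * x k) ^ 2 / (cosCoord x j - cosCoord x k) ^ 2)) =
      (2 * Real.pi ^ 2 * l * (l + 1) / Real.sin (Real.pi * (x j - x k)) ^ 2 +
      2 * Real.pi ^ 2 * l * (l + 1) / Real.sin (Real.pi * (x j + x k)) ^ 2) -
        4 * Real.pi ^ 2 * m * (a + b + m) := by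
    intro j k hk
    have hjk := (Finset.mem_Ioi.mp hk).ne
    have hne := hx'.2 j k hjk
    have hne' := hx'.2 k j hjk.symm
    have hαS : ∀ j, α j * Real.sin (2 * Real.pi * x j) =
        Real.pi * (a * (1 + cosCoord x j) - b * (1 - cosCoord x j)) := by
      intro j
      have h1 := (hx.1 j).1
      have h2 := (hx.1 j).2
      have h3 := sin_sq_eq_cosCoord x j
      have h4 := cos_sq_eq_cosCoord x j
      simp only [α]
      rw [mul_assoc 2, Real.sin_two_mul]
      generalize Real.sin (Real.pi * x j) = s at *
      generalize Real.cos (Real.pi * x j) = c at *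
      have e : Real.pi * (a * c / s - b * s / c) * (2 * s * c) =
          Real.pi * (a * (2 * c ^ 2) - b * (2 * s ^ 2)) := by
        field_simp
      rw [e, h3, h4]
      ring
    have hαβ : ∀ j k, 2 * α j * β j k = 4 * Real.pi ^ 2 * m *
        (a * (1 + cosCoord x j) - b * (1 - cosCoord x j)) / (cosCoord x k - cosCoord x j) := by
      intro j k
      have : 2 * α j * β j k = 4 * Real.pi * m * (α j * Real.sin (2 * Real.pi * x j)) /
          (cosCoord x k - cosCoord x j) := by
        simp only [β]
        ring
      rw [this, hαS]
      ring
    have hββ : ∀ j k, β j k ^ 2 = 4 * Real.pi ^ 2 * m ^ 2 * (1 - cosCoord x j ^ 2) /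
        (cosCoord x k - cosCoord x j) ^ 2 := by
      intro j k
      simp only [β]
      rw [div_pow, mul_pow, sin_two_sq_eq_cosCoord]
      ring
    have hpot : 2 * Real.pi ^ 2 * l * (l + 1) / Real.sin (Real.pi * (x j - x k)) ^ 2 +
        2 * Real.pi ^ 2 * l * (l + 1) / Real.sin (Real.pi * (x j + x k)) ^ 2 =
        8 * Real.pi ^ 2 * l * (l + 1) * (1 - cosCoord x j * cosCoord x k) /
          (cosCoord x k - cosCoord x j) ^ 2 := by
      have hr := hx.2 j k hjk
      have e1 := sin_sub_mul_sin_add x j k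
      rw [← sin_sub_sq_add_sin_add_sq]
      have e2 : cosCoord x k - cosCoord x j =
        2 * (Real.sin (Real.pi * (x j - x k)) * Real.sin (Real.pi * (x j + x k))) := by
        rw [e1]
        ring
      rw [e2]
      have n1 := hr.1
      have n2 := hr.2
      generalize Real.sin (Real.pi * (x j - x k)) = u at *
      generalize Real.sin (Real.pi * (x j + x k)) = v at *
      field_simp
      ring
    rw [hpot, hαβ, hαβ, hββ, hββ, sin_two_sq_eq_cosCoord, sin_two_sq_eq_cosCoord]
    have e : cosCoord x j - cosCoord x k = -(cosCoord x k - cosCoord x j) := by ring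
    rw [e]
    have e3 : cosCoord x k = cosCoord x j + (cosCoord x k - cosCoord x j) := by ring
    generalize cosCoord x k - cosCoord x j = d at *
    rw [e3]
    simp only [m, a, b]
    field_simp
    ring
  -- the terms that involve three coordinates
  have h3 : ∑ j, ∑ k, ∑ i, (if j ≠ k ∧ k ≠ i ∧ i ≠ j then β j k * β j i else 0) =
      (∑ j : Fin N, ∑ k, ∑ i, if j ≠ k ∧ k ≠ i ∧ i ≠ j then
        -(4 * Real.pi ^ 2 * m ^ 2) else 0) / 3 := by
    rw [eq_div_iff three_ne_zero, mul_comm, three_mul_sum_cyclic]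
    refine Finset.sum_congr rfl fun j _ => Finset.sum_congr rfl fun k _ =>
      Finset.sum_congr rfl fun i _ => ?_
    by_cases h : j ≠ k ∧ k ≠ i ∧ i ≠ j
    · have h' : k ≠ i ∧ i ≠ j ∧ j ≠ k := ⟨h.2.1, h.2.2, h.1⟩
      have h'' : i ≠ j ∧ j ≠ k ∧ k ≠ i := ⟨h.2.2, h.1, h.2.1⟩
      rw [if_pos h, if_pos h', if_pos h'', if_pos h]
      have hβ : ∀ j k i, β j k * β j i = 4 * Real.pi ^ 2 * m ^ 2 * (1 - cosCoord x j ^ 2) /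
          ((cosCoord x k - cosCoord x j) * (cosCoord x i - cosCoord x j)) := by
        intro j k i
        simp only [β]
        rw [div_mul_div_comm, ← sin_two_sq_eq_cosCoord]
        ring
      rw [hβ, hβ, hβ]
      have n1 := hx'.2 j k h.1
      have n2 := hx'.2 k i h.2.1
      have n3 := hx'.2 i j h.2.2
      have e1 : cosCoord x j - cosCoord x k = -(cosCoord x k - cosCoord x j) := by ring
      have e2 : cosCoord x k - cosCoord x i = -(cosCoord x i - cosCoord x k) := by ring
      have e3 : cosCoord x i - cosCoord x j = -(cosCoord x j - cosCoord x i) := by ring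
      rw [e1, e2, e3]
      field_simp
      ring
    · have h' : ¬(k ≠ i ∧ i ≠ j ∧ j ≠ k) := fun h' => h ⟨h'.2.2, h'.1, h'.2.1⟩
      have h'' : ¬(i ≠ j ∧ j ≠ k ∧ k ≠ i) := fun h' => h ⟨h'.2.1, h'.2.2, h'.1⟩
      rw [if_neg h, if_neg h', if_neg h'', if_neg h]
      ring
  have hdd : ∀ j, driftDeriv l lc j x = Real.pi ^ 2 * (-a / Real.sin (Real.pi * x j) ^ 2 -
      b / Real.cos (Real.pi * x j) ^ 2) + ∑ k ∈ ({j} : Finset (Fin N))ᶜ, 4 * Real.pi ^ 2 * m *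
      (cosCoord x j / (cosCoord x k - cosCoord x j) -
        Real.sin (2 * Real.pi * x j) ^ 2 / (cosCoord x k - cosCoord x j) ^ 2) := fun j => rfl
  rw [Finset.sum_add_distrib, Finset.sum_congr rfl fun j _ => congrArg (· ^ 2) (hdrift j),
    sum_add_sum_sq, h3, Finset.sum_congr rfl fun j _ => hdd j, Finset.sum_add_distrib]
  have k1 := Finset.sum_congr rfl fun j (_ : j ∈ Finset.univ) => h1 j
  rw [Finset.sum_add_distrib, Finset.sum_sub_distrib] at k1
  have k2 := Finset.sum_congr rfl fun j (_ : j ∈ Finset.univ) => Finset.sum_congr rfl (h2 j)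
  rw [Finset.sum_sum_Ioi_add_eq_sum_sum_off_diag fun k j =>
    2 * α j * β j k + β j k ^ 2 + 4 * Real.pi ^ 2 * m *
      (cosCoord x j / (cosCoord x k - cosCoord x j) -
        Real.sin (2 * Real.pi * x j) ^ 2 / (cosCoord x k - cosCoord x j) ^ 2)] at k2
  simp only [Finset.sum_sub_distrib, Finset.sum_add_distrib] at k1 k2 ⊢
  unfold trigPotential
  simp only [Finset.sum_add_distrib]
  linear_combination k1 + k2

/-! ### Polynomials in the cosines -/

/-- A polynomial in the coordinates `cos (2 π x_j)`, as a function of `x`. -/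
def polyFun {N : ℕ} (q : MvPolynomial (Fin N) ℂ) (x : Fin N → ℝ) : ℂ :=
  MvPolynomial.eval (fun j => (cosCoord x j : ℂ)) q

theorem polyFun_add {N : ℕ} (q r : MvPolynomial (Fin N) ℂ) (x : Fin N → ℝ) :
    polyFun (q + r) x = polyFun q x + polyFun r x := map_add _ _ _

theorem polyFun_mul {N : ℕ} (q r : MvPolynomial (Fin N) ℂ) (x : Fin N → ℝ) :
    polyFun (q * r) x = polyFun q x * polyFun r x := map_mul _ _ _

@[simp] theorem polyFun_C {N : ℕ} (c : ℂ) (x : Fin N → ℝ) :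
    polyFun (MvPolynomial.C c) x = c := by simp [polyFun]

@[simp] theorem polyFun_X {N : ℕ} (j : Fin N) (x : Fin N → ℝ) :
    polyFun (MvPolynomial.X j) x = cosCoord x j := by simp [polyFun]

theorem contDiff_polyFun {N : ℕ} (q : MvPolynomial (Fin N) ℂ) {n : WithTop ℕ∞} :
    ContDiff ℝ n (polyFun q) := by
  induction q using MvPolynomial.induction_on with
  | C c =>
    have : polyFun (MvPolynomial.C c : MvPolynomial (Fin N) ℂ) = fun _ => c :=
      funext (polyFun_C c)
    rw [this]
    exact contDiff_const
  | add p q hp hq =>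
    have : polyFun (p + q) = fun x => polyFun p x + polyFun q x := funext (polyFun_add p q)
    rw [this]
    exact hp.add hq
  | mul_X p j hp =>
    have : polyFun (p * MvPolynomial.X j) = fun x => polyFun p x * ((cosCoord x j : ℝ) : ℂ) := by
      funext x
      rw [polyFun_mul, polyFun_X]
    rw [this]
    exact hp.mul (Complex.ofRealCLM.contDiff.comp
      (Real.contDiff_cos.comp (contDiff_const.mul (contDiff_apply ℝ ℝ j))))

/-- The derivative of `polyFun q` with respect to `x_j`. -/
def partialFun {N : ℕ} (j : Fin N) (q : MvPolynomial (Fin N) ℂ) (x : Fin N → ℝ) : ℂ :=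
  -((2 * Real.pi * Real.sin (2 * Real.pi * x j) : ℝ) : ℂ) * polyFun (MvPolynomial.pderiv j q) x

theorem hasDerivAt_polyFun {N : ℕ} (q : MvPolynomial (Fin N) ℂ) (x : Fin N → ℝ) (j : Fin N) :
    HasDerivAt (fun t => polyFun q (Function.update x j t)) (partialFun j q x) (x j) := by
  have hup : Function.update x j (x j) = x := Function.update_eq_self j x
  unfold partialFun
  induction q using MvPolynomial.induction_on with
  | C c => simpa [polyFun] using hasDerivAt_const (x j) c
  | add p q hp hq =>
    simp only [polyFun_add, map_add, mul_add]
    exact hp.add hq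
  | mul_X p i hp =>
    simp only [polyFun_mul, polyFun_X, Derivation.leibniz, smul_eq_mul, MvPolynomial.pderiv_X]
    have h := hp.mul (hasDerivAt_cosCoord x i j).ofReal_comp
    refine h.congr_deriv ?_
    rw [hup, polyFun_add, polyFun_mul, polyFun_mul, polyFun_X]
    by_cases hij : i = j
    · subst hij
      simp [polyFun]
      ring
    · simp [hij, polyFun]
      ring

theorem hasDerivAt_partialFun {N : ℕ} (q : MvPolynomial (Fin N) ℂ) (x : Fin N → ℝ) (j : Fin N) :
    HasDerivAt (fun t => partialFun j q (Function.update x j t))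
      (4 * Real.pi ^ 2 * ((1 - (cosCoord x j : ℂ) ^ 2) *
          polyFun (MvPolynomial.pderiv j (MvPolynomial.pderiv j q)) x -
        cosCoord x j * polyFun (MvPolynomial.pderiv j q) x)) (x j) := by
  have hup : Function.update x j (x j) = x := Function.update_eq_self j x
  have h1 := hasDerivAt_polyFun (MvPolynomial.pderiv j q) x j
  have hS : HasDerivAt (fun t => 2 * Real.pi * Real.sin (2 * Real.pi * Function.update x j t j))
      (2 * Real.pi * (Real.cos (2 * Real.pi * x j) * (2 * Real.pi * 1))) (x j) := by
    simp only [Function.update_self]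
    exact ((hasDerivAt_id (x j)).const_mul (2 * Real.pi)).sin.const_mul _
  have h2 := hS.ofReal_comp.neg.mul h1
  unfold partialFun at h2 ⊢
  refine h2.congr_deriv ?_
  have e : ((Real.sin (2 * Real.pi * x j) : ℝ) : ℂ) ^ 2 = 1 - (cosCoord x j : ℂ) ^ 2 := by
    exact_mod_cast congrArg (fun r : ℝ => (r : ℂ)) (sin_two_sq_eq_cosCoord x j)
  simp only [Pi.neg_apply, hup]
  rw [← e]
  change -((2 * Real.pi * (cosCoord x j * (2 * Real.pi * 1)) : ℝ) : ℂ) * _ + _ = _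
  push_cast
  ring

theorem eventually_isRegular_update {N : ℕ} {x : Fin N → ℝ} (hx : IsRegular x) (j : Fin N) :
    ∀ᶠ t in 𝓝 (x j), IsRegular (Function.update x j t) := by
  have hc : Continuous fun t => Function.update x j t := continuous_const.update j continuous_id
  have hx' : IsRegular (Function.update x j (x j)) := by rwa [Function.update_eq_self]
  exact hc.continuousAt.eventually ((isOpen_isRegular N).mem_nhds hx')

/-- The second derivative of `Φ_T P`, with the factor `Φ_T` taken out. -/
theorem iteratedDeriv_groundState_mul {N : ℕ} {l : ℝ} {lc : Fin 4 → ℝ} (hl : 0 ≤ l)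
    (hl0 : 0 ≤ lc 0) (hl1 : 0 ≤ lc 1) {x : Fin N → ℝ} (hx : IsRegular x) (j : Fin N)
    (q : MvPolynomial (Fin N) ℂ) :
    iteratedDeriv 2 (fun t => groundState l lc (Function.update x j t) *
      polyFun q (Function.update x j t)) (x j) =
      groundState l lc x * (((drift l lc j x ^ 2 + driftDeriv l lc j x : ℝ) : ℂ) * polyFun q x +
        2 * drift l lc j x * partialFun j q x +
        4 * Real.pi ^ 2 * ((1 - (cosCoord x j : ℂ) ^ 2) *
          polyFun (MvPolynomial.pderiv j (MvPolynomial.pderiv j q)) x -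
        cosCoord x j * polyFun (MvPolynomial.pderiv j q) x)) := by
  have hup : Function.update x j (x j) = x := Function.update_eq_self j x
  rw [iteratedDeriv_succ, iteratedDeriv_one]
  have hev : deriv (fun t => groundState l lc (Function.update x j t) *
      polyFun q (Function.update x j t)) =ᶠ[𝓝 (x j)] fun t =>
      groundState l lc (Function.update x j t) *
        (drift l lc j (Function.update x j t) * polyFun q (Function.update x j t) +
          partialFun j q (Function.update x j t)) := by
    filter_upwards [eventually_isRegular_update hx j] with t ht
    have h1 := hasDerivAt_groundState hl hl0 hl1 ht j
    have h2 := hasDerivAt_polyFun q (Function.update x j t) j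
    simp only [Function.update_idem, Function.update_self] at h1 h2
    refine (h1.mul h2).deriv.trans ?_
    ring
  rw [hev.deriv_eq]
  have h1 := hasDerivAt_groundState hl hl0 hl1 hx j
  have h2 := (hasDerivAt_drift l lc hx j).ofReal_comp
  have h3 := hasDerivAt_polyFun q x j
  have h4 := hasDerivAt_partialFun q x j
  refine ((h1.mul ((h2.mul h3).add h4)).congr_deriv ?_).deriv
  simp only [Pi.add_apply, Pi.mul_apply, hup]
  push_cast
  ring

/-! ### The gauged operator on polynomials -/

section

open MvPolynomial

theorem X_sub_X_dvd_sub_rename_swap {N : ℕ} (i j : Fin N) (g : MvPolynomial (Fin N) ℂ) :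
    (X i - X j : MvPolynomial (Fin N) ℂ) ∣ g - rename (Equiv.swap i j) g := by
  rw [← Ideal.mem_span_singleton, ← Ideal.Quotient.eq]
  -- The quotient map and its composition with the transposition agree on the variables.
  let I : Ideal (MvPolynomial (Fin N) ℂ) := Ideal.span {X i - X j}
  have hij : (Ideal.Quotient.mkₐ ℂ I) (X i) = (Ideal.Quotient.mkₐ ℂ I) (X j) :=
    Ideal.Quotient.eq.mpr (Ideal.mem_span_singleton_self _)
  have h : Ideal.Quotient.mkₐ ℂ I = (Ideal.Quotient.mkₐ ℂ I).comp (rename (Equiv.swap i j)) := by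
    refine algHom_ext fun k => ?_
    rw [AlgHom.comp_apply, rename_X]
    by_cases hi : k = i
    · rw [hi, Equiv.swap_apply_left, hij]
    · by_cases hj : k = j
      · rw [hj, Equiv.swap_apply_right, hij]
      · rw [Equiv.swap_apply_of_ne_of_ne hi hj]
  exact congrArg (fun f : MvPolynomial (Fin N) ℂ →ₐ[ℂ] _ => f g) h

theorem X_sub_X_ne_zero {N : ℕ} {i j : Fin N} (h : i ≠ j) :
    (X i - X j : MvPolynomial (Fin N) ℂ) ≠ 0 := by
  rw [sub_ne_zero]
  exact fun h' => h (X_injective h')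

open Classical in
/-- The divided difference `(g - s g) / (X i - X j)`, where `s` is the transposition of `i` and
`j ≠ i`. -/
def divDiff {N : ℕ} (i j : Fin N) : MvPolynomial (Fin N) ℂ →ₗ[ℂ] MvPolynomial (Fin N) ℂ :=
  if h : i = j then 0 else
  { toFun := fun g => (X_sub_X_dvd_sub_rename_swap i j g).choose
    map_add' := fun f g => by
      refine mul_left_cancel₀ (X_sub_X_ne_zero h) ?_
      rw [mul_add, ← (X_sub_X_dvd_sub_rename_swap i j f).choose_spec,
        ← (X_sub_X_dvd_sub_rename_swap i j g).choose_spec,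
        ← (X_sub_X_dvd_sub_rename_swap i j (f + g)).choose_spec, map_add]
      ring
    map_smul' := fun c g => by
      refine mul_left_cancel₀ (X_sub_X_ne_zero h) ?_
      rw [RingHom.id_apply, mul_smul_comm, ← (X_sub_X_dvd_sub_rename_swap i j g).choose_spec,
        ← (X_sub_X_dvd_sub_rename_swap i j (c • g)).choose_spec, map_smul, smul_sub] }

theorem mul_divDiff {N : ℕ} {i j : Fin N} (h : i ≠ j) (g : MvPolynomial (Fin N) ℂ) :
    (X i - X j) * divDiff i j g = g - rename (Equiv.swap i j) g := by
  rw [divDiff, dif_neg h]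
  exact (X_sub_X_dvd_sub_rename_swap i j g).choose_spec.symm

/-- The operator `-Φ⁻² ∑ ∂_j Φ² ∂_j` on symmetric polynomials in the coordinates
`cos (2 π x_j)`. -/
def gaugeOp {N : ℕ} (l : ℝ) (lc : Fin 4 → ℝ) :
    MvPolynomial (Fin N) ℂ →ₗ[ℂ] MvPolynomial (Fin N) ℂ :=
  -((4 * Real.pi ^ 2 : ℝ) : ℂ) • ∑ j,
      (LinearMap.mulLeft ℂ (1 - X j ^ 2) ∘ₗ (pderiv j).toLinearMap ∘ₗ (pderiv j).toLinearMap -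
        LinearMap.mulLeft ℂ (X j + C ((lc 0 + 1 : ℝ) : ℂ) * (1 + X j) -
          C ((lc 1 + 1 : ℝ) : ℂ) * (1 - X j)) ∘ₗ (pderiv j).toLinearMap) -
    ((4 * Real.pi ^ 2 * (l + 1) : ℝ) : ℂ) • ∑ j, ∑ k ∈ ({j} : Finset (Fin N))ᶜ,
      divDiff j k ∘ₗ LinearMap.mulLeft ℂ (1 - X j ^ 2) ∘ₗ (pderiv j).toLinearMap

theorem gaugeOp_apply {N : ℕ} (l : ℝ) (lc : Fin 4 → ℝ) (q : MvPolynomial (Fin N) ℂ) :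
    gaugeOp l lc q = -((4 * Real.pi ^ 2 : ℝ) : ℂ) • ∑ j,
      ((1 - X j ^ 2) * pderiv j (pderiv j q) -
        (X j + C ((lc 0 + 1 : ℝ) : ℂ) * (1 + X j) - C ((lc 1 + 1 : ℝ) : ℂ) * (1 - X j)) *
          pderiv j q) -
    ((4 * Real.pi ^ 2 * (l + 1) : ℝ) : ℂ) • ∑ j, ∑ k ∈ ({j} : Finset (Fin N))ᶜ,
      divDiff j k ((1 - X j ^ 2) * pderiv j q) := by
  simp [gaugeOp, LinearMap.sum_apply]

theorem rename_divDiff {N : ℕ} (σ : Equiv.Perm (Fin N)) {j k : Fin N} (h : j ≠ k)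
    (g : MvPolynomial (Fin N) ℂ) :
    rename σ (divDiff j k g) = divDiff (σ j) (σ k) (rename σ g) := by
  have h' : σ j ≠ σ k := fun e => h (σ.injective e)
  refine mul_left_cancel₀ (X_sub_X_ne_zero h') ?_
  rw [mul_divDiff h']
  have := congrArg (rename σ) (mul_divDiff h g)
  rw [map_mul, map_sub, map_sub, rename_X, rename_X] at this
  rw [this, rename_rename, rename_rename]
  congr 3
  funext i
  simp only [Function.comp_apply]
  rw [Equiv.swap_apply_apply]
  simp

theorem isSymmetric_gaugeOp {N : ℕ} (l : ℝ) (lc : Fin 4 → ℝ) {q : MvPolynomial (Fin N) ℂ}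
    (hq : q.IsSymmetric) : (gaugeOp l lc q).IsSymmetric := by
  intro σ
  have hp : ∀ j, rename σ (pderiv j q) = pderiv (σ j) q := by
    intro j
    rw [← pderiv_rename σ.injective, hq σ]
  have hpp : ∀ j, rename σ (pderiv j (pderiv j q)) = pderiv (σ j) (pderiv (σ j) q) := by
    intro j
    rw [← pderiv_rename σ.injective, hp]
  rw [gaugeOp_apply, map_sub, map_smul, map_smul, map_sum, map_sum]
  congr 2
  · rw [← Equiv.sum_comp σ fun j => (1 - X j ^ 2) * pderiv j (pderiv j q) -
        (X j + C ((lc 0 + 1 : ℝ) : ℂ) * (1 + X j) - C ((lc 1 + 1 : ℝ) : ℂ) * (1 - X j)) *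
          pderiv j q]
    refine Finset.sum_congr rfl fun j _ => ?_
    simp only [map_sub, map_mul, map_add, map_one, map_pow, rename_X, rename_C, hp, hpp]
  · rw [← sum_offDiag_comp_perm (fun j k => divDiff j k ((1 - X j ^ 2) * pderiv j q)) σ]
    refine Finset.sum_congr rfl fun j _ => ?_
    rw [map_sum]
    refine Finset.sum_congr rfl fun k hk => ?_
    have hjk : j ≠ k := by simpa [eq_comm] using hk
    rw [rename_divDiff σ hjk]
    simp only [map_sub, map_mul, map_one, map_pow, rename_X, hp]

/-- The exponents of `f` have degree at most `d - k`; in particular `f = 0` if `d < k`. -/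
def DegreeLE {N : ℕ} (k d : ℕ) (f : MvPolynomial (Fin N) ℂ) : Prop :=
  ∀ s ∈ f.support, (s.sum fun _ e => e) + k ≤ d

theorem degreeLE_zero_iff {N : ℕ} {d : ℕ} {f : MvPolynomial (Fin N) ℂ} :
    DegreeLE 0 d f ↔ f.totalDegree ≤ d := by
  rw [MvPolynomial.totalDegree, Finset.sup_le_iff]
  rfl

theorem DegreeLE.pderiv {N : ℕ} {k d : ℕ} {f : MvPolynomial (Fin N) ℂ} (h : DegreeLE k d f)
    (i : Fin N) : DegreeLE (k + 1) d (pderiv i f) := by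
  intro s hs
  rw [mem_support_iff, coeff_pderiv] at hs
  have := h _ (mem_support_iff.mpr (left_ne_zero_of_mul hs))
  rw [Finsupp.sum_add_index' (fun _ => rfl) (fun _ _ _ => rfl), Finsupp.sum_single_index rfl] at this
  lia

theorem DegreeLE.mul {N : ℕ} {k d n : ℕ} {f g : MvPolynomial (Fin N) ℂ} (h : DegreeLE k d f)
    (hg : g.totalDegree ≤ n) : DegreeLE k (d + n) (g * f) := by
  classical
  intro s hs
  obtain ⟨a, ha, b, hb, rfl⟩ := Finset.mem_add.mp (support_mul g f hs)
  have h1 := h b hb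
  have h2 := (le_totalDegree ha).trans hg
  rw [Finsupp.sum_add_index' (fun _ => rfl) (fun _ _ _ => rfl)]
  lia

theorem DegreeLE.totalDegree_le {N : ℕ} {k d : ℕ} {f : MvPolynomial (Fin N) ℂ}
    (h : DegreeLE k (d + k) f) : f.totalDegree ≤ d := by
  rw [← degreeLE_zero_iff]
  intro s hs
  have := h s hs
  lia

theorem totalDegree_divDiff_le {N : ℕ} {d : ℕ} {f : MvPolynomial (Fin N) ℂ}
    (h : f.totalDegree ≤ d + 1) {i j : Fin N} (hij : i ≠ j) : (divDiff i j f).totalDegree ≤ d := by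
  by_cases h0 : divDiff i j f = 0
  · simp [h0]
  have h1 := congrArg totalDegree (mul_divDiff hij f)
  rw [totalDegree_mul_of_isDomain (X_sub_X_ne_zero hij) h0,
    ((isHomogeneous_X ℂ i).sub (isHomogeneous_X ℂ j)).totalDegree (X_sub_X_ne_zero hij)] at h1
  have h2 := (totalDegree_sub f (rename (Equiv.swap i j) f))
  have h3 := totalDegree_rename_le (Equiv.swap i j) f
  lia

/-- The gauged operator does not raise the total degree: `1 - X_j ^ 2` raises it by two, which each
derivative and each divided difference compensates by one. -/
theorem totalDegree_gaugeOp_le {N : ℕ} (l : ℝ) (lc : Fin 4 → ℝ) {d : ℕ}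
    {q : MvPolynomial (Fin N) ℂ} (hq : q.totalDegree ≤ d) :
    (gaugeOp l lc q).totalDegree ≤ d := by
  have h0 := degreeLE_zero_iff.mpr hq
  have hX : ∀ j : Fin N, (1 - X j ^ 2 : MvPolynomial (Fin N) ℂ).totalDegree ≤ 2 := by
    intro j
    refine (totalDegree_sub _ _).trans (max_le (by simp) ?_)
    rw [totalDegree_X_pow]
  have hadd : ∀ j : Fin N, (1 + X j : MvPolynomial (Fin N) ℂ).totalDegree ≤ 1 := fun j =>
    (totalDegree_add _ _).trans (max_le (by simp) (by simp))
  have hsub : ∀ j : Fin N, (1 - X j : MvPolynomial (Fin N) ℂ).totalDegree ≤ 1 := fun j =>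
    (totalDegree_sub _ _).trans (max_le (by simp) (by simp))
  have hC : ∀ (c : ℂ) (f : MvPolynomial (Fin N) ℂ), f.totalDegree ≤ 1 →
      (C c * f).totalDegree ≤ 1 := fun c f hf =>
    (totalDegree_mul _ _).trans (by rw [totalDegree_C, zero_add]; exact hf)
  rw [gaugeOp_apply]
  refine (totalDegree_sub _ _).trans (max_le ((totalDegree_smul_le _ _).trans
    (totalDegree_finsetSum_le fun j _ => (totalDegree_sub _ _).trans (max_le ?_ ?_)))
    ((totalDegree_smul_le _ _).trans (totalDegree_finsetSum_le fun j _ =>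
      totalDegree_finsetSum_le fun k hk => ?_)))
  · exact (((h0.pderiv j).pderiv j).mul (hX j)).totalDegree_le
  · refine ((h0.pderiv j).mul (n := 1) ?_).totalDegree_le
    exact (totalDegree_sub _ _).trans (max_le ((totalDegree_add _ _).trans (max_le (by simp)
      (hC _ _ (hadd j)))) (hC _ _ (hsub j)))
  · have hjk : j ≠ k := by simpa [eq_comm] using hk
    exact totalDegree_divDiff_le ((h0.pderiv j).mul (hX j)).totalDegree_le hjk

theorem polyFun_sum {N : ℕ} {ι : Type*} (s : Finset ι) (f : ι → MvPolynomial (Fin N) ℂ)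
    (x : Fin N → ℝ) : polyFun (∑ i ∈ s, f i) x = ∑ i ∈ s, polyFun (f i) x := map_sum _ _ _

theorem polyFun_smul {N : ℕ} (c : ℂ) (f : MvPolynomial (Fin N) ℂ)
    (x : Fin N → ℝ) : polyFun (c • f) x = c * polyFun f x := by
  simp [polyFun, smul_eval]

/-- On symmetric polynomials `gaugeOp` acts as the differential operator `-∑ (∂_j² + 2 A_j ∂_j)`, `A_j`
being the logarithmic derivatives of the ground state: its two-body terms, of the form
`(g_j - g_k) / (y_j - y_k)`, are divided differences. -/
theorem polyFun_gaugeOp {N : ℕ} (l : ℝ) (lc : Fin 4 → ℝ) {q : MvPolynomial (Fin N) ℂ}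
    (hq : q.IsSymmetric) {x : Fin N → ℝ} (hx : IsRegular x) :
    polyFun (gaugeOp l lc q) x = -∑ j, (2 * drift l lc j x * partialFun j q x +
        4 * Real.pi ^ 2 * ((1 - (cosCoord x j : ℂ) ^ 2) *
          polyFun (pderiv j (pderiv j q)) x - cosCoord x j * polyFun (pderiv j q) x)) := by
  have hx' := isRegular_iff.mp hx
  let g : Fin N → ℂ := fun j => (1 - (cosCoord x j : ℂ) ^ 2) * polyFun (pderiv j q) x
  have hne : ∀ j k : Fin N, j ≠ k → (cosCoord x k : ℂ) - cosCoord x j ≠ 0 := by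
    intro j k h
    exact_mod_cast hx'.2 j k h
  -- the divided differences, at a regular point
  have hdd : ∀ j k : Fin N, j ≠ k → polyFun (divDiff j k ((1 - X j ^ 2) * pderiv j q)) x =
      (g j - g k) / (cosCoord x j - cosCoord x k) := by
    intro j k hjk
    rw [eq_div_iff (hne k j hjk.symm), mul_comm]
    have h1 := congrArg (fun f => polyFun f x) (mul_divDiff hjk ((1 - X j ^ 2) * pderiv j q))
    have h2 : rename (Equiv.swap j k) (pderiv j q) = pderiv k q := by
      have := pderiv_rename (R := ℂ) (Equiv.swap j k).injective j q
      rw [hq (Equiv.swap j k), Equiv.swap_apply_left] at this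
      exact this.symm
    simp only [map_mul, map_sub, map_one, map_pow, rename_X, h2, Equiv.swap_apply_left] at h1
    simpa [polyFun, g] using h1
  -- the one-body part of the drift
  have hone : ∀ j, ((Real.pi * ((lc 0 + 1) * Real.cos (Real.pi * x j) / Real.sin (Real.pi * x j) -
      (lc 1 + 1) * Real.sin (Real.pi * x j) / Real.cos (Real.pi * x j)) *
      Real.sin (2 * Real.pi * x j) : ℝ) : ℂ) =
      Real.pi * (((lc 0 + 1 : ℝ) : ℂ) * (1 + cosCoord x j) -
        ((lc 1 + 1 : ℝ) : ℂ) * (1 - cosCoord x j)) := by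
    intro j
    have h1 := (hx.1 j).1
    have h2 := (hx.1 j).2
    have h3 := sin_sq_eq_cosCoord x j
    have h4 := cos_sq_eq_cosCoord x j
    rw [mul_assoc 2, Real.sin_two_mul]
    generalize Real.sin (Real.pi * x j) = s at *
    generalize Real.cos (Real.pi * x j) = c at *
    have e : Real.pi * ((lc 0 + 1) * c / s - (lc 1 + 1) * s / c) * (2 * s * c) =
        Real.pi * ((lc 0 + 1) * (2 * c ^ 2) - (lc 1 + 1) * (2 * s ^ 2)) := by
      field_simp
    rw [e, h3, h4]
    push_cast
    ring
  have hS : ∀ j, ((Real.sin (2 * Real.pi * x j) : ℝ) : ℂ) ^ 2 = 1 - (cosCoord x j : ℂ) ^ 2 := by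
    intro j
    exact_mod_cast congrArg (fun r : ℝ => (r : ℂ)) (sin_two_sq_eq_cosCoord x j)
  have hdrift : ∀ j, 2 * (drift l lc j x : ℂ) * partialFun j q x =
      -(4 * Real.pi ^ 2 * (((lc 0 + 1 : ℝ) : ℂ) * (1 + cosCoord x j) -
        ((lc 1 + 1 : ℝ) : ℂ) * (1 - cosCoord x j)) * polyFun (pderiv j q) x) +
      8 * Real.pi ^ 2 * (l + 1) * ∑ k ∈ ({j} : Finset (Fin N))ᶜ,
        g j / (cosCoord x j - cosCoord x k) := by
    intro j
    have h1 : (drift l lc j x : ℂ) * Real.sin (2 * Real.pi * x j) =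
        Real.pi * (((lc 0 + 1 : ℝ) : ℂ) * (1 + cosCoord x j) -
          ((lc 1 + 1 : ℝ) : ℂ) * (1 - cosCoord x j)) -
        2 * Real.pi * (l + 1) * ∑ k ∈ ({j} : Finset (Fin N))ᶜ,
          (1 - (cosCoord x j : ℂ) ^ 2) / (cosCoord x j - cosCoord x k) := by
      have hs : (∑ k ∈ ({j} : Finset (Fin N))ᶜ, 2 * (Real.pi : ℂ) * (l + 1) *
          Real.sin (2 * Real.pi * x j) / (cosCoord x k - cosCoord x j)) *
            Real.sin (2 * Real.pi * x j) = -(2 * Real.pi * (l + 1) *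
          ∑ k ∈ ({j} : Finset (Fin N))ᶜ, ((Real.sin (2 * Real.pi * x j) : ℝ) : ℂ) ^ 2 /
            (cosCoord x j - cosCoord x k)) := by
        rw [Finset.sum_mul, Finset.mul_sum, ← Finset.sum_neg_distrib]
        refine Finset.sum_congr rfl fun k _ => ?_
        have e : (cosCoord x j : ℂ) - cosCoord x k = -(cosCoord x k - cosCoord x j) := by ring
        rw [e, div_neg]
        ring
      rw [← hone, ← hS, drift]
      push_cast at hs ⊢
      linear_combination hs
    have h2 : ∑ k ∈ ({j} : Finset (Fin N))ᶜ, g j / ((cosCoord x j : ℂ) - cosCoord x k) =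
        polyFun (pderiv j q) x * ∑ k ∈ ({j} : Finset (Fin N))ᶜ,
          (1 - (cosCoord x j : ℂ) ^ 2) / (cosCoord x j - cosCoord x k) := by
      rw [Finset.mul_sum]
      refine Finset.sum_congr rfl fun k _ => ?_
      simp only [g]
      ring
    rw [h2, partialFun]
    push_cast at h1 ⊢
    linear_combination (-4 * Real.pi * polyFun (pderiv j q) x) * h1
  -- symmetrization of the two-body part
  have hsym : ∑ j, ∑ k ∈ ({j} : Finset (Fin N))ᶜ, g j / ((cosCoord x j : ℂ) - cosCoord x k) =
      (∑ j, ∑ k ∈ ({j} : Finset (Fin N))ᶜ,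
        polyFun (divDiff j k ((1 - X j ^ 2) * pderiv j q)) x) / 2 := by
    have h1 : ∑ j, ∑ k ∈ ({j} : Finset (Fin N))ᶜ,
        polyFun (divDiff j k ((1 - X j ^ 2) * pderiv j q)) x =
        ∑ j, ∑ k ∈ ({j} : Finset (Fin N))ᶜ, (g j - g k) / (cosCoord x j - cosCoord x k) :=
      Finset.sum_congr rfl fun j _ => Finset.sum_congr rfl fun k hk =>
        hdd j k (by simpa [eq_comm] using hk)
    rw [h1, ← sum_Ioi_eq_half _ fun j k => ?_, ← Finset.sum_sum_Ioi_add_eq_sum_sum_off_diag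
      fun k j => g j / ((cosCoord x j : ℂ) - cosCoord x k)]
    · refine Finset.sum_congr rfl fun j _ => Finset.sum_congr rfl fun k hk => ?_
      have e : (cosCoord x j : ℂ) - cosCoord x k = -(cosCoord x k - cosCoord x j) := by ring
      rw [e, div_neg, div_neg]
      ring
    · rw [← neg_sub (g k), ← neg_sub (cosCoord x k : ℂ), neg_div_neg_eq]
  rw [gaugeOp_apply, sub_eq_add_neg, polyFun_add, ← neg_smul, polyFun_smul, polyFun_smul,
    polyFun_sum, polyFun_sum]
  simp only [polyFun_sum]
  rw [Finset.sum_add_distrib, Finset.sum_congr rfl fun j _ => hdrift j, Finset.sum_add_distrib,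
    ← Finset.mul_sum, hsym]
  have hp : ∀ j, polyFun ((1 - X j ^ 2) * pderiv j (pderiv j q) -
        (X j + C ((lc 0 + 1 : ℝ) : ℂ) * (1 + X j) - C ((lc 1 + 1 : ℝ) : ℂ) * (1 - X j)) *
          pderiv j q) x = ((1 - (cosCoord x j : ℂ) ^ 2) *
          polyFun (pderiv j (pderiv j q)) x - cosCoord x j * polyFun (pderiv j q) x) -
          (((lc 0 + 1 : ℝ) : ℂ) * (1 + cosCoord x j) -
        ((lc 1 + 1 : ℝ) : ℂ) * (1 - cosCoord x j)) * polyFun (pderiv j q) x := by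
    intro j
    simp only [polyFun, map_sub, map_mul, map_add, map_one, map_pow, eval_X, eval_C]
    ring
  rw [Finset.sum_congr rfl fun j _ => hp j, Finset.sum_sub_distrib, Finset.sum_neg_distrib]
  simp only [mul_assoc, ← Finset.mul_sum]
  push_cast
  ring

end

/-! ### Invariant Laurent polynomials -/

theorem comp_perm_eq_of_swap {N : ℕ} {α : Type*} {h : (Fin N → ℝ) → α}
    (hs : ∀ (i j : Fin N) x, h (x ∘ Equiv.swap i j) = h x) (σ : Equiv.Perm (Fin N)) :
    ∀ x, h (x ∘ σ) = h x := by
  induction σ using Equiv.Perm.swap_induction_on with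
  | one => exact fun x => rfl
  | swap_mul f i j _ ih =>
    intro x
    have : x ∘ (Equiv.swap i j * f : Equiv.Perm (Fin N)) = (x ∘ Equiv.swap i j) ∘ f := rfl
    rw [this, ih, hs]

theorem IsInvariant.comp_perm {N : ℕ} {α : Type*} {h : (Fin N → ℝ) → α} (hi : IsInvariant h)
    (σ : Equiv.Perm (Fin N)) (x : Fin N → ℝ) : h (x ∘ σ) = h x :=
  comp_perm_eq_of_swap hi.swap σ x

theorem polyFun_rename {N : ℕ} (σ : Equiv.Perm (Fin N)) (q : MvPolynomial (Fin N) ℂ)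
    (x : Fin N → ℝ) : polyFun (MvPolynomial.rename σ q) x = polyFun q (x ∘ σ) := by
  rw [polyFun, MvPolynomial.eval_rename]
  rfl

theorem isInvariant_polyFun {N : ℕ} {q : MvPolynomial (Fin N) ℂ} (hq : q.IsSymmetric) :
    IsInvariant (polyFun q) := by
  refine isInvariant_of_comp_cosCoord
    (f := fun y => MvPolynomial.eval (fun j => (y j : ℂ)) q) (fun x => rfl) fun σ y => ?_
  conv_rhs => rw [← hq σ]
  rw [MvPolynomial.eval_rename]
  rfl

/-- The Laurent monomials, as functions of `x`. -/
def expFun {N : ℕ} (n : Fin N → ℤ) (x : Fin N → ℝ) : ℂ :=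
  Complex.exp (2 * Real.pi * Complex.I * ∑ j, (n j : ℂ) * (x j : ℂ))

theorem expFun_mul_cosCoord {N : ℕ} (n : Fin N → ℤ) (j : Fin N) (x : Fin N → ℝ) :
    expFun n x * cosCoord x j =
      (1 / 2 : ℂ) * expFun (n + Pi.single j 1) x + (1 / 2 : ℂ) * expFun (n - Pi.single j 1) x := by
  have h : ∀ c : ℤ, ∑ i, ((n + Pi.single j c : Fin N → ℤ) i : ℂ) * (x i : ℂ) =
      ∑ i, (n i : ℂ) * (x i : ℂ) + c * x j := by
    intro c
    simp only [Pi.add_apply, Int.cast_add, add_mul, Finset.sum_add_distrib]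
    congr 1
    rw [Finset.sum_eq_single j]
    · simp
    · intro i _ hi
      simp [hi]
    · simp
  have e : n - Pi.single j 1 = n + Pi.single j (-1) := by
    rw [Pi.single_neg, sub_eq_add_neg]
  rw [e]
  unfold expFun cosCoord
  rw [h, h, mul_add, mul_add, Complex.exp_add, Complex.exp_add, Complex.ofReal_cos, Complex.cos]
  push_cast
  have e1 : 2 * (Real.pi : ℂ) * Complex.I * (1 * x j) = 2 * Real.pi * x j * Complex.I := by ring
  have e2 : 2 * (Real.pi : ℂ) * Complex.I * (-1 * x j) = -(2 * Real.pi * x j) * Complex.I := by ring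
  rw [e1, e2]
  ring

theorem polyFun_mem_span {N : ℕ} (q : MvPolynomial (Fin N) ℂ) :
    polyFun q ∈ Submodule.span ℂ (Set.range (expFun (N := N))) := by
  induction q using MvPolynomial.induction_on with
  | C c =>
    have : polyFun (MvPolynomial.C c) = c • expFun (N := N) 0 := by
      funext x
      simp [expFun]
    rw [this]
    exact Submodule.smul_mem _ _ (Submodule.subset_span ⟨0, rfl⟩)
  | add p q hp hq =>
    have : polyFun (p + q) = polyFun p + polyFun q := funext (polyFun_add p q)
    rw [this]
    exact add_mem hp hq
  | mul_X p j hp =>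
    have : polyFun (p * MvPolynomial.X j) =
        LinearMap.mulRight ℂ (fun x : Fin N → ℝ => (cosCoord x j : ℂ)) (polyFun p) := by
      funext x
      rw [polyFun_mul, polyFun_X]
      rfl
    rw [this]
    have hle : Submodule.span ℂ (Set.range (expFun (N := N))) ≤
        (Submodule.span ℂ (Set.range (expFun (N := N)))).comap
          (LinearMap.mulRight ℂ (fun x : Fin N → ℝ => (cosCoord x j : ℂ))) := by
      rw [Submodule.span_le]
      rintro _ ⟨n, rfl⟩
      have : LinearMap.mulRight ℂ (fun x : Fin N → ℝ => (cosCoord x j : ℂ)) (expFun n) =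
          (1 / 2 : ℂ) • expFun (n + Pi.single j 1) + (1 / 2 : ℂ) • expFun (n - Pi.single j 1) :=
        funext fun x => expFun_mul_cosCoord n j x
      rw [SetLike.mem_coe, Submodule.mem_comap, this]
      exact add_mem (Submodule.smul_mem _ _ (Submodule.subset_span ⟨_, rfl⟩))
        (Submodule.smul_mem _ _ (Submodule.subset_span ⟨_, rfl⟩))
    exact hle hp

theorem polyFun_mem_invLaurent {N : ℕ} {q : MvPolynomial (Fin N) ℂ} (hq : q.IsSymmetric) :
    polyFun q ∈ invLaurent N :=
  ⟨polyFun_mem_span q, (isInvariant_polyFun hq).swap, (isInvariant_polyFun hq).neg⟩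

/-- The Laurent monomial `expFun n`, made even in the coordinates that belong to `s`. -/
def evenExpFun {N : ℕ} (s : Finset (Fin N)) (n : Fin N → ℤ) (x : Fin N → ℝ) : ℂ :=
  ∏ j, if j ∈ s then Complex.cos (n j * (2 * Real.pi * x j))
    else Complex.exp (n j * (2 * Real.pi * x j) * Complex.I)

theorem evenExpFun_empty {N : ℕ} (n : Fin N → ℤ) : evenExpFun ∅ n = expFun n := by
  funext x
  simp only [evenExpFun, expFun, Finset.notMem_empty, if_false]
  rw [← Complex.exp_sum, Finset.mul_sum]
  congr 1
  refine Finset.sum_congr rfl fun j _ => ?_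
  ring

theorem evenExpFun_insert {N : ℕ} {s : Finset (Fin N)} {i : Fin N} (hi : i ∉ s) (n : Fin N → ℤ)
    (x : Fin N → ℝ) : evenExpFun (insert i s) n x =
      (1 / 2 : ℂ) * (evenExpFun s n x + evenExpFun s n (Function.update x i (-x i))) := by
  unfold evenExpFun
  rw [← Finset.mul_prod_erase _ _ (Finset.mem_univ i), ← Finset.mul_prod_erase _ _ (Finset.mem_univ i),
    ← Finset.mul_prod_erase _ _ (Finset.mem_univ i)]
  have h1 : ∀ j ∈ Finset.univ.erase i,
      (if j ∈ insert i s then Complex.cos (n j * (2 * Real.pi * x j))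
        else Complex.exp (n j * (2 * Real.pi * x j) * Complex.I)) =
      (if j ∈ s then Complex.cos (n j * (2 * Real.pi * x j))
        else Complex.exp (n j * (2 * Real.pi * x j) * Complex.I)) := by
    intro j hj
    simp [Finset.ne_of_mem_erase hj]
  have h2 : ∀ j ∈ Finset.univ.erase i,
      (if j ∈ s then Complex.cos (n j * (2 * Real.pi * (Function.update x i (-x i) j : ℝ)))
        else Complex.exp (n j * (2 * Real.pi * (Function.update x i (-x i) j : ℝ)) * Complex.I)) =
      (if j ∈ s then Complex.cos (n j * (2 * Real.pi * x j))
        else Complex.exp (n j * (2 * Real.pi * x j) * Complex.I)) := by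
    intro j hj
    simp [Finset.ne_of_mem_erase hj]
  rw [Finset.prod_congr rfl h1, Finset.prod_congr rfl h2]
  simp only [Finset.mem_insert_self, if_true, hi, if_false, Function.update_self]
  rw [Complex.cos]
  push_cast
  have e : (n i : ℂ) * (2 * Real.pi * -x i) * Complex.I =
    -(n i * (2 * Real.pi * x i)) * Complex.I := by ring
  rw [e]
  ring

/-- An invariant Laurent polynomial is a combination of products of cosines. -/
theorem mem_span_evenExpFun {N : ℕ} {P : (Fin N → ℝ) → ℂ} (hP : P ∈ invLaurent N)
    (s : Finset (Fin N)) : P ∈ Submodule.span ℂ (Set.range (evenExpFun s)) := by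
  classical
  induction s using Finset.induction_on with
  | empty =>
    have : evenExpFun (N := N) ∅ = expFun := funext evenExpFun_empty
    rw [this]
    exact hP.1
  | insert i s hi ih =>
    -- averaging over the sign of `x_i` fixes `P`
    let R : ((Fin N → ℝ) → ℂ) →ₗ[ℂ] ((Fin N → ℝ) → ℂ) := (1 / 2 : ℂ) • (LinearMap.id +
      LinearMap.funLeft ℂ ℂ fun x => Function.update x i (-x i))
    have hR : ∀ f x, R f x = (1 / 2 : ℂ) * (f x + f (Function.update x i (-x i))) :=
      fun f x => rfl
    have hRP : R P = P := by
      funext x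
      rw [hR, hP.2.2]
      ring
    have hle : Submodule.span ℂ (Set.range (evenExpFun s)) ≤
        (Submodule.span ℂ (Set.range (evenExpFun (insert i s)))).comap R := by
      rw [Submodule.span_le]
      rintro _ ⟨n, rfl⟩
      have : R (evenExpFun s n) = evenExpFun (insert i s) n := by
        funext x
        rw [hR, evenExpFun_insert hi]
      rw [SetLike.mem_coe, Submodule.mem_comap, this]
      exact Submodule.subset_span ⟨n, rfl⟩
    have := hle ih
    rwa [Submodule.mem_comap, hRP] at this

/-- The map from polynomials to functions of `x`. -/
def polyFunHom (N : ℕ) : MvPolynomial (Fin N) ℂ →ₗ[ℂ] ((Fin N → ℝ) → ℂ) where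
  toFun := polyFun
  map_add' p q := funext (polyFun_add p q)
  map_smul' c p := funext (polyFun_smul c p)

/-- `cos (n θ)` is a Chebyshev polynomial in `cos θ`. -/
theorem exists_polyFun_eq_evenExpFun {N : ℕ} (n : Fin N → ℤ) :
    ∃ q : MvPolynomial (Fin N) ℂ, polyFun q = evenExpFun Finset.univ n := by
  refine ⟨∏ j, Polynomial.aeval (MvPolynomial.X j) (Polynomial.Chebyshev.T ℂ (n j)), ?_⟩
  funext x
  rw [polyFun, map_prod, evenExpFun]
  refine Finset.prod_congr rfl fun j _ => ?_
  have e : MvPolynomial.eval (fun j => (cosCoord x j : ℂ)) (Polynomial.aeval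
      (MvPolynomial.X j : MvPolynomial (Fin N) ℂ) (Polynomial.Chebyshev.T ℂ (n j))) =
      Polynomial.eval (cosCoord x j : ℂ) (Polynomial.Chebyshev.T ℂ (n j)) := by
    rw [← MvPolynomial.coe_aeval_eq_eval, RingHom.coe_coe, ← Polynomial.aeval_algHom_apply,
      MvPolynomial.aeval_X, Polynomial.coe_aeval_eq_eval]
  rw [e, if_pos (Finset.mem_univ j)]
  have e2 : (cosCoord x j : ℂ) = Complex.cos (2 * Real.pi * x j) := by
    simp [cosCoord]
  rw [e2, Polynomial.Chebyshev.T_complex_cos]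

theorem isSymmetric_sum_rename {N : ℕ} (q : MvPolynomial (Fin N) ℂ) :
    (∑ σ : Equiv.Perm (Fin N), MvPolynomial.rename σ q).IsSymmetric := by
  intro τ
  rw [map_sum, ← Equiv.sum_comp (Equiv.mulLeft τ) fun σ => MvPolynomial.rename σ q]
  refine Finset.sum_congr rfl fun σ _ => ?_
  rw [MvPolynomial.rename_rename]
  rfl

theorem exists_polyFun_of_mem_invLaurent {N : ℕ} {P : (Fin N → ℝ) → ℂ} (hP : P ∈ invLaurent N) :
    ∃ q : MvPolynomial (Fin N) ℂ, q.IsSymmetric ∧ P = polyFun q := by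
  obtain ⟨q, hq⟩ : ∃ q : MvPolynomial (Fin N) ℂ, polyFun q = P := by
    have h := mem_span_evenExpFun hP Finset.univ
    have hle : Submodule.span ℂ (Set.range (evenExpFun Finset.univ)) ≤
        LinearMap.range (polyFunHom N) := by
      rw [Submodule.span_le]
      rintro _ ⟨n, rfl⟩
      exact exists_polyFun_eq_evenExpFun n
    exact hle h
  -- symmetrization
  refine ⟨((N.factorial : ℂ)⁻¹) • ∑ σ : Equiv.Perm (Fin N), MvPolynomial.rename σ q, ?_, ?_⟩
  · exact (isSymmetric_sum_rename q).smul _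
  · funext x
    rw [polyFun_smul, polyFun_sum]
    have : ∀ σ : Equiv.Perm (Fin N), polyFun (MvPolynomial.rename σ q) x = P x := by
      intro σ
      rw [polyFun_rename, hq, comp_perm_eq_of_swap hP.2.1 σ x]
    simp only [this, Finset.sum_const, Finset.card_univ, Fintype.card_perm, Fintype.card_fin,
      nsmul_eq_mul]
    rw [inv_mul_cancel_left₀ (by exact_mod_cast N.factorial_ne_zero)]

/-! ### The unit cube and the chamber -/

theorem coe_piCongrLeft_symm {N : ℕ} (σ : Equiv.Perm (Fin N)) :
    ⇑(MeasurableEquiv.piCongrLeft (fun _ : Fin N => ℝ) σ.symm) = fun x : Fin N → ℝ => x ∘ σ := by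
  funext x j
  obtain ⟨k, rfl⟩ := σ.symm.surjective j
  rw [MeasurableEquiv.piCongrLeft_apply_apply]
  simp

theorem measurePreserving_comp_perm {N : ℕ} (σ : Equiv.Perm (Fin N)) :
    MeasurePreserving (fun x : Fin N → ℝ => x ∘ σ) := by
  rw [← coe_piCongrLeft_symm]
  exact volume_measurePreserving_piCongrLeft (fun _ : Fin N => ℝ) σ.symm

theorem ae_comp_perm_eq_of_swap {N : ℕ} {h : (Fin N → ℝ) → ℂ}
    (hs : ∀ i j : Fin N, ∀ᵐ x, h (x ∘ Equiv.swap i j) = h x) (σ : Equiv.Perm (Fin N)) :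
    ∀ᵐ x, h (x ∘ σ) = h x := by
  induction σ using Equiv.Perm.swap_induction_on with
  | one => exact ae_of_all _ fun x => rfl
  | swap_mul f i j _ ih =>
    filter_upwards [hs i j,
      (measurePreserving_comp_perm (Equiv.swap i j)).quasiMeasurePreserving.ae ih] with x h1 h2
    rw [← h1]
    exact h2

/-- The open unit cube, a fundamental domain for the translations by `ℤ^N`. -/
def unitCube (N : ℕ) : Set (Fin N → ℝ) := Set.univ.pi fun _ => Set.Ioo 0 1

theorem measurableSet_unitCube (N : ℕ) : MeasurableSet (unitCube N) :=
  MeasurableSet.univ_pi fun _ => measurableSet_Ioo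

theorem unitCube_ae_eq_Icc (N : ℕ) : unitCube N =ᵐ[volume] Set.Icc 0 1 :=
  Measure.univ_pi_Ioo_ae_eq_Icc

theorem measurableSet_chamber (N : ℕ) : MeasurableSet (chamber N) := by
  have : chamber N = unitCube N ∩ {x | Monotone x} := by
    ext x
    simp [chamber, unitCube, Set.mem_pi]
  rw [this]
  exact (measurableSet_unitCube N).inter isClosed_monotone.measurableSet

theorem chamber_subset_unitCube (N : ℕ) : chamber N ⊆ unitCube N := fun _ hx j _ => hx.1 j

instance (N : ℕ) : IsFiniteMeasure (volume.restrict (unitCube N)) := by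
  refine isFiniteMeasure_restrict.mpr ?_
  rw [measure_congr (unitCube_ae_eq_Icc N)]
  exact isCompact_Icc.measure_lt_top.ne

instance (N : ℕ) : IsFiniteMeasure (volume.restrict (chamber N)) :=
  isFiniteMeasure_restrict.mpr ((measure_mono (chamber_subset_unitCube N)).trans_lt
    (by simpa using measure_lt_top (volume.restrict (unitCube N)) Set.univ)).ne

theorem ae_injective (N : ℕ) : ∀ᵐ x : Fin N → ℝ, Function.Injective x := by
  filter_upwards [ae_isRegular N] with x hx j k hjk
  by_contra h
  exact (hx.2 j k h).1 (by simp [hjk])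

/-- The unit cube is, up to a null set, the disjoint union of the images of the chamber under the
permutations of the coordinates. -/
theorem restrict_unitCube (N : ℕ) : volume.restrict (unitCube N) =
    ∑ σ : Equiv.Perm (Fin N), volume.restrict ((fun x : Fin N → ℝ => x ∘ σ) ⁻¹' chamber N) := by
  have hU : unitCube N = ⋃ σ : Equiv.Perm (Fin N), (fun x : Fin N → ℝ => x ∘ σ) ⁻¹' chamber N := by
    ext x
    simp only [Set.mem_iUnion, Set.mem_preimage]
    constructor
    · exact fun hx => ⟨Tuple.sort x, fun j => hx _ trivial, Tuple.monotone_sort x⟩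
    · rintro ⟨σ, hσ, -⟩ j -
      simpa using hσ (σ.symm j)
  have hd : Pairwise (Function.onFun (AEDisjoint volume) fun σ : Equiv.Perm (Fin N) =>
      (fun x : Fin N → ℝ => x ∘ σ) ⁻¹' chamber N) := by
    intro σ τ hστ
    refine measure_mono_null ?_ (ae_iff.mp (ae_injective N))
    rintro x ⟨h1, h2⟩ hx
    refine hστ (Equiv.ext fun j => hx ?_)
    have := Tuple.unique_monotone (f := x) h1.2 h2.2
    exact congrFun this j
  rw [hU, Measure.restrict_iUnion_ae hd fun σ => ((measurePreserving_comp_perm σ).measurable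
    (measurableSet_chamber N)).nullMeasurableSet, Measure.sum_fintype]

theorem integrable_unitCube {N : ℕ} {h : (Fin N → ℝ) → ℂ}
    (hs : ∀ σ : Equiv.Perm (Fin N), ∀ᵐ x, h (x ∘ σ) = h x)
    (hi : IntegrableOn h (chamber N)) : IntegrableOn h (unitCube N) := by
  rw [IntegrableOn, restrict_unitCube, integrable_finsetSum_measure]
  intro σ _
  have := ((measurePreserving_comp_perm σ).restrict_preimage (measurableSet_chamber N))
  refine (this.integrable_comp_of_integrable hi).congr ?_
  exact ae_restrict_of_ae (hs σ)

/-- The integral of a symmetric function over the cube is `N!` times that over the chamber. -/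
theorem integral_unitCube {N : ℕ} {h : (Fin N → ℝ) → ℂ}
    (hs : ∀ σ : Equiv.Perm (Fin N), ∀ᵐ x, h (x ∘ σ) = h x)
    (hi : IntegrableOn h (unitCube N)) :
    ∫ x in unitCube N, h x = N.factorial * ∫ x in chamber N, h x := by
  have hi' := hi
  rw [IntegrableOn, restrict_unitCube, integrable_finsetSum_measure] at hi'
  rw [restrict_unitCube, integral_finsetSum_measure hi']
  have : ∀ σ : Equiv.Perm (Fin N), ∫ x in (fun x : Fin N → ℝ => x ∘ σ) ⁻¹' chamber N, h x =
      ∫ x in chamber N, h x := by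
    intro σ
    rw [← integral_congr_ae (ae_restrict_of_ae (hs σ))]
    exact (measurePreserving_comp_perm σ).setIntegral_preimage_emb
      (by rw [← coe_piCongrLeft_symm]; exact MeasurableEquiv.measurableEmbedding _) _ _
  simp [this, Fintype.card_perm]

theorem memLp_unitCube {N : ℕ} {h : (Fin N → ℝ) → ℂ} (hm : Measurable h)
    (hs : ∀ σ : Equiv.Perm (Fin N), ∀ᵐ x, h (x ∘ σ) = h x)
    (hi : MemLp h 2 (volume.restrict (chamber N))) :
    MemLp h 2 (volume.restrict (unitCube N)) := by
  rw [memLp_two_iff_integrable_sq_norm hm.aestronglyMeasurable] at hi ⊢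
  have := integrable_unitCube (h := fun x => Complex.ofReal (‖h x‖ ^ 2)) (fun σ => by
    filter_upwards [hs σ] with x hx
    rw [hx]) (Complex.ofRealCLM.integrable_comp hi)
  exact this.re

/-! ### Symmetry of the gauged operator -/

/-- The divergence of a periodic vector field has integral zero over the unit cube. -/
theorem integral_divergence_eq_zero {N : ℕ} {f : Fin N → (Fin N → ℝ) → ℂ}
    (hf : ∀ j, ContDiff ℝ 1 (f j))
    (hp : ∀ (j : Fin N) x (n : Fin N → ℤ), f j (fun i => x i + n i) = f j x) :
    ∫ x in unitCube N, ∑ j, fderiv ℝ (f j) x (Pi.single j 1) = 0 := by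
  cases N with
  | zero => simp
  | succ n =>
    rw [setIntegral_congr_set (unitCube_ae_eq_Icc _),
      integral_divergence_of_hasFDerivAt_off_countable' 0 1 zero_le_one f (fun j => fderiv ℝ (f j))
      ∅ Set.countable_empty (fun i => (hf i).continuous.continuousOn)
      (fun x _ i => ((hf i).differentiable one_ne_zero x).hasFDerivAt) ?_]
    · refine Finset.sum_eq_zero fun i _ => sub_eq_zero.mpr ?_
      refine integral_congr_ae (ae_of_all _ fun x => ?_)
      simp only [Pi.one_apply, Pi.zero_apply]
      rw [← hp i (i.insertNth 0 x) (Pi.single i 1)]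
      congr 1
      funext j
      by_cases h : j = i
      · subst h
        simp
      · obtain ⟨k, rfl⟩ := Fin.exists_succAbove_eq h
        simp [Fin.succAbove_ne]
    · refine Continuous.integrableOn_Icc (continuous_finsetSum _ fun i _ => ?_)
      exact ((hf i).continuous_fderiv one_ne_zero).clm_apply continuous_const

theorem polyFun_translate {N : ℕ} (q : MvPolynomial (Fin N) ℂ) (x : Fin N → ℝ) (n : Fin N → ℤ) :
    polyFun q (fun j => x j + n j) = polyFun q x := by
  unfold polyFun
  rw [cosCoord_translate]

theorem partialFun_translate {N : ℕ} (j : Fin N) (q : MvPolynomial (Fin N) ℂ) (x : Fin N → ℝ)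
    (n : Fin N → ℤ) : partialFun j q (fun j => x j + n j) = partialFun j q x := by
  unfold partialFun
  rw [polyFun_translate, mul_add, mul_comm (2 * Real.pi) (n j : ℝ), Real.sin_add_int_mul_two_pi]

theorem contDiff_partialFun {N : ℕ} (j : Fin N) (q : MvPolynomial (Fin N) ℂ) :
    ContDiff ℝ 1 (partialFun j q) :=
  (Complex.ofRealCLM.contDiff.comp (contDiff_const.mul
    (Real.contDiff_sin.comp (contDiff_const.mul (contDiff_apply ℝ ℝ j))))).neg.mul
    (contDiff_polyFun _)

theorem hasDerivAt_weight {N : ℕ} {l : ℝ} {lc : Fin 4 → ℝ} (hl : 0 ≤ l) (hl0 : 0 ≤ lc 0)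
    (hl1 : 0 ≤ lc 1) {x : Fin N → ℝ} (hx : IsRegular x) (j : Fin N) :
    HasDerivAt (fun t => (weight l lc (Function.update x j t) : ℂ))
      (2 * drift l lc j x * weight l lc x) (x j) := by
  have hup : Function.update x j (x j) = x := Function.update_eq_self j x
  have hw : ∀ y : Fin N → ℝ, (weight l lc y : ℂ) = star (groundState l lc y) * groundState l lc y := by
    intro y
    rw [weight, Complex.star_def, Complex.conj_mul', Complex.ofReal_pow]
  simp only [hw]
  have h := hasDerivAt_groundState hl hl0 hl1 hx j
  refine (h.star.mul h).congr_deriv ?_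
  rw [hup]
  simp only [star_mul', Complex.star_def, Complex.conj_ofReal]
  ring

/-- Integration by parts: the gauged operator is that of the Dirichlet form with weight
`|Φ_T|²`. -/
theorem integral_weight_mul_gaugeOp {N : ℕ} {l : ℝ} {lc : Fin 4 → ℝ} (hl : 0 ≤ l) (hl0 : 0 ≤ lc 0)
    (hl1 : 0 ≤ lc 1) (q : MvPolynomial (Fin N) ℂ) {r : MvPolynomial (Fin N) ℂ}
    (hr : r.IsSymmetric) :
    ∫ x in unitCube N, weight l lc x * polyFun (gaugeOp l lc r) x * star (polyFun q x) =
      ∫ x in unitCube N, weight l lc x * ∑ j, partialFun j r x * star (partialFun j q x) := by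
  have hw := contDiff_weight (N := N) hl hl0 hl1
  have hwC : ContDiff ℝ 1 fun x : Fin N → ℝ => (weight l lc x : ℂ) :=
    Complex.ofRealCLM.contDiff.comp hw
  have hstar : ∀ q : MvPolynomial (Fin N) ℂ, ContDiff ℝ 1 fun x => star (polyFun q x) := fun q =>
    Complex.conjCLE.contDiff.comp (contDiff_polyFun q)
  let f : Fin N → (Fin N → ℝ) → ℂ := fun j x =>
    weight l lc x * partialFun j r x * star (polyFun q x)
  have hf : ∀ j, ContDiff ℝ 1 (f j) := fun j => (hwC.mul (contDiff_partialFun j r)).mul (hstar q)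
  have hint := integral_divergence_eq_zero hf fun j x n => by
    simp only [f, polyFun_translate, partialFun_translate, (isInvariant_weight l lc).translate]
  have hI : ∀ g : (Fin N → ℝ) → ℂ, Continuous g → IntegrableOn g (unitCube N) := fun g hg =>
    (hg.integrableOn_Icc (a := 0) (b := 1)).congr_set_ae (unitCube_ae_eq_Icc N)
  rw [← sub_eq_zero, ← neg_eq_zero, neg_sub, ← integral_sub, ← hint]
  · refine integral_congr_ae (ae_restrict_of_ae ?_)
    filter_upwards [ae_isRegular N] with x hx
    have hup : ∀ j, Function.update x j (x j) = x := fun j => Function.update_eq_self j x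
    have hd : ∀ j, fderiv ℝ (f j) x (Pi.single j 1) =
        (2 * drift l lc j x * weight l lc x * partialFun j r x + weight l lc x *
          (4 * Real.pi ^ 2 * ((1 - (cosCoord x j : ℂ) ^ 2) *
          polyFun (MvPolynomial.pderiv j (MvPolynomial.pderiv j r)) x -
        cosCoord x j * polyFun (MvPolynomial.pderiv j r) x))) * star (polyFun q x) +
          weight l lc x * partialFun j r x * star (partialFun j q x) := by
      intro j
      have h1 : HasDerivAt (fun t => f j (Function.update x j t)) (fderiv ℝ (f j) x (Pi.single j 1))
          (x j) := by
        have h0 : HasFDerivAt (f j) (fderiv ℝ (f j) x) (Function.update x j (x j)) := by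
          rw [hup]
          exact ((hf j).differentiable one_ne_zero x).hasFDerivAt
        exact h0.comp_hasDerivAt (x j) (hasDerivAt_update x j (x j))
      have h2 := ((hasDerivAt_weight hl hl0 hl1 hx j).mul (hasDerivAt_partialFun r x j)).mul
        (hasDerivAt_polyFun q x j).star
      rw [h1.unique h2]
      simp only [hup, Pi.mul_apply]
    simp only [hd]
    rw [polyFun_gaugeOp l lc hr hx, Finset.mul_sum, mul_neg, neg_mul, sub_neg_eq_add,
      Finset.mul_sum, Finset.sum_mul, ← Finset.sum_add_distrib]
    refine Finset.sum_congr rfl fun j _ => ?_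
    ring
  · refine hI _ (hwC.continuous.mul (continuous_finsetSum _ fun j _ => ?_))
    exact (contDiff_partialFun j r).continuous.mul (contDiff_partialFun j q).continuous.star
  · exact hI _ ((hwC.continuous.mul (contDiff_polyFun _ (n := 1)).continuous).mul
      (hstar q).continuous)

/-- Symmetry of the gauged operator on the chamber. -/
theorem integral_weight_mul_star {N : ℕ} {l : ℝ} {lc : Fin 4 → ℝ} (hl : 0 ≤ l) (hl0 : 0 ≤ lc 0)
    (hl1 : 0 ≤ lc 1) {q r : MvPolynomial (Fin N) ℂ} (hq : q.IsSymmetric) (hr : r.IsSymmetric) :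
    ∫ x in chamber N, weight l lc x * polyFun (gaugeOp l lc r) x * star (polyFun q x) =
      ∫ x in chamber N, weight l lc x * polyFun r x * star (polyFun (gaugeOp l lc q) x) := by
  have hwC : Continuous fun x : Fin N → ℝ => (weight l lc x : ℂ) :=
    Complex.continuous_ofReal.comp (contDiff_weight hl hl0 hl1).continuous
  have hI : ∀ q r : MvPolynomial (Fin N) ℂ, IntegrableOn
      (fun x => weight l lc x * polyFun r x * star (polyFun q x)) (unitCube N) := fun q r =>
    (Continuous.integrableOn_Icc (a := 0) (b := 1) ((hwC.mul
      (contDiff_polyFun r (n := 1)).continuous).mul (contDiff_polyFun q (n := 1)).continuous.star)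
      ).congr_set_ae (unitCube_ae_eq_Icc N)
  have hD : ∀ q r : MvPolynomial (Fin N) ℂ, q.IsSymmetric → r.IsSymmetric →
      ∫ x in unitCube N, weight l lc x * polyFun r x * star (polyFun q x) =
      N.factorial * ∫ x in chamber N, weight l lc x * polyFun r x * star (polyFun q x) := by
    intro q r hq hr
    refine integral_unitCube (fun σ => ae_of_all _ fun x => ?_) (hI q r)
    rw [(isInvariant_weight l lc).comp_perm, (isInvariant_polyFun hq).comp_perm,
      (isInvariant_polyFun hr).comp_perm]
  have hN : (N.factorial : ℂ) ≠ 0 := by exact_mod_cast N.factorial_ne_zero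
  refine mul_left_cancel₀ hN ?_
  rw [← hD _ _ hq (isSymmetric_gaugeOp l lc hr), ← hD _ _ (isSymmetric_gaugeOp l lc hq) hr,
    integral_weight_mul_gaugeOp hl hl0 hl1 q hr]
  have h2 := congrArg star (integral_weight_mul_gaugeOp hl hl0 hl1 r hq)
  simp only [Complex.star_def, ← integral_conj] at h2 ⊢
  simp only [map_mul, map_sum, Complex.conj_ofReal, Complex.conj_conj] at h2
  rw [← sub_eq_zero] at h2 ⊢
  rw [← neg_eq_zero, neg_sub, ← h2]
  congr 1
  · refine integral_congr_ae (ae_of_all _ fun x => ?_)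
    simp only
    ring
  · refine integral_congr_ae (ae_of_all _ fun x => ?_)
    simp only
    congr 1
    exact Finset.sum_congr rfl fun j _ => mul_comm _ _

/-! ### Fourier uniqueness and density -/

/-- A square-integrable function on the unit cube whose Fourier coefficients vanish is zero. -/
theorem ae_eq_zero_of_integral_expFun {N : ℕ} {F : (Fin N → ℝ) → ℂ} (hm : Measurable F)
    (hF : MemLp F 2 (volume.restrict (unitCube N)))
    (h : ∀ n : Fin N → ℤ, ∫ x in unitCube N, F x * star (expFun n x) = 0) :
    F =ᵐ[volume.restrict (unitCube N)] 0 := by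
  let S : Set (Fin N → ℝ) := {x | ∀ i, x i ∈ Set.Ioc ((0 : Fin N → ℝ) i) ((0 : Fin N → ℝ) i + 1)}
  have hS : MeasurableSet S := MeasurableSet.univ_pi' fun _ => measurableSet_Ioc
  have hQS : volume.restrict (unitCube N) = volume.restrict S := by
    refine Measure.restrict_congr_set ?_
    have : S = Set.univ.pi fun _ => Set.Ioc 0 1 := by
      ext x
      simp [S]
    rw [this]
    exact Measure.univ_pi_Ioo_ae_eq_Icc.trans Measure.univ_pi_Ioc_ae_eq_Icc.symm
  rw [hQS] at hF h ⊢
  have hψ := (measurePreserving_subtype_coe hS).comp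
    (UnitAddTorus.measurePreserving_equivPiIoc (0 : Fin N → ℝ))
  set ψ := Subtype.val ∘ UnitAddTorus.measurableEquivPiIoc (0 : Fin N → ℝ) with hψdef
  have hFψ := hF.comp_measurePreserving hψ
  have hcoeff : ∀ n, UnitAddTorus.mFourierCoeff hFψ.toLp n = 0 := by
    intro n
    rw [← h n, ← hψ.map_eq, integral_map hψ.aemeasurable, UnitAddTorus.mFourierCoeff]
    · refine integral_congr_ae ?_
      filter_upwards [hFψ.coeFn_toLp] with t ht
      rw [ht, smul_eq_mul, mul_comm, UnitAddTorus.mFourier_neg]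
      refine congrArg (fun z => F (ψ t) * star z) ?_
      have ht : ∀ i, ((ψ t i : ℝ) : UnitAddCircle) = t i := fun i =>
        congrFun ((UnitAddTorus.measurableEquivPiIoc (0 : Fin N → ℝ)).symm_apply_apply t) i
      rw [UnitAddTorus.mFourier, ContinuousMap.coe_mk, expFun, Finset.mul_sum, Complex.exp_sum]
      refine Finset.prod_congr (M := ℂ) rfl fun i _ => ?_
      rw [← ht i, fourier_coe_apply]
      change _ = Complex.exp (2 * Real.pi * Complex.I * (n i * ψ t i))
      congr 1
      push_cast
      ring
    · refine (hm.aestronglyMeasurable.mul ?_)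
      unfold expFun
      exact (Continuous.star (by fun_prop)).aestronglyMeasurable
  have hsum := UnitAddTorus.hasSum_mFourier_series_L2 hFψ.toLp
  simp only [hcoeff, zero_smul] at hsum
  have h0 := hsum.unique hasSum_zero
  have h1 := hFψ.coeFn_toLp
  rw [h0] at h1
  rw [← hψ.map_eq]
  refine (ae_map_iff hψ.aemeasurable (hm (measurableSet_singleton 0))).mpr ?_
  filter_upwards [h1, Lp.coeFn_zero ℂ 2 _] with t ht ht0
  exact ht.symm.trans ht0

theorem measurePreserving_reflect {N : ℕ} (i : Fin N) (c : ℝ) :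
    MeasurePreserving fun x : Fin N → ℝ => Function.update x i (c - x i) := by
  have h := volume_preserving_pi (α' := fun _ : Fin N => ℝ) (β' := fun _ : Fin N => ℝ)
    (f := fun j t => if j = i then c - t else t) fun j => by
      by_cases h : j = i
      · simpa only [h, if_true] using Measure.measurePreserving_sub_left volume c
      · simp only [h, if_false]
        exact MeasurePreserving.id volume
  convert h using 1
  funext x j
  by_cases h : j = i
  · subst h
    simp
  · simp [h]

theorem reflect_involutive {N : ℕ} (i : Fin N) (c : ℝ) :
    Function.Involutive fun x : Fin N → ℝ => Function.update x i (c - x i) := by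
  intro x
  simp

theorem continuous_evenExpFun {N : ℕ} (s : Finset (Fin N)) (n : Fin N → ℤ) :
    Continuous (evenExpFun s n) := by
  unfold evenExpFun
  refine continuous_finsetProd _ fun j _ => ?_
  split_ifs <;> fun_prop

theorem evenExpFun_translate {N : ℕ} (s : Finset (Fin N)) (n : Fin N → ℤ) (x : Fin N → ℝ)
    (m : Fin N → ℤ) : evenExpFun s n (fun j => x j + m j) = evenExpFun s n x := by
  unfold evenExpFun
  refine Finset.prod_congr rfl fun j _ => ?_
  have e : (n j : ℂ) * (2 * Real.pi * ((x j + m j : ℝ) : ℂ)) =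
      n j * (2 * Real.pi * x j) + (n j * m j : ℤ) * (2 * Real.pi) := by
    push_cast
    ring
  rw [e, Complex.cos_add_int_mul_two_pi, add_mul, Complex.exp_add, mul_assoc _ (2 * _ : ℂ),
    Complex.exp_int_mul_two_pi_mul_I, mul_one]

theorem integrableOn_mul_continuous {N : ℕ} {F G : (Fin N → ℝ) → ℂ}
    (hF : IntegrableOn F (unitCube N)) (hG : Continuous G) :
    IntegrableOn (fun x => F x * G x) (unitCube N) := by
  have h := unitCube_ae_eq_Icc N
  exact ((hF.congr_set_ae h.symm).mul_continuousOn hG.continuousOn isCompact_Icc).congr_set_ae h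

/-- An almost everywhere invariant function has the same integral against a Laurent monomial as
against its even part. -/
theorem integral_mul_star_evenExpFun {N : ℕ} {F : (Fin N → ℝ) → ℂ} (hF : AEInvariant F)
    (hi : IntegrableOn F (unitCube N)) (n : Fin N → ℤ) (s : Finset (Fin N)) :
    ∫ x in unitCube N, F x * star (evenExpFun s n x) =
      ∫ x in unitCube N, F x * star (expFun n x) := by
  induction s using Finset.induction_on with
  | empty => rw [evenExpFun_empty]
  | insert i s his ih =>
    have hI := fun s => integrableOn_mul_continuous hi (continuous_evenExpFun s n).star
    have hr := measurePreserving_reflect i 1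
    have h0 := measurePreserving_reflect i 0
    have hneg : Continuous fun x : Fin N → ℝ => Function.update x i (-x i) := by fun_prop
    have hI' := integrableOn_mul_continuous hi ((continuous_evenExpFun s n).comp hneg).star
    have hpre : (fun x : Fin N → ℝ => Function.update x i (1 - x i)) ⁻¹' unitCube N =
        unitCube N := by
      ext x
      simp only [unitCube, Set.mem_preimage, Set.mem_univ_pi, Set.mem_Ioo]
      refine forall_congr' fun j => ?_
      by_cases h : j = i
      · subst h
        simp only [Function.update_self]
        constructor <;> rintro ⟨h1, h2⟩ <;> constructor <;> linarith
      · simp [h]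
    have hshift : ∀ x : Fin N → ℝ, Function.update x i (1 - x i) =
        fun j => Function.update x i (-x i) j + (Pi.single i 1 : Fin N → ℤ) j := by
      intro x
      funext j
      by_cases h : j = i
      · subst h
        simp
        ring
      · simp [h]
    have key : ∫ x in unitCube N, F x * star (evenExpFun s n (Function.update x i (-x i))) =
        ∫ x in unitCube N, F x * star (evenExpFun s n x) := by
      have h1 := hr.setIntegral_preimage_emb (MeasurableEquiv.ofInvolutive _
        (reflect_involutive i 1) hr.measurable).measurableEmbedding
        (fun x => F x * star (evenExpFun s n x)) (unitCube N)
      rw [hpre] at h1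
      rw [← h1]
      refine integral_congr_ae (ae_restrict_of_ae ?_)
      have h2 := h0.quasiMeasurePreserving.ae (hF.translate (Pi.single i 1))
      filter_upwards [hF.neg i, h2] with x hx hx2
      simp only [zero_sub] at hx2
      rw [hshift, evenExpFun_translate, hx2, hx]
    have e : ∀ x, F x * star (evenExpFun (insert i s) n x) =
        (1 / 2 : ℂ) * (F x * star (evenExpFun s n x) +
          F x * star (evenExpFun s n (Function.update x i (-x i)))) := by
      intro x
      rw [evenExpFun_insert his]
      simp
      ring
    simp only [e]
    have hadd := integral_add (hI s) hI'
    simp only [Function.comp_apply] at hadd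
    rw [integral_const_mul, hadd, key, ih]
    ring

/-- The functions `Φ_T P` with `P` an invariant Laurent polynomial are total in the Hilbert
space. -/
theorem ae_eq_zero_of_integral_groundState {N : ℕ} {l : ℝ} {lc : Fin 4 → ℝ} (hl : 0 ≤ l)
    (hl0 : 0 ≤ lc 0) (hl1 : 0 ≤ lc 1) {g : (Fin N → ℝ) → ℂ} (hm : Measurable g)
    (hg : AEInvariant fun x => g x / groundState l lc x)
    (hL : MemLp g 2 (volume.restrict (chamber N)))
    (h : ∀ q : MvPolynomial (Fin N) ℂ, q.IsSymmetric →
      ∫ x in chamber N, g x * star (groundState l lc x * polyFun q x) = 0) :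
    g =ᵐ[volume.restrict (chamber N)] 0 := by
  -- Unlike `g`, the product `F = |Φ_T|² (g / Φ_T)` is itself invariant.
  let F : (Fin N → ℝ) → ℂ := fun x => star (groundState l lc x) * g x
  have hFm : Measurable F := (Complex.continuous_conj.measurable.comp (measurable_groundState l lc)).mul hm
  have hFw : ∀ x, F x = weight l lc x * (g x / groundState l lc x) := by
    intro x
    simp only [F, weight, Complex.star_def]
    by_cases h0 : groundState l lc x = 0
    · simp [h0]
    · push_cast
      rw [← Complex.conj_mul']
      field_simp
  have hw := isInvariant_weight (N := N) l lc
  have hFinv : AEInvariant F := by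
    refine ⟨fun i j => ?_, fun i => ?_, fun n => ?_⟩
    · filter_upwards [hg.swap i j] with x hx
      rw [hFw, hFw, hx, hw.swap]
    · filter_upwards [hg.neg i] with x hx
      rw [hFw, hFw, hx, hw.neg]
    · filter_upwards [hg.translate n] with x hx
      rw [hFw, hFw, hx, hw.translate]
  have hperm := ae_comp_perm_eq_of_swap hFinv.swap
  have hFL : MemLp F 2 (volume.restrict (unitCube N)) := by
    refine memLp_unitCube hFm hperm (hL.of_le hFm.aestronglyMeasurable (ae_of_all _ fun x => ?_))
    simp only [F, norm_mul, norm_star]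
    exact mul_le_of_le_one_left (norm_nonneg _) (norm_groundState_le_one hl hl0 hl1 x)
  have hFi : IntegrableOn F (unitCube N) := hFL.integrable one_le_two
  have hI : ∀ q : MvPolynomial (Fin N) ℂ,
      IntegrableOn (fun x => F x * star (polyFun q x)) (unitCube N) := fun q =>
    integrableOn_mul_continuous hFi (contDiff_polyFun q (n := 1)).continuous.star
  -- symmetric polynomials
  have hsymm : ∀ q : MvPolynomial (Fin N) ℂ, q.IsSymmetric →
      ∫ x in unitCube N, F x * star (polyFun q x) = 0 := by
    intro q hq
    rw [integral_unitCube (fun σ => ?_) (hI q)]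
    · rw [mul_eq_zero]
      right
      rw [← h q hq]
      refine integral_congr_ae (ae_of_all _ fun x => ?_)
      simp only [F, star_mul']
      ring
    · filter_upwards [hperm σ] with x hx
      rw [hx, (isInvariant_polyFun hq).comp_perm]
  -- all polynomials, by averaging over the permutations
  have hall : ∀ q : MvPolynomial (Fin N) ℂ, ∫ x in unitCube N, F x * star (polyFun q x) = 0 := by
    intro q
    have h1 := hsymm _ (isSymmetric_sum_rename q)
    have h2 : ∀ σ : Equiv.Perm (Fin N),
        ∫ x in unitCube N, F x * star (polyFun (MvPolynomial.rename σ q) x) =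
          ∫ x in unitCube N, F x * star (polyFun q x) := by
      intro σ
      have hpre : (fun x : Fin N → ℝ => x ∘ σ) ⁻¹' unitCube N = unitCube N := by
        ext x
        simp only [unitCube, Set.mem_preimage, Set.mem_univ_pi, Function.comp_apply]
        exact ⟨fun h j => by simpa using h (σ.symm j), fun h j => h (σ j)⟩
      have h3 := (measurePreserving_comp_perm σ).setIntegral_preimage_emb
        (by rw [← coe_piCongrLeft_symm]; exact MeasurableEquiv.measurableEmbedding _)
        (fun x => F x * star (polyFun q x)) (unitCube N)
      rw [hpre] at h3
      rw [← h3]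
      refine integral_congr_ae (ae_restrict_of_ae ?_)
      filter_upwards [hperm σ] with x hx
      rw [hx, polyFun_rename]
    simp only [polyFun_sum, star_sum, Finset.mul_sum] at h1
    rw [integral_finsetSum _ fun σ _ => hI _] at h1
    simp only [h2, Finset.sum_const, nsmul_eq_mul, mul_eq_zero, Nat.cast_eq_zero,
      Finset.card_eq_zero] at h1
    exact h1.resolve_left Finset.univ_nonempty.ne_empty
  have hF0 := ae_eq_zero_of_integral_expFun hFm hFL fun n => by
    obtain ⟨q, hq⟩ := exists_polyFun_eq_evenExpFun n
    rw [← integral_mul_star_evenExpFun hFinv hFi n Finset.univ, ← hq, hall]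
  filter_upwards [ae_restrict_of_ae_restrict_of_subset (chamber_subset_unitCube N) hF0,
    ae_restrict_of_ae (ae_isRegular N)] with x hx hreg
  simpa [F, (groundState_ne_zero_iff hl hl0 hl1).mpr hreg] using hx

/-! ### The initial domain -/

section

/-- The symmetric polynomials, as a space of coordinates for the initial domain. -/
abbrev symmPoly (N : ℕ) : Submodule ℂ (MvPolynomial (Fin N) ℂ) :=
  Subalgebra.toSubmodule (MvPolynomial.symmetricSubalgebra (Fin N) ℂ)

theorem measurable_state {N : ℕ} (l : ℝ) (lc : Fin 4 → ℝ) (q : MvPolynomial (Fin N) ℂ) :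
    Measurable fun x => groundState l lc x * polyFun q x :=
  (measurable_groundState l lc).mul (contDiff_polyFun q (n := 1)).continuous.measurable

theorem memLp_state {N : ℕ} {l : ℝ} {lc : Fin 4 → ℝ} (hl : 0 ≤ l)
    (hl0 : 0 ≤ lc 0) (hl1 : 0 ≤ lc 1) (q : MvPolynomial (Fin N) ℂ) :
    MemLp (fun x => groundState l lc x * polyFun q x) 2 (volume.restrict (chamber N)) := by
  obtain ⟨C, hC⟩ := (isCompact_Icc (a := (0 : Fin N → ℝ)) (b := 1)).exists_bound_of_continuousOn
    (contDiff_polyFun q (n := 1)).continuous.continuousOn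
  refine MemLp.of_bound (measurable_state l lc q).aestronglyMeasurable C ?_
  refine (ae_restrict_iff' (measurableSet_chamber N)).mpr (ae_of_all _ fun x hx => ?_)
  rw [norm_mul]
  refine (mul_le_of_le_one_left (norm_nonneg _) (norm_groundState_le_one hl hl0 hl1 x)).trans
    (hC x ⟨fun j => (hx.1 j).1.le, fun j => (hx.1 j).2.le⟩)

theorem IsInvariant.aeInvariant {N : ℕ} {h : (Fin N → ℝ) → ℂ} (hi : IsInvariant h) :
    AEInvariant h :=
  ⟨fun i j => ae_of_all _ (hi.swap i j), fun i => ae_of_all _ (hi.neg i),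
    fun n => ae_of_all _ (hi.translate n)⟩

theorem aeInvariant_state {N : ℕ} (l : ℝ) (lc : Fin 4 → ℝ) {q : MvPolynomial (Fin N) ℂ}
    (hq : q.IsSymmetric) :
    AEInvariant fun x => groundState l lc x * polyFun q x / groundState l lc x := by
  classical
  have h : (fun x => groundState l lc x * polyFun q x / groundState l lc x) =
      fun x => if weight l lc x = 0 then 0 else polyFun q x := by
    funext x
    by_cases h0 : groundState l lc x = 0
    · simp [weight, h0]
    · simp [weight, h0]
  rw [h]
  have hw := isInvariant_weight (N := N) l lc
  have hp := isInvariant_polyFun hq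
  exact IsInvariant.aeInvariant ⟨fun i j x => by rw [hw.swap, hp.swap],
    fun i x => by rw [hw.neg, hp.neg], fun n x => by rw [hw.translate, hp.translate]⟩

/-- The map sending a symmetric polynomial `q` to the class of `Φ_T P`, where `P` is the value of
`q` at the cosines. -/
def stateMap {N : ℕ} {l : ℝ} {lc : Fin 4 → ℝ} (hl : 0 ≤ l) (hl0 : 0 ≤ lc 0) (hl1 : 0 ≤ lc 1) :
    symmPoly N →ₗ[ℂ] hilbert N l lc where
  toFun q := ⟨(memLp_state hl hl0 hl1 q.1).toLp, _, measurable_state l lc q.1,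
    aeInvariant_state l lc q.2, MemLp.coeFn_toLp _⟩
  map_add' q r := by
    refine Subtype.ext ?_
    change MemLp.toLp _ (memLp_state hl hl0 hl1 _) = MemLp.toLp _ (memLp_state hl hl0 hl1 _) +
      MemLp.toLp _ (memLp_state hl hl0 hl1 _)
    rw [← MemLp.toLp_add]
    refine MemLp.toLp_congr _ _ (ae_of_all _ fun x => ?_)
    simp only [Submodule.coe_add, polyFun_add, mul_add, Pi.add_apply]
  map_smul' c q := by
    refine Subtype.ext ?_
    change MemLp.toLp _ (memLp_state hl hl0 hl1 _) = c • MemLp.toLp _ (memLp_state hl hl0 hl1 _)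
    rw [← MemLp.toLp_const_smul]
    refine MemLp.toLp_congr _ _ (ae_of_all _ fun x => ?_)
    simp only [Submodule.coe_smul, polyFun_smul, Pi.smul_apply, smul_eq_mul]
    ring

variable {N : ℕ} {l : ℝ} {lc : Fin 4 → ℝ} (hl : 0 ≤ l) (hl0 : 0 ≤ lc 0) (hl1 : 0 ≤ lc 1)

theorem coeFn_stateMap (q : symmPoly N) :
    ((stateMap hl hl0 hl1 q : Lp ℂ 2 (volume.restrict (chamber N))) : (Fin N → ℝ) → ℂ)
      =ᵐ[volume.restrict (chamber N)] fun x => groundState l lc x * polyFun q.1 x :=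
  MemLp.coeFn_toLp (memLp_state hl hl0 hl1 q.1)

theorem inner_stateMap_left (q : symmPoly N) (u : hilbert N l lc) {g : (Fin N → ℝ) → ℂ}
    (hg : ((u : Lp ℂ 2 (volume.restrict (chamber N))) : (Fin N → ℝ) → ℂ)
      =ᵐ[volume.restrict (chamber N)] g) :
    inner ℂ (stateMap hl hl0 hl1 q) u =
      ∫ x in chamber N, g x * star (groundState l lc x * polyFun q.1 x) := by
  rw [Submodule.coe_inner, L2.inner_def]
  refine integral_congr_ae ?_
  filter_upwards [coeFn_stateMap hl hl0 hl1 q, hg] with x h1 h2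
  rw [h1, h2]
  rfl

theorem inner_stateMap (q r : symmPoly N) :
    inner ℂ (stateMap hl hl0 hl1 q) (stateMap hl hl0 hl1 r) =
      ∫ x in chamber N, weight l lc x * polyFun r.1 x * star (polyFun q.1 x) := by
  rw [inner_stateMap_left hl hl0 hl1 q _ (coeFn_stateMap hl hl0 hl1 r)]
  refine integral_congr_ae (ae_of_all _ fun x => ?_)
  simp only [weight, Complex.star_def, Complex.ofReal_pow, map_mul]
  rw [← Complex.conj_mul']
  ring

theorem denseRange_stateMap : DenseRange (stateMap (N := N) hl hl0 hl1) := by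
  have h : (LinearMap.range (stateMap (N := N) hl hl0 hl1)).topologicalClosure = ⊤ := by
    rw [Submodule.topologicalClosure_eq_top_iff, Submodule.eq_bot_iff]
    rintro ⟨u, g, hgm, hgi, hug⟩ hu
    have hgL : MemLp g 2 (volume.restrict (chamber N)) := (Lp.memLp u).ae_eq hug
    have hg0 := ae_eq_zero_of_integral_groundState hl hl0 hl1 hgm hgi hgL fun q hq => by
      rw [← inner_stateMap_left hl hl0 hl1 ⟨q, hq⟩ ⟨u, g, hgm, hgi, hug⟩ hug]
      exact hu _ (LinearMap.mem_range_self _ _)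
    refine Subtype.ext (Lp.ext ?_)
    exact (hug.trans hg0).trans (Lp.coeFn_zero ℂ 2 _).symm
  rw [DenseRange, ← LinearMap.coe_range]
  exact Submodule.dense_iff_topologicalClosure_eq_top.mpr h

/-- The operator `q ↦ L q + c q` on symmetric polynomials, where `L` is the gauged operator. -/
def gaugeEnd (N : ℕ) (l : ℝ) (lc : Fin 4 → ℝ) (c : ℝ) : symmPoly N →ₗ[ℂ] symmPoly N :=
  (gaugeOp l lc).restrict (fun _ hq => isSymmetric_gaugeOp l lc hq) + (c : ℂ) • LinearMap.id

theorem coe_gaugeEnd (c : ℝ) (q : symmPoly N) :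
    (gaugeEnd N l lc c q).1 = gaugeOp l lc q.1 + (c : ℂ) • q.1 := rfl

theorem inner_stateMap_gaugeEnd (c : ℝ) (q r : symmPoly N) :
    inner ℂ (stateMap hl hl0 hl1 (gaugeEnd N l lc c q)) (stateMap hl hl0 hl1 r) =
      inner ℂ (stateMap hl hl0 hl1 q) (stateMap hl hl0 hl1 (gaugeEnd N l lc c r)) := by
  have h : inner ℂ (stateMap hl hl0 hl1 (gaugeEnd N l lc 0 q)) (stateMap hl hl0 hl1 r) =
      inner ℂ (stateMap hl hl0 hl1 q) (stateMap hl hl0 hl1 (gaugeEnd N l lc 0 r)) := by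
    rw [inner_stateMap, inner_stateMap, coe_gaugeEnd, coe_gaugeEnd]
    simp only [Complex.ofReal_zero, zero_smul, add_zero]
    exact (integral_weight_mul_star hl hl0 hl1 q.2 r.2).symm
  have hc : ∀ q, gaugeEnd N l lc c q = gaugeEnd N l lc 0 q + (c : ℂ) • q := by
    intro q
    refine Subtype.ext ?_
    simp [coe_gaugeEnd]
  have h1 := inner_smul_left (𝕜 := ℂ) (stateMap hl hl0 hl1 q) (stateMap hl hl0 hl1 r) c
  have h2 := inner_smul_right (𝕜 := ℂ) (stateMap hl hl0 hl1 q) (stateMap hl hl0 hl1 r) c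
  rw [Complex.conj_ofReal] at h1
  rw [hc, hc, map_add, map_add, inner_add_left, inner_add_right, h, map_smul, map_smul]
  exact congrArg _ (h1.trans h2.symm)

/-- The symmetric polynomials of total degree at most `d`. -/
def symmPolyDegreeLE (N d : ℕ) : Submodule ℂ (symmPoly N) :=
  (MvPolynomial.restrictTotalDegree (Fin N) ℂ d).comap (symmPoly N).subtype

instance (d : ℕ) : FiniteDimensional ℂ (symmPolyDegreeLE N d) := by
  let f : symmPolyDegreeLE N d →ₗ[ℂ] MvPolynomial.restrictTotalDegree (Fin N) ℂ d :=
    (symmPoly N).subtype.restrict fun _ h => h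
  refine Module.Finite.of_injective f fun a b h => ?_
  exact Subtype.ext (Subtype.ext (congrArg (fun z => z.1) h))

theorem gaugeEnd_mem (c : ℝ) (d : ℕ) {q : symmPoly N} (hq : q ∈ symmPolyDegreeLE N d) :
    gaugeEnd N l lc c q ∈ symmPolyDegreeLE N d := by
  have hq' : q.1 ∈ MvPolynomial.restrictTotalDegree (Fin N) ℂ d := hq
  change gaugeOp l lc q.1 + (c : ℂ) • q.1 ∈ MvPolynomial.restrictTotalDegree (Fin N) ℂ d
  refine add_mem ?_ (Submodule.smul_mem _ _ hq')
  rw [MvPolynomial.mem_restrictTotalDegree] at hq' ⊢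
  exact totalDegree_gaugeOp_le l lc hq'

/-- The graph of `H(0)` on its initial domain. -/
def trigGraph (c : ℝ) : Submodule ℂ (hilbert N l lc × hilbert N l lc) :=
  LinearMap.range ((stateMap hl hl0 hl1).prod (stateMap hl hl0 hl1 ∘ₗ gaugeEnd N l lc c))

/-- `H(0)` is essentially self-adjoint. -/
theorem adjoint_trigGraph (c : ℝ) :
    (trigGraph (N := N) hl hl0 hl1 c).adjoint = (trigGraph hl hl0 hl1 c).topologicalClosure := by
  refine adjoint_range_eq_topologicalClosure _ _ (inner_stateMap_gaugeEnd hl hl0 hl1 c)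
    (denseRange_stateMap hl hl0 hl1) (symmPolyDegreeLE N)
    (fun d a ha => ⟨_, gaugeEnd_mem c d ha, rfl⟩) fun a => ⟨a.1.totalDegree, ?_⟩
  change a.1 ∈ MvPolynomial.restrictTotalDegree (Fin N) ℂ _
  rw [MvPolynomial.mem_restrictTotalDegree]

/-- Conjugation by the ground state turns `H(0)` into the gauged operator plus a constant. -/
theorem exists_schrodinger_state (N : ℕ) {l : ℝ} {lc : Fin 4 → ℝ} (hl : 0 ≤ l) (hl0 : 0 ≤ lc 0)
    (hl1 : 0 ≤ lc 1) : ∃ c : ℝ, ∀ (q : symmPoly N) (U : (Fin N → ℝ) → ℂ) (x : Fin N → ℝ),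
      IsRegular x → schrodinger U (fun x => groundState l lc x * polyFun q.1 x) x =
        groundState l lc x * polyFun (gaugeEnd N l lc c q).1 x +
          (U x - ((trigPotential l lc x + trigConst N l lc : ℝ) : ℂ)) *
            (groundState l lc x * polyFun q.1 x) := by
  obtain ⟨E, hE⟩ := exists_sum_drift_sq_add_driftDeriv N l lc
  refine ⟨trigConst N l lc - E, fun q U x hx => ?_⟩
  have h1 := hE x hx
  have h2 := congrArg Complex.ofReal h1
  rw [Complex.ofReal_sum] at h2
  simp only [schrodinger, iteratedDeriv_groundState_mul hl hl0 hl1 hx]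
  rw [coe_gaugeEnd, polyFun_add, polyFun_smul, polyFun_gaugeOp l lc q.2 hx, ← Finset.mul_sum]
  simp only [add_assoc]
  rw [Finset.sum_add_distrib, ← Finset.sum_mul, h2]
  push_cast
  ring

end

/-! ### The perturbation -/

section

/-- The compression of bounded operators to a complete subspace. -/
def compression {X : Type*} [NormedAddCommGroup X] [InnerProductSpace ℂ X] (K : Submodule ℂ X)
    [CompleteSpace K] : (X →L[ℂ] X) →L[ℂ] (K →L[ℂ] K) :=
  (ContinuousLinearMap.compL ℂ K X K K.orthogonalProjectionOnto).comp
    ((ContinuousLinearMap.compL ℂ K X X).flip K.subtypeL)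

/-- Multiplication by a bounded continuous function on `L²` of the chamber. -/
def mulLp (N : ℕ) : BoundedContinuousFunction (Fin N → ℝ) ℂ →L[ℂ]
    (Lp ℂ 2 (volume.restrict (chamber N)) →L[ℂ] Lp ℂ 2 (volume.restrict (chamber N))) :=
  ((ContinuousLinearMap.mul ℂ ℂ).holderL (volume.restrict (chamber N)) ⊤ 2 2).comp
    (BoundedContinuousFunction.toLp (E := ℂ) ⊤ (volume.restrict (chamber N)) ℂ)

/-- Multiplication by a bounded continuous function, compressed to the Hilbert space.  The
compression is immaterial for invariant functions, and makes the map linear in the function. -/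
def multOp (N : ℕ) (l : ℝ) (lc : Fin 4 → ℝ) :
    BoundedContinuousFunction (Fin N → ℝ) ℂ →L[ℂ] (hilbert N l lc →L[ℂ] hilbert N l lc) :=
  (compression (hilbert N l lc)).comp (mulLp N)

variable {N : ℕ} {l : ℝ} {lc : Fin 4 → ℝ}

theorem coeFn_multOp {f : BoundedContinuousFunction (Fin N → ℝ) ℂ} (hf : IsInvariant f)
    (u : hilbert N l lc) :
    ((multOp N l lc f u : Lp ℂ 2 (volume.restrict (chamber N))) : (Fin N → ℝ) → ℂ)
      =ᵐ[volume.restrict (chamber N)]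
        fun x => f x * (u : Lp ℂ 2 (volume.restrict (chamber N))) x := by
  let v : Lp ℂ 2 (volume.restrict (chamber N)) := (ContinuousLinearMap.mul ℂ ℂ).holder 2
    (BoundedContinuousFunction.toLp ⊤ (volume.restrict (chamber N)) ℂ f) u.1
  have hv : v =ᵐ[volume.restrict (chamber N)]
      fun x => f x * (u : Lp ℂ 2 (volume.restrict (chamber N))) x := by
    filter_upwards [(ContinuousLinearMap.mul ℂ ℂ).coeFn_holder (r := 2)
      (BoundedContinuousFunction.toLp ⊤ (volume.restrict (chamber N)) ℂ f) u.1,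
      BoundedContinuousFunction.coeFn_toLp ⊤ (volume.restrict (chamber N)) ℂ f] with x h1 h2
    rw [h1, h2]
    rfl
  have hmem : v ∈ hilbert N l lc := by
    obtain ⟨g, hg, hgi, hug⟩ := u.2
    refine ⟨fun x => f x * g x, f.continuous.measurable.mul hg, ⟨fun i j => ?_, fun i => ?_,
      fun n => ?_⟩, hv.trans ?_⟩
    · filter_upwards [hgi.swap i j] with x hx
      rw [mul_div_assoc, mul_div_assoc, hx, hf.swap]
    · filter_upwards [hgi.neg i] with x hx
      rw [mul_div_assoc, mul_div_assoc, hx, hf.neg]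
    · filter_upwards [hgi.translate n] with x hx
      rw [mul_div_assoc, mul_div_assoc, hx, hf.translate]
    · filter_upwards [hug] with x hx
      rw [hx]
  have h : multOp N l lc f u = ⟨v, hmem⟩ :=
    (hilbert N l lc).orthogonalProjectionOnto_mem_subspace_eq_self ⟨v, hmem⟩
  rw [h]
  exact hv

theorem inner_multOp {f : BoundedContinuousFunction (Fin N → ℝ) ℂ} (hf : IsInvariant f)
    (hr : ∀ x, star (f x) = f x) (u v : hilbert N l lc) :
    inner ℂ (multOp N l lc f u) v = inner ℂ u (multOp N l lc f v) := by
  rw [Submodule.coe_inner, Submodule.coe_inner, L2.inner_def, L2.inner_def]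
  refine integral_congr_ae ?_
  filter_upwards [coeFn_multOp hf u, coeFn_multOp hf v] with x h1 h2
  have h3 : (starRingEnd ℂ) (f x) = f x := hr x
  simp only [h1, h2, RCLike.inner_apply, map_mul, h3]
  ring

/-- The potentials of `H(p)` and `H(0)` differ by a bounded continuous function that is
holomorphic in `p`. -/
theorem exists_perturbation (N : ℕ) (l : ℝ) (lc : Fin 4 → ℝ) :
    ∃ W : ℂ → BoundedContinuousFunction (Fin N → ℝ) ℂ,
      (∀ u, DifferentiableOn ℂ (fun p => multOp N l lc (W p) u) (Metric.ball 0 1)) ∧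
      ∀ p, ‖p‖ < 1 → IsInvariant (W p) ∧
        (∀ x, IsRegular x → nomePotential l lc p x -
          ((trigPotential l lc x + trigConst N l lc : ℝ) : ℂ) = W p x) ∧
        (star p = p → ∀ x, star (W p x) = W p x) := by
  obtain ⟨V, M, hc, hi, hb, hs, h0, hV⟩ := exists_potential_expansion N l lc
  have hM : ∀ k, 0 ≤ M k := fun k => (abs_nonneg _).trans (hb k 0)
  let Vb : ℕ → BoundedContinuousFunction (Fin N → ℝ) ℂ := fun k =>
    BoundedContinuousFunction.ofNormedAddCommGroup (fun x => (V k x : ℂ))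
      (Complex.continuous_ofReal.comp (hc k)) (M k) fun x => by
        rw [Complex.norm_real]
        exact hb k x
  have hVb : ∀ k, ‖Vb k‖ ≤ M k := fun k =>
    BoundedContinuousFunction.norm_ofNormedAddCommGroup_le _ (hM k) _
  have hle : ∀ (k : ℕ) (p : ℂ) (r : ℝ), ‖p‖ ≤ r → ‖p ^ k • Vb k‖ ≤ M k * r ^ k := by
    intro k p r hp
    rw [norm_smul, norm_pow, mul_comm]
    exact mul_le_mul (hVb k) (pow_le_pow_left₀ (norm_nonneg p) hp k) (by positivity) (hM k)
  have hsumW : ∀ p : ℂ, ‖p‖ < 1 → HasSum (fun k => p ^ k • Vb k) (∑' k, p ^ k • Vb k) :=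
    fun p hp => (Summable.of_norm_bounded (hs ‖p‖ (norm_nonneg p) hp)
      fun k => hle k p ‖p‖ le_rfl).hasSum
  have hsum : ∀ p : ℂ, ‖p‖ < 1 → ∀ x, HasSum (fun k => (V k x : ℂ) * p ^ k)
      ((∑' k, p ^ k • Vb k) x) := by
    intro p hp x
    have h2 := (BoundedContinuousFunction.evalCLM ℂ x).hasSum (hsumW p hp)
    refine h2.congr_fun fun k => ?_
    exact mul_comm _ _
  refine ⟨fun p => ∑' k, p ^ k • Vb k, fun u p hp => ?_, fun p hp => ⟨?_, fun x hx => ?_,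
    fun hpr x => ?_⟩⟩
  · obtain ⟨r, hpr, hr1⟩ := exists_between (mem_ball_zero_iff.mp hp)
    have hr0 : 0 ≤ r := (norm_nonneg p).trans hpr.le
    let L : BoundedContinuousFunction (Fin N → ℝ) ℂ →L[ℂ] hilbert N l lc :=
      (ContinuousLinearMap.apply ℂ (hilbert N l lc) u).comp (multOp N l lc)
    have hLW : ∀ w ∈ Metric.ball (0 : ℂ) 1,
        multOp N l lc (∑' k, w ^ k • Vb k) u = ∑' k, w ^ k • L (Vb k) := by
      intro w hw
      refine ((L.hasSum (hsumW w (mem_ball_zero_iff.mp hw))).congr_fun fun k => ?_).tsum_eq.symm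
      exact (L.map_smul _ _).symm
    have hd : DifferentiableOn ℂ (fun w : ℂ => ∑' k, w ^ k • L (Vb k)) (Metric.ball 0 r) := by
      refine Complex.differentiableOn_tsum_of_summable_norm ((hs r hr0 hr1).mul_left ‖L‖)
        (fun k => ?_) Metric.isOpen_ball fun k w hw => ?_
      · exact (Differentiable.smul_const (by fun_prop) (L (Vb k))).differentiableOn
      · rw [← L.map_smul]
        exact (L.le_opNorm _).trans (mul_le_mul_of_nonneg_left
          (hle k w r (mem_ball_zero_iff.mp hw).le) (norm_nonneg L))
    refine DifferentiableWithinAt.congr (f := fun w : ℂ => ∑' k, w ^ k • L (Vb k)) ?_ hLW (hLW p hp)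
    exact (hd.differentiableAt
      (Metric.isOpen_ball.mem_nhds (mem_ball_zero_iff.mpr hpr))).differentiableWithinAt
  · constructor
    · intro i j x
      refine (hsum p hp _).unique ((hsum p hp x).congr_fun fun k => ?_)
      rw [(hi k).swap]
    · intro i x
      refine (hsum p hp _).unique ((hsum p hp x).congr_fun fun k => ?_)
      rw [(hi k).neg]
    · intro n x
      refine (hsum p hp _).unique ((hsum p hp x).congr_fun fun k => ?_)
      rw [(hi k).translate]
  · by_cases hp0 : p = 0
    · subst hp0
      have h1 := hsum 0 hp x
      have h2 : HasSum (fun k => (V k x : ℂ) * (0 : ℂ) ^ k) 0 := by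
        refine hasSum_zero.congr_fun fun k => ?_
        cases k with
        | zero => simp [h0]
        | succ k => simp
      rw [h1.unique h2, nomePotential, dif_neg (fun h => h.1 rfl), sub_self]
    · have h1 := hV (tauOfNome p hp0 hp) x hx
      have he : Complex.exp (Real.pi * Complex.I * (tauOfNome p hp0 hp : ℂ)) = p := by
        have := Function.Periodic.qParam_right_inv (h := 2) two_ne_zero hp0
        refine Eq.trans ?_ this
        rw [Function.Periodic.qParam]
        congr 1
        change Real.pi * Complex.I * Function.Periodic.invQParam 2 p = _
        push_cast
        ring
      rw [he] at h1
      rw [nomePotential, dif_pos ⟨hp0, hp⟩]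
      exact h1.unique (hsum p hp x)
  · refine (hsum p hp x).star.unique ((hsum p hp x).congr_fun fun k => ?_)
    rw [star_mul', star_pow, hpr, Complex.star_def, Complex.conj_ofReal]

/-! ### The operators as perturbations of `H(0)` -/

/-- On the initial domain `H(p)` is a bounded perturbation of `H(0)`. -/
theorem coeFn_stateMap_gaugeEnd_add (hl : 0 ≤ l) (hl0 : 0 ≤ lc 0) (hl1 : 0 ≤ lc 1)
    {c : ℝ} (hc : ∀ (q : symmPoly N) (U : (Fin N → ℝ) → ℂ) (x : Fin N → ℝ),
      IsRegular x → schrodinger U (fun x => groundState l lc x * polyFun q.1 x) x =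
        groundState l lc x * polyFun (gaugeEnd N l lc c q).1 x +
          (U x - ((trigPotential l lc x + trigConst N l lc : ℝ) : ℂ)) *
            (groundState l lc x * polyFun q.1 x)) {p : ℂ}
    {f : BoundedContinuousFunction (Fin N → ℝ) ℂ} (hf : IsInvariant f)
    (hfp : ∀ x, IsRegular x → nomePotential l lc p x -
      ((trigPotential l lc x + trigConst N l lc : ℝ) : ℂ) = f x) (q : symmPoly N) :
    ((stateMap hl hl0 hl1 (gaugeEnd N l lc c q) +
      multOp N l lc f (stateMap hl hl0 hl1 q) : hilbert N l lc) :
        Lp ℂ 2 (volume.restrict (chamber N))) =ᵐ[volume.restrict (chamber N)]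
      schrodinger (nomePotential l lc p) (fun x => groundState l lc x * polyFun q.1 x) := by
  refine (Lp.coeFn_add _ _).trans ?_
  filter_upwards [coeFn_stateMap hl hl0 hl1 (gaugeEnd N l lc c q), coeFn_stateMap hl hl0 hl1 q,
    coeFn_multOp hf (stateMap hl hl0 hl1 q), ae_restrict_of_ae (ae_isRegular N)] with x h1 h2 h3 hx
  rw [Pi.add_apply, h1, h3, h2, hc q _ x hx, hfp x hx]

/-- The relation that generates the graph of `H(p)` is already a subspace, the graph of `H(0)`
plus a bounded operator. -/
theorem generators_eq_shearGraph (hl : 0 ≤ l) (hl0 : 0 ≤ lc 0) (hl1 : 0 ≤ lc 1)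
    {c : ℝ} (hc : ∀ (q : symmPoly N) (U : (Fin N → ℝ) → ℂ) (x : Fin N → ℝ),
      IsRegular x → schrodinger U (fun x => groundState l lc x * polyFun q.1 x) x =
        groundState l lc x * polyFun (gaugeEnd N l lc c q).1 x +
          (U x - ((trigPotential l lc x + trigConst N l lc : ℝ) : ℂ)) *
            (groundState l lc x * polyFun q.1 x)) {p : ℂ}
    {f : BoundedContinuousFunction (Fin N → ℝ) ℂ} (hf : IsInvariant f)
    (hfp : ∀ x, IsRegular x → nomePotential l lc p x -
      ((trigPotential l lc x + trigConst N l lc : ℝ) : ℂ) = f x) :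
    {w : hilbert N l lc × hilbert N l lc | ∃ P ∈ invLaurent N,
    ((w.1 : Lp ℂ 2 (volume.restrict (chamber N))) : (Fin N → ℝ) → ℂ)
      =ᵐ[volume.restrict (chamber N)] (fun x => groundState l lc x * P x) ∧
    ((w.2 : Lp ℂ 2 (volume.restrict (chamber N))) : (Fin N → ℝ) → ℂ)
      =ᵐ[volume.restrict (chamber N)]
        schrodinger (nomePotential l lc p) (fun x => groundState l lc x * P x)} =
      shearGraph (trigGraph hl hl0 hl1 c) (multOp N l lc f) := by
  have key := coeFn_stateMap_gaugeEnd_add hl hl0 hl1 hc hf hfp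
  ext ⟨u, v⟩
  rw [SetLike.mem_coe, mem_shearGraph]
  constructor
  · rintro ⟨P, hP, hu, hv⟩
    obtain ⟨q, hq, rfl⟩ := exists_polyFun_of_mem_invLaurent hP
    have h1 : stateMap hl hl0 hl1 ⟨q, hq⟩ = u :=
      Subtype.ext (Lp.ext ((coeFn_stateMap hl hl0 hl1 ⟨q, hq⟩).trans hu.symm))
    have h2 : stateMap hl hl0 hl1 (gaugeEnd N l lc c ⟨q, hq⟩) +
        multOp N l lc f (stateMap hl hl0 hl1 ⟨q, hq⟩) = v :=
      Subtype.ext (Lp.ext ((key ⟨q, hq⟩).trans hv.symm))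
    refine ⟨⟨q, hq⟩, Prod.ext h1 ?_⟩
    change stateMap hl hl0 hl1 (gaugeEnd N l lc c ⟨q, hq⟩) = v - multOp N l lc f u
    rw [← h2, h1, add_sub_cancel_right]
  · rintro ⟨q, hq⟩
    have h1 : stateMap hl hl0 hl1 q = u := congrArg Prod.fst hq
    have h2 : stateMap hl hl0 hl1 (gaugeEnd N l lc c q) = v - multOp N l lc f u :=
      congrArg Prod.snd hq
    refine ⟨polyFun q.1, polyFun_mem_invLaurent q.2, ?_, ?_⟩
    · rw [← h1]
      exact coeFn_stateMap hl hl0 hl1 q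
    · have h3 := key q
      rwa [h1, h2, sub_add_cancel] at h3

end

/-! ### Closures -/

section

variable {N : ℕ} {l : ℝ} {lc : Fin 4 → ℝ} (hl : 0 ≤ l) (hl0 : 0 ≤ lc 0) (hl1 : 0 ≤ lc 1)

theorem dense_fst_trigGraph (c : ℝ) :
    Dense {u : hilbert N l lc | ∃ y ∈ trigGraph hl hl0 hl1 c, u = y.1} := by
  refine (denseRange_stateMap hl hl0 hl1).mono ?_
  rintro _ ⟨q, rfl⟩
  exact ⟨_, LinearMap.mem_range_self _ q, rfl⟩

/-- The perturbed operators are well defined and closable. -/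
theorem snd_eq_zero_of_mem_closure_shearGraph (c : ℝ) (B : hilbert N l lc →L[ℂ] hilbert N l lc) :
    ∀ x ∈ (shearGraph (trigGraph hl hl0 hl1 c) B).topologicalClosure, x.1 = 0 → x.2 = 0 := by
  intro x hx h
  rw [topologicalClosure_shearGraph, mem_shearGraph, ← adjoint_trigGraph] at hx
  have := snd_eq_zero_of_mem_adjoint (dense_fst_trigGraph hl hl0 hl1 c) hx h
  simpa [h] using this

end

end

end Inozemtsev

theorem mainTheorem3 (N : ℕ) (l : ℝ) (lc : Fin 4 → ℝ)
    (hl : 0 ≤ l) (hl0 : 0 ≤ lc 0) (hl1 : 0 ≤ lc 1) :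
    -- the expansion of `H(p)`: a bounded multiplication operator analytic in `p` is added
    (∃ (V : ℕ → (Fin N → ℝ) → ℝ) (M : ℕ → ℝ),
      (∀ k, Continuous (V k)) ∧ (∀ k x, |V k x| ≤ M k) ∧
      (∀ r : ℝ, 0 ≤ r → r < 1 → Summable fun k => M k * r ^ k) ∧
      ∀ (τ : UpperHalfPlane) (x : Fin N → ℝ), Inozemtsev.groundState l lc x ≠ 0 →
        HasSum (fun k : ℕ => (V (k + 1) x : ℂ) *
            Complex.exp (Real.pi * Complex.I * (τ : ℂ)) ^ (k + 1))
          (Inozemtsev.ellipticPotential l lc τ x -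
            ((Inozemtsev.trigPotential l lc x + Inozemtsev.trigConst N l lc : ℝ) : ℂ))) ∧
    -- `H(p)` is a well-defined, densely defined operator in the Hilbert space
    (∀ p : ℂ, ‖p‖ < 1 →
      Dense ((Inozemtsev.hamiltonian N l lc p).domain : Set (Inozemtsev.hilbert N l lc)) ∧
      ∀ P ∈ Inozemtsev.invLaurent N, ∃ u : (Inozemtsev.hamiltonian N l lc p).domain,
        (((u : Inozemtsev.hilbert N l lc) :
            MeasureTheory.Lp ℂ 2 (MeasureTheory.volume.restrict (Inozemtsev.chamber N))) :
            (Fin N → ℝ) → ℂ)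
          =ᵐ[MeasureTheory.volume.restrict (Inozemtsev.chamber N)]
            (fun x => Inozemtsev.groundState l lc x * P x) ∧
        ((Inozemtsev.hamiltonian N l lc p u :
            MeasureTheory.Lp ℂ 2 (MeasureTheory.volume.restrict (Inozemtsev.chamber N))) :
            (Fin N → ℝ) → ℂ)
          =ᵐ[MeasureTheory.volume.restrict (Inozemtsev.chamber N)]
            Inozemtsev.schrodinger (Inozemtsev.nomePotential l lc p)
              (fun x => Inozemtsev.groundState l lc x * P x)) ∧
    -- for real `p` the closure is the unique self-adjoint extension of `H(p)`
    (∀ p : ℝ, -1 < p → p < 1 →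
      IsSelfAdjoint (Inozemtsev.closedHamiltonian N l lc p) ∧
      ∀ A : Inozemtsev.hilbert N l lc →ₗ.[ℂ] Inozemtsev.hilbert N l lc,
        IsSelfAdjoint A → Inozemtsev.hamiltonian N l lc p ≤ A →
          A = Inozemtsev.closedHamiltonian N l lc p) ∧
    -- the operators form a holomorphic family of type (A)
    Inozemtsev.IsHolomorphicFamilyTypeA (Metric.ball (0 : ℂ) 1)
      (Inozemtsev.closedHamiltonian N l lc) := by
  obtain ⟨c, hc⟩ := Inozemtsev.exists_schrodinger_state N hl hl0 hl1
  obtain ⟨W, hW, hWp⟩ := Inozemtsev.exists_perturbation N l lc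
  let G := Inozemtsev.trigGraph (N := N) hl hl0 hl1 c
  let B : ℂ → _ := fun p => Inozemtsev.multOp N l lc (W p)
  -- The generators of the graph of `H(p)` form a subspace, so that the span adds nothing.
  have hset := fun p (hp : ‖p‖ < 1) => Inozemtsev.generators_eq_shearGraph hl hl0 hl1 hc
    (hWp p hp).1 (hWp p hp).2.1
  have hham : ∀ p : ℂ, ‖p‖ < 1 → Inozemtsev.hamiltonian N l lc p =
      (Inozemtsev.shearGraph G (B p)).toLinearPMap := by
    intro p hp
    rw [Inozemtsev.hamiltonian, hset p hp, Submodule.span_eq]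
  have hzero := fun p => Inozemtsev.snd_eq_zero_of_mem_closure_shearGraph hl hl0 hl1 c (B p)
  have hzero' : ∀ p, ∀ x ∈ Inozemtsev.shearGraph G (B p), x.1 = 0 → x.2 = 0 := fun p x hx =>
    hzero p x (Submodule.le_topologicalClosure _ hx)
  have hgraph : ∀ p : ℂ, ‖p‖ < 1 → (Inozemtsev.hamiltonian N l lc p).graph =
      Inozemtsev.shearGraph G (B p) := fun p hp => by
    rw [hham p hp, Submodule.toLinearPMap_graph_eq _ (hzero' p)]
  have hcgraph : ∀ p : ℂ, ‖p‖ < 1 → (Inozemtsev.closedHamiltonian N l lc p).graph =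
      Inozemtsev.shearGraph G.topologicalClosure (B p) := fun p hp => by
    rw [Inozemtsev.closedHamiltonian, hham p hp, Inozemtsev.closure_toLinearPMap_graph (hzero p),
      Inozemtsev.topologicalClosure_shearGraph]
  have hdense : ∀ p : ℂ, ‖p‖ < 1 → Dense
      ((Inozemtsev.hamiltonian N l lc p).domain : Set (Inozemtsev.hilbert N l lc)) := by
    intro p hp
    rw [Inozemtsev.domain_eq_map_fst_of_graph_eq_shearGraph (hgraph p hp)]
    refine (Inozemtsev.dense_fst_trigGraph hl hl0 hl1 c).mono ?_
    rintro _ ⟨y, hy, rfl⟩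
    exact ⟨y, hy, rfl⟩
  refine ⟨?_, fun p hp => ⟨hdense p hp, fun P hP => ?_⟩, fun p hp hp1 => ?_, ?_⟩
  · obtain ⟨V, M, h1, -, h2, h3, h0, h4⟩ := Inozemtsev.exists_potential_expansion N l lc
    refine ⟨V, M, h1, h2, h3, fun τ x hx => ?_⟩
    have h5 := h4 τ x ((Inozemtsev.groundState_ne_zero_iff hl hl0 hl1).mp hx)
    simpa [h0] using (hasSum_nat_add_iff' 1).mpr h5
  · obtain ⟨q, hq, rfl⟩ := Inozemtsev.exists_polyFun_of_mem_invLaurent hP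
    let u := Inozemtsev.stateMap hl hl0 hl1 ⟨q, hq⟩
    let v := Inozemtsev.stateMap hl hl0 hl1 (Inozemtsev.gaugeEnd N l lc c ⟨q, hq⟩) + B p u
    have hmem : (u, v) ∈ Inozemtsev.shearGraph G (B p) := by
      rw [Inozemtsev.mem_shearGraph]
      exact ⟨⟨q, hq⟩, Prod.ext rfl (add_sub_cancel_right _ _).symm⟩
    rw [← hgraph p hp, LinearPMap.mem_graph_iff] at hmem
    obtain ⟨y, hy, hyv⟩ := hmem
    refine ⟨y, ?_, ?_⟩
    · rw [hy]
      exact Inozemtsev.coeFn_stateMap hl hl0 hl1 ⟨q, hq⟩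
    · rw [hyv]
      exact Inozemtsev.coeFn_stateMap_gaugeEnd_add hl hl0 hl1 hc (hWp p hp).1 (hWp p hp).2.1 ⟨q, hq⟩
  · have hp' : ‖(p : ℂ)‖ < 1 := by
      rw [Complex.norm_real]
      exact abs_lt.mpr ⟨hp, hp1⟩
    have hsymm := Inozemtsev.inner_multOp (l := l) (lc := lc) (hWp p hp').1
      ((hWp p hp').2.2 (Complex.conj_ofReal p))
    have hsa : IsSelfAdjoint (Inozemtsev.closedHamiltonian N l lc p) := by
      refine Inozemtsev.isSelfAdjoint_of_adjoint_graph ?_ ?_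
      · exact (hdense p hp').mono (Inozemtsev.hamiltonian N l lc p).le_closure.1
      · rw [hcgraph p hp', Inozemtsev.adjoint_shearGraph _ hsymm,
          Inozemtsev.adjoint_topologicalClosure, Inozemtsev.adjoint_trigGraph]
    exact ⟨hsa, fun A hA hle => Inozemtsev.eq_closure_of_isSelfAdjoint hsa hA hle⟩
  · refine ⟨Metric.isOpen_ball, (convex_ball (0 : ℂ) 1).isConnected
      (Metric.nonempty_ball.mpr one_pos), fun p hp => ?_,
      G.topologicalClosure.map (LinearMap.fst ℂ _ _), fun p hp => ?_, fun u hu => ?_⟩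
    · rw [LinearPMap.IsClosed, hcgraph p (mem_ball_zero_iff.mp hp),
        ← Inozemtsev.topologicalClosure_shearGraph]
      exact Submodule.isClosed_topologicalClosure _
    · exact Inozemtsev.domain_eq_map_fst_of_graph_eq_shearGraph
        (hcgraph p (mem_ball_zero_iff.mp hp))
    · obtain ⟨⟨u, v⟩, huv, rfl⟩ := hu
      refine ⟨fun p => v + B p u, fun p hp => ?_, fun p hp => ?_⟩
      · refine (differentiableWithinAt_const v).add ?_
        exact hW u p hp
      · rw [hcgraph p (mem_ball_zero_iff.mp hp), Inozemtsev.mem_shearGraph]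
        have h : v + B p u - Inozemtsev.multOp N l lc (W p) u = v := add_sub_cancel_right _ _
        change (u, v + B p u - Inozemtsev.multOp N l lc (W p) u) ∈ _
        rwa [h]
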